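/- **Setting.** Let $G=(V,E)$ be a finite connected undirected graph with at least two nodes, maximum degree $\Delta$ and distinct node ids; let $S\subseteq V$ be a set of $k$ sources, each with one rumor, and let $1\le c\le k$. A message (batch) carries at most $c$ rumors, all held by its sender. Time is slotted; in a slot a node receives the message of a neighbor $u$ iff $u$ is its only transmitting neighbor, it detects a collision if two or more neighbors transmit, and it hears silence otherwise. Let $m_{opt}$ be the minimum number of transmissions (interference being ignored), and $s_{opt}$ the minimum number of slots (with interference), in a centralized schedule that delivers all $k$ rumors to all nodes. Let $\mu>0$ be such that $\mu\Delta\ge 2$ is an integer. Let $D_0$ be a connected dominating set (CDS) of $G$ whose size is at most $\alpha$ times the minimum size of a CDS. A *backbone* for $D_0$ is a CDS $D\supseteq D_0$ with $|D|\le 3|D_0|$ and $\operatorname{diam}G[D]\le 4\operatorname{diam}G$, given together with a spanning arborescence of $G$ whose inner nodes are in $D$, rooted at some $r\in D$ and of height at most $\operatorname{diam}G[D]+1$. The cost of preparing the backbone is not counted. A *distributed protocol with randomized slot selection* works in frames of $2\mu\Delta$ slots. In each frame each node draws $x\in\{1,\dots,\mu\Delta\}$ uniformly, independently of all other draws; if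 it has a packet to send (own id, a header, a batch) it sends it in slot $x$. In slots $\mu\Delta+s$, $1\le s\le\mu\Delta$, nodes may send a content-free reply to what they heard in slot $s$ (such as an error message after a collision). All nodes run the same program, knowing initially only: their own id; whether they are sources and whether they are in $D$; the ids of their neighbors (and which of these are sources, which are in $D$); their parent and children in the arborescence; and $\Delta$, $\mu\Delta$, $k$, $c$, $\operatorname{diam}G$. **Theorem.** There are one distributed protocol with randomized slot selection (the same for all networks) and an absolute constant $C$ such that for all $G,S,c,\mu,\alpha,D_0$ as above a backbone for $D_0$ exists, and for every backbone $D$ for $D_0$ (with any such arborescence) the following holds, with $\delta=\max_{v\in D\cup S}\delta(v)$ the largest degree of a node of $D\cup S$. 1. The execution gathers the rumors at $r$ and then spreads them from $r$ along the backbone: only nodes of $D\cup S$ send packets; $r$ sends only when it holds all rumors; every other node sends only batches of rumors that originate in its own subtree, or batches that its parent has sent before. 2. The expected total number of transmissions, replies included, is at most $$C\,\alpha\, m_{opt}\, e^{2\delta/\mu}\bigl(1+\delta\,(1-e^{-1/\mu})\bigr).$$ 3. The expected number of slots until all nodes hold all rumors is at most $$C\, s_{opt}\,\mu\Delta\, e^{2\delta/\mu}.$$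 -/

import Mathlib

open MeasureTheory ProbabilityTheory
open scoped ENNReal

namespace RadioGossip

/-! ### One slot of the radio channel -/

/-- What a node with a collision detector perceives in one slot. -/
inductive Heard (β : Type) : Type
  | silence : Heard β
  | message (a : β) : Heard β
  | collision : Heard β

open Classical in
/-- Protocol interference model. In one slot, `tx u = some a` means that `u` transmits `a`. The node
`v` receives the message of its neighbour `u` iff `u` is the only neighbour of `v` that transmits; it
hears a collision if two or more of its neighbours transmit, and silence if none does. -/
noncomputable def heard {V β : Type} (G : SimpleGraph V) (tx : V → Option β) (v : V) : Heard β :=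
  if h : ∃ a, ∃ u, G.Adj v u ∧ tx u = some a ∧ ∀ w, G.Adj v w → (tx w).isSome → w = u then
    Heard.message h.choose
  else if ∃ u, G.Adj v u ∧ (tx u).isSome then Heard.collision
  else Heard.silence

/-! ### The optima of the multi-broadcast problem

A centralized schedule `σ` tells which batch of rumors (named by their sources) each node transmits
in each slot. -/

section Optimum

variable {V : Type} [Fintype V] [DecidableEq V]

/-- The rumors held after `t` slots when there is no interference: every neighbour's message is
received. -/
def idealKnown (G : SimpleGraph V) [DecidableRel G.Adj] (S : Finset V)
    (σ : ℕ → V → Option (Finset V)) : ℕ → V → Finset V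
  | 0, v => if v ∈ S then {v} else ∅
  | t + 1, v => idealKnown G S σ t v ∪ (G.neighborFinset v).biUnion fun u => (σ t u).getD ∅

/-- The rumors held after `t` slots under the protocol interference model. -/
noncomputable def radioKnown (G : SimpleGraph V) (S : Finset V)
    (σ : ℕ → V → Option (Finset V)) : ℕ → V → Finset V
  | 0, v => if v ∈ S then {v} else ∅
  | t + 1, v => radioKnown G S σ t v ∪
      (match heard G (σ t) v with
        | Heard.message b => b
        | _ => ∅)

/-- During the first `T` slots every transmitted batch has at most `c` rumors, all of them held by
the transmitting node. -/
def ValidSchedule (c : ℕ) (known : ℕ → V → Finset V) (σ : ℕ → V → Option (Finset V)) (T : ℕ) :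
    Prop :=
  ∀ t < T, ∀ v b, σ t v = some b → b ⊆ known t v ∧ b.card ≤ c

/-- `m_opt`: the least number of transmissions that brings all rumors to all nodes (interference
is not taken into account). -/
noncomputable def mOpt (G : SimpleGraph V) [DecidableRel G.Adj] (S : Finset V) (c : ℕ) : ℕ :=
  sInf {M | ∃ (T : ℕ) (σ : ℕ → V → Option (Finset V)),
    ValidSchedule c (idealKnown G S σ) σ T ∧ (∀ v, S ⊆ idealKnown G S σ T v) ∧
      M = ∑ t ∈ Finset.range T, (Finset.univ.filter fun v => (σ t v).isSome).card}

/-- `s_opt`: the least number of slots in which all rumors can be brought to all nodes under the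
protocol interference model. -/
noncomputable def sOpt (G : SimpleGraph V) (S : Finset V) (c : ℕ) : ℕ :=
  sInf {T | ∃ σ : ℕ → V → Option (Finset V),
    ValidSchedule c (radioKnown G S σ) σ T ∧ ∀ v, S ⊆ radioKnown G S σ T v}

end Optimum

/-! ### Backbones -/

section Backbone

variable {V : Type} [Fintype V] [DecidableEq V]

/-- Connected dominating sets. -/
def IsCDS (G : SimpleGraph V) (D : Finset V) : Prop :=
  (G.induce (D : Set V)).Connected ∧ ∀ v, v ∉ D → ∃ u ∈ D, G.Adj v u

/-- The size of a minimum connected dominating set. -/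
noncomputable def minCDS (G : SimpleGraph V) : ℕ :=
  sInf {N | ∃ D : Finset V, IsCDS G D ∧ D.card = N}

/-- `D` is a connected dominating set of bounded diameter obtained by enlarging the connected
dominating set `D₀`: at most three times as large, and of diameter at most four times that of the
graph. -/
def IsShortBackbone (G : SimpleGraph V) (D₀ D : Finset V) : Prop :=
  IsCDS G D ∧ D₀ ⊆ D ∧ D.card ≤ 3 * D₀.card ∧
    (G.induce (D : Set V)).diam ≤ 4 * G.diam

/-- A spanning arborescence of `G` whose inner nodes belong to the backbone `D`, of height at most
`diam D + 1`. -/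
structure Arborescence (G : SimpleGraph V) (D : Finset V) where
  root : V
  parent : V → V
  depth : V → ℕ
  root_mem : root ∈ D
  parent_root : parent root = root
  depth_root : depth root = 0
  parent_mem : ∀ v, v ≠ root → parent v ∈ D
  parent_adj : ∀ v, v ≠ root → G.Adj v (parent v)
  depth_parent : ∀ v, v ≠ root → depth v = depth (parent v) + 1
  depth_le : ∀ v, depth v ≤ (G.induce (D : Set V)).diam + 1

end Backbone

/-! ### Distributed protocols with randomized slot selection

Time is divided into frames of `2 m` slots. In each frame every node draws a number `x` uniformly
from the `m` possible ones. If it has something to send, it sends it in slot `x` of the frame. The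
last `m` slots of the frame are for content-free replies to what was heard in the first `m` slots:
a reply in slot `m + s` concerns slot `s`; the error message in slot `m + s` of a node that heard a
collision in slot `s` is of this kind. -/

/-- What a node knows at the beginning. Nodes and rumors are referred to by the ids of the nodes. -/
structure LocalView where
  id : ℕ
  isSource : Prop
  inBackbone : Prop
  /-- the parent in the arborescence, `none` for the root -/
  parent : Option ℕ
  children : Finset ℕ
  nbrs : Finset ℕ
  sourceNbrs : Finset ℕ
  backboneNbrs : Finset ℕ
  maxDegree : ℕ
  diameter : ℕ
  slots : ℕ
  numRumors : ℕ
  compression : ℕ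

/-- A transmitted message: id of the sender, a header, and a batch of rumors. -/
structure Packet where
  sender : ℕ
  header : ℕ
  batch : Finset ℕ

/-- A distributed protocol: the program that every node runs, on nothing but its own local view,
its own random numbers and what it hears. -/
structure Protocol where
  State : Type
  start : LocalView → State
  /-- header and batch to be sent in this frame, if any -/
  send : State → Option (ℕ × Finset ℕ)
  /-- the slots `m + s` in which to reply; arguments: state, number `m` of slots, own random number
  of this frame, what was heard in the first `m` slots of the frame, and `s` -/
  reply : State → (m : ℕ) → Fin m → (Fin m → Heard Packet) → Fin m → Bool
  /-- the state after the frame; arguments: state, number `m` of slots, own random number, what was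
  heard in the first `m` slots and in the last `m` slots of the frame -/
  update : State → (m : ℕ) → Fin m → (Fin m → Heard Packet) → (Fin m → Heard Unit) → State

/-- An instance of the problem, with the number `slots` and a backbone prepared in advance. -/
structure Network (V : Type) [Fintype V] [DecidableEq V] where
  graph : SimpleGraph V
  ident : V ↪ ℕ
  sources : Finset V
  compression : ℕ
  slots : ℕ
  backbone : Finset V
  tree : Arborescence graph backbone

/-- A global configuration: states of the nodes, and the rumors that they hold. -/
structure Config (P : Protocol) (V : Type) where
  state : V → P.State
  known : V → Finset ℕ

namespace Network

variable {V : Type} [Fintype V] [DecidableEq V] (N : Network V) (P : Protocol)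

open Classical in
noncomputable def view (v : V) : LocalView where
  id := N.ident v
  isSource := v ∈ N.sources
  inBackbone := v ∈ N.backbone
  parent := if v = N.tree.root then none else some (N.ident (N.tree.parent v))
  children := (Finset.univ.filter fun u => u ≠ N.tree.root ∧ N.tree.parent u = v).map N.ident
  nbrs := (N.graph.neighborFinset v).map N.ident
  sourceNbrs := (N.graph.neighborFinset v ∩ N.sources).map N.ident
  backboneNbrs := (N.graph.neighborFinset v ∩ N.backbone).map N.ident
  maxDegree := N.graph.maxDegree
  diameter := N.graph.diam
  slots := N.slots
  numRumors := N.sources.card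
  compression := N.compression

/-- The ids of all rumors. -/
def rumors : Finset ℕ := N.sources.map N.ident

/-- At the beginning only the sources hold a rumor, each its own. -/
noncomputable def initial : Config P V where
  state v := P.start (N.view v)
  known v := if v ∈ N.sources then {N.ident v} else ∅

variable {P}

/-- The packet that `v` sends in the current frame, if any. A node can only send batches of at most
`c` rumors, and only rumors that it holds. -/
def sent (cfg : Config P V) (v : V) : Option Packet :=
  match P.send (cfg.state v) with
  | none => none
  | some (h, b) =>
      if b ⊆ cfg.known v ∧ b.card ≤ N.compression then some ⟨N.ident v, h, b⟩ else none

/-- What `v` hears in slot `s` of the frame, if the nodes draw the numbers `x`. -/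
noncomputable def heardData (cfg : Config P V) (x : V → Fin N.slots) (v : V) (s : Fin N.slots) :
    Heard Packet :=
  heard N.graph (fun u => if x u = s then N.sent cfg u else none) v

/-- Whether `v` replies in slot `m + s` of the frame. -/
noncomputable def replies (cfg : Config P V) (x : V → Fin N.slots) (v : V) (s : Fin N.slots) :
    Bool :=
  P.reply (cfg.state v) N.slots (x v) (N.heardData cfg x v) s

/-- What `v` hears in slot `m + s` of the frame. -/
noncomputable def heardReply (cfg : Config P V) (x : V → Fin N.slots) (v : V) (s : Fin N.slots) :
    Heard Unit :=
  heard N.graph (fun u => if N.replies cfg x u s then some () else none) v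

/-- The configuration after the frame. -/
noncomputable def step (cfg : Config P V) (x : V → Fin N.slots) : Config P V where
  state v :=
    P.update (cfg.state v) N.slots (x v) (N.heardData cfg x v) (N.heardReply cfg x v)
  known v := cfg.known v ∪ Finset.univ.biUnion fun s : Fin N.slots =>
    match N.heardData cfg x v s with
    | Heard.message p => p.batch
    | _ => ∅

variable (P)

/-- The configuration after `t` frames, if node `v` draws the number `x i v` in frame `i`. -/
noncomputable def run (x : ℕ → V → Fin N.slots) : ℕ → Config P V
  | 0 => N.initial P
  | t + 1 => N.step (run x t) (x t)

/-- The number of transmissions in frame `t`, replies included. -/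
noncomputable def frameMessages (x : ℕ → V → Fin N.slots) (t : ℕ) : ℕ :=
  (Finset.univ.filter fun v => (N.sent (N.run P x t) v).isSome).card +
    (Finset.univ.filter fun q : V × Fin N.slots =>
      N.replies (N.run P x t) (x t) q.1 q.2 = true).card

/-- The number of all transmissions in the whole execution. -/
noncomputable def totalMessages (x : ℕ → V → Fin N.slots) : ℝ≥0∞ :=
  ∑' t, (N.frameMessages P x t : ℝ≥0∞)

/-- The number of slots until all nodes hold all rumors (`∞` if this never happens). -/
noncomputable def completionTime (x : ℕ → V → Fin N.slots) : ℝ≥0∞ :=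
  ⨅ (t : ℕ) (_ : ∀ v, N.rumors ⊆ (N.run P x t).known v), ((2 * N.slots * t : ℕ) : ℝ≥0∞)

/-- The execution gathers the rumors at the root and spreads them from there along the backbone:
only backbone nodes and sources send packets; the root sends only when it holds all rumors; any
other node sends either rumors that originate in its own subtree (upwards), or a batch that its
parent has sent before (downwards). -/
def GathersThenSpreads : Prop :=
  ∀ (x : ℕ → V → Fin N.slots) (t : ℕ) (v : V) (p : Packet), N.sent (N.run P x t) v = some p →
    v ∈ N.backbone ∪ N.sources ∧
    (v = N.tree.root → N.rumors ⊆ (N.run P x t).known v) ∧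
    (v ≠ N.tree.root →
      (∀ i ∈ p.batch, ∃ u ∈ N.sources, N.ident u = i ∧ ∃ j : ℕ, N.tree.parent^[j] u = v) ∨
      ∃ t' < t, ∃ q, N.sent (N.run P x t') (N.tree.parent v) = some q ∧ q.batch = p.batch)

end Network

/-- The numbers `X t v` drawn by the nodes `v` in the frames `t` are independent and uniform. -/
structure IsUniformDraw {V : Type} {m : ℕ} {Ω : Type} [MeasurableSpace Ω] (Pr : Measure Ω)
    (X : ℕ → V → Ω → Fin m) : Prop where
  measurable : ∀ t v, Measurable (X t v)
  indep : iIndepFun (fun q : ℕ × V => X q.1 q.2) Pr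
  uniform : ∀ t v s, Pr (X t v ⁻¹' {s}) = (m : ℝ≥0∞)⁻¹

end RadioGossip

/-! Write L for `numItems`, H for a bound on the depth of the arborescence, and recall that a round
consists of eight frames. Lower bounds. In every schedule the nodes that transmit a given rumor form
a connected dominating set, and a transmission counts for at most c rumors; so k times the minimum
size of a CDS is at most c m_opt (`card_mul_minCDS_le`), and k ≤ m_opt because every source must
transmit (`card_le_mOpt`). In a slot a rumor crosses at most one edge and a node gains at most c
rumors, so diam G and k/c are O(s_opt) (`diam_le_two_mul_sOpt`, `card_le_sOpt`). Hence |D| L = O(α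
m_opt) and H + L = O(s_opt), and it suffices to compare the protocol with these quantities. The
channel. In the slot in which a node sends, each neighbour hears its packet or a collision
(`hears_of_packet`). Thus one reply slot carries reliable information: an acknowledgement by the
parent, the report of a child that it is behind, or, by silence, the certainty that all neighbours
have the packet. A packet misses a given neighbour with probability at most ε ≤ 1/μ, and reaches all
neighbours with probability at least p ≥ exp(-3δ/(2μ)) (`exists_conflict_bounds`). Transmissions. A
potential that is linear in the batches still to be sent up, the items still to be confirmed and the
lags of the children decreases in the mean by at least the cost of each round
(`tsum_lintegral_cost_le`, `lintegral_totalMessages_le`). A node that is spreading causes O(1 + δε)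
transmissions per round in the amortized mean and gets a confirmation with probability at least p,
which gives the factor (1 + δε)/p. Time. Weights β^(level + remaining work) are summed over the
nodes. A node that has to wait weighs less, by a factor 1/β up to constants, than a neighbour in the
tree for which it waits; so waiting is nearly free, and the whole potential contracts in the mean by
some ρ < 1 per round (`avg_gatherPotential_le`, `avg_certWeight_le`, `avg_streamWeight_le`). Its
initial value is at most β^(3H + 2L + 2), so O((H + L) log β / log(1/ρ)) rounds suffice, up to a
final term 1/(1 - ρ) (`lintegral_completionTime_le_of_potential`). If δ ≥ 16 and ε²δ ≤ 1, the
analysis of the streaming frames allows β = δ³ and ρ = 2/√δ, and the quotient of logarithms is a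
constant. Otherwise the confirmations alone are used, with ρ = 1 - p/2 and β = 2(δ + 3)/p. The loss
of order log(δ/p)/p is then O(exp(2δ/μ)), because δ ≤ 16 or δ ≤ (δ/μ)² (`log_div_le`). -/

namespace RadioGossip

/-! ### Averages over finite types and chains driven by uniform draws -/

section Average

variable {Y : Type} [Fintype Y]

/-- The mean of a real function on a finite type. -/
noncomputable def avg (f : Y → ℝ) : ℝ := (∑ y, f y) / Fintype.card Y

theorem avg_mono {f g : Y → ℝ} (h : ∀ y, f y ≤ g y) : avg f ≤ avg g :=
  div_le_div_of_nonneg_right (Finset.sum_le_sum fun y _ => h y) (Nat.cast_nonneg _)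

theorem avg_nonneg {f : Y → ℝ} (h : ∀ y, 0 ≤ f y) : 0 ≤ avg f :=
  div_nonneg (Finset.sum_nonneg fun y _ => h y) (Nat.cast_nonneg _)

theorem avg_add (f g : Y → ℝ) : avg (fun y => f y + g y) = avg f + avg g := by
  simp [avg, Finset.sum_add_distrib, add_div]

theorem avg_sum {ι : Type} (s : Finset ι) (f : ι → Y → ℝ) :
    avg (fun y => ∑ i ∈ s, f i y) = ∑ i ∈ s, avg (f i) := by
  simp [avg, Finset.sum_comm (s := s), Finset.sum_div]

theorem avg_mul_left (a : ℝ) (f : Y → ℝ) : avg (fun y => a * f y) = a * avg f := by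
  simp only [avg, ← Finset.mul_sum, mul_div_assoc]

theorem avg_const [Nonempty Y] (a : ℝ) : avg (fun _ : Y => a) = a := by
  have : (Fintype.card Y : ℝ) ≠ 0 := by exact_mod_cast Fintype.card_ne_zero
  simp [avg]

open Classical in
/-- The proportion of points that satisfy a predicate. -/
noncomputable def prob (E : Y → Prop) : ℝ := avg fun y => if E y then (1 : ℝ) else 0

theorem prob_nonneg (E : Y → Prop) : 0 ≤ prob E :=
  avg_nonneg fun y => by split_ifs <;> norm_num

theorem prob_mono {E E' : Y → Prop} (h : ∀ y, E y → E' y) : prob E ≤ prob E' := by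
  refine avg_mono fun y => ?_
  by_cases h1 : E y
  · simp [h1, h y h1]
  · simp only [h1, if_false]; split_ifs <;> norm_num

theorem prob_not [Nonempty Y] (E : Y → Prop) : prob (fun y => ¬ E y) = 1 - prob E := by
  have h : prob (fun y => ¬ E y) + prob E = 1 := by
    rw [← avg_const (Y := Y) 1, prob, prob, ← avg_add]
    congr 1; ext y; by_cases h1 : E y <;> simp [h1]
  linarith

theorem prob_eq_card (E : Y → Prop) [DecidablePred E] :
    prob E = ((Finset.univ.filter E).card : ℝ) / Fintype.card Y := by
  unfold prob avg
  congr 1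
  rw [← Finset.sum_boole]
  exact Finset.sum_congr rfl fun y _ => by by_cases h : E y <;> simp [h]

theorem prob_forall_mem {ι X : Type} [Fintype ι] [DecidableEq ι] [Fintype X]
    (t : ι → Finset X) :
    prob (fun y : ι → X => ∀ i, y i ∈ t i) = ∏ i, ((t i).card : ℝ) / Fintype.card X := by
  classical
  rw [prob_eq_card]
  have : (Finset.univ.filter fun y : ι → X => ∀ i, y i ∈ t i) = Fintype.piFinset t := by
    ext y; simp
  rw [this, Fintype.card_piFinset, Finset.prod_div_distrib]
  simp

/-- Coordinates of a uniformly chosen function are independent. This turns six frames for streaming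
into a sixth power of the probability of a conflict. -/
theorem prob_forall_in {ι X : Type} [Fintype ι] [DecidableEq ι] [Fintype X] [Nonempty X]
    (s : Finset ι) (E : X → Prop) :
    prob (fun y : ι → X => ∀ i ∈ s, E (y i)) = prob E ^ s.card := by
  classical
  have hX : (Fintype.card X : ℝ) ≠ 0 := by exact_mod_cast Fintype.card_ne_zero
  have h := prob_forall_mem (fun i : ι => if i ∈ s then Finset.univ.filter E else Finset.univ)
  have h2 : (fun y : ι → X => ∀ i, y i ∈ if i ∈ s then Finset.univ.filter E else Finset.univ) =
      fun y : ι → X => ∀ i ∈ s, E (y i) := by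
    ext y
    refine forall_congr' fun i => ?_
    by_cases hi : i ∈ s <;> simp [hi]
  rw [h2] at h
  rw [h, prob_eq_card E, ← Finset.prod_const,
    ← Finset.prod_subset (Finset.subset_univ s)]
  · exact Finset.prod_congr rfl fun i hi => by simp [hi]
  · intro i _ hi
    simp [hi, hX]

theorem avg_apply {ι X : Type} [Fintype ι] [DecidableEq ι] [Fintype X] [Nonempty X]
    (i : ι) (f : X → ℝ) : avg (fun y : ι → X => f (y i)) = avg f := by
  have hX : (Fintype.card X : ℝ) ≠ 0 := by exact_mod_cast Fintype.card_ne_zero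
  have hZ : (Fintype.card ({j // j ≠ i} → X) : ℝ) ≠ 0 := by
    exact_mod_cast Fintype.card_ne_zero
  unfold avg
  rw [Fintype.card_congr (Equiv.funSplitAt i X), Fintype.card_prod,
    ← Equiv.sum_comp (Equiv.funSplitAt i X).symm, Fintype.sum_prod_type]
  have : ∀ a b, f ((Equiv.funSplitAt i X).symm (a, b) i) = f a := by
    intro a b; simp [Equiv.funSplitAt]
  simp only [this, Finset.sum_const, Finset.card_univ, nsmul_eq_mul, ← Finset.mul_sum]
  push_cast
  field_simp

end Average

/-! ### Orbits of a driven system -/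

section Orbit

/-- The successive states of a system with transition function `F`, driven by `z`. -/
def orbit {σ Y : Type} (F : σ → Y → σ) (s : σ) (z : ℕ → Y) : ℕ → σ
  | 0 => s
  | n + 1 => F (orbit F s z n) (z n)

theorem orbit_congr {σ Y : Type} (F : σ → Y → σ) (s : σ) {z z' : ℕ → Y} {n : ℕ}
    (h : ∀ i < n, z i = z' i) : orbit F s z n = orbit F s z' n := by
  induction n with
  | zero => rfl
  | succ n ih => simp only [orbit]; rw [ih fun i hi => h i (by omega), h n (by omega)]

theorem orbit_invariant {σ Y : Type} {F : σ → Y → σ} {s : σ} {I : σ → Prop} (h0 : I s)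
    (hF : ∀ s y, I s → I (F s y)) (z : ℕ → Y) (n : ℕ) : I (orbit F s z n) := by
  induction n with
  | zero => exact h0
  | succ n ih => exact hF _ _ ih

/-- The state at time `n` is thereby a function on the finite type `Fin n → Y`, even if `σ` is
infinite. The arbitrary value fills places that are never read. -/
theorem orbit_eq_prefix {σ Y : Type} [Nonempty Y] (F : σ → Y → σ) (s : σ) (z : ℕ → Y) (n : ℕ) : orbit F s z n =
    orbit F s (fun i => if h : i < n then (fun j : Fin n => z j) ⟨i, h⟩ else
      Classical.arbitrary Y) n :=
  orbit_congr F s fun i hi => by simp [hi]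

end Orbit

/-! ### Expectations along chains driven by independent uniform draws -/

section Chain

variable {Ω : Type} [MeasurableSpace Ω] {Y : Type} [Fintype Y]

/-- `Z 0, Z 1, …` are independent and uniform on `Y`. -/
structure IsUniformSequence (Pr : Measure Ω) (Z : ℕ → Ω → Y) : Prop where
  measurableSet : ∀ i y, MeasurableSet {ω | Z i ω = y}
  prob_prefix : ∀ n (a : ℕ → Y),
    Pr {ω | ∀ i < n, Z i ω = a i} = ((Fintype.card Y : ℝ≥0∞)⁻¹) ^ n

/-- The finite type carries the discrete σ-algebra, so `g` needs no measurability assumption. -/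
theorem lintegral_comp_finite {A : Type} [Fintype A] {Pr : Measure Ω} {W : Ω → A}
    (hW : ∀ a, MeasurableSet {ω | W ω = a}) (g : A → ℝ≥0∞) :
    ∫⁻ ω, g (W ω) ∂Pr = ∑ a, g a * Pr {ω | W ω = a} := by
  let _ : MeasurableSpace A := ⊤
  have hm : Measurable W := measurable_to_countable' fun a => hW a
  rw [← lintegral_map (f := g) (measurable_from_top) hm, lintegral_fintype]
  refine Finset.sum_congr rfl fun a _ => ?_
  rw [Measure.map_apply hm (measurableSet_singleton a)]
  rfl

theorem measurable_comp_finite {A : Type} [Fintype A] {W : Ω → A}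
    (hW : ∀ a, MeasurableSet {ω | W ω = a}) (g : A → ℝ≥0∞) : Measurable fun ω => g (W ω) := by
  let _ : MeasurableSpace A := ⊤
  have hm : Measurable W := measurable_to_countable' fun a => hW a
  exact (measurable_from_top (f := g)).comp hm

namespace IsUniformSequence

variable {Pr : Measure Ω} {Z : ℕ → Ω → Y} {σ : Type}

theorem measurableSet_pair (hZ : IsUniformSequence Pr Z) (n : ℕ) (a : (Fin n → Y) × Y) :
    MeasurableSet {ω | ((fun i : Fin n => Z i ω), Z n ω) = a} := by
  obtain ⟨a, y⟩ := a
  have : {ω | ((fun i : Fin n => Z i ω), Z n ω) = (a, y)} =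
      (⋂ i : Fin n, {ω | Z i ω = a i}) ∩ {ω | Z n ω = y} := by
    ext ω; simp [funext_iff]
  rw [this]
  exact (MeasurableSet.iInter fun i => hZ.measurableSet _ _).inter (hZ.measurableSet _ _)

theorem prob_pair (hZ : IsUniformSequence Pr Z) (n : ℕ) (a : (Fin n → Y) × Y) :
    Pr {ω | ((fun i : Fin n => Z i ω), Z n ω) = a} = ((Fintype.card Y : ℝ≥0∞)⁻¹) ^ (n + 1) := by
  obtain ⟨a, y⟩ := a
  rw [← hZ.prob_prefix (n + 1) fun i => if h : i < n then a ⟨i, h⟩ else y]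
  congr 1
  ext ω
  simp only [Set.mem_ofPred_eq, Prod.mk.injEq, funext_iff]
  constructor
  · rintro ⟨h1, h2⟩ i hi
    by_cases h : i < n
    · simpa [h] using h1 ⟨i, h⟩
    · obtain rfl : i = n := by omega
      simpa using h2
  · intro h
    refine ⟨fun i => ?_, ?_⟩
    · simpa using h i (by omega)
    · simpa using h n (by omega)

/-- The Markov property in the form needed: every pair of a past and a fresh draw has the same
probability, so the fresh draw can be averaged out for each past separately. -/
theorem lintegral_draw [Nonempty Y] (hZ : IsUniformSequence Pr Z) (n : ℕ)
    (f : (Fin n → Y) → Y → ℝ) (hf : ∀ a y, 0 ≤ f a y) :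
    ∫⁻ ω, ENNReal.ofReal (f (fun i => Z i ω) (Z n ω)) ∂Pr =
      ∫⁻ ω, ENNReal.ofReal (avg (f fun i => Z i ω)) ∂Pr := by
  have h1 := lintegral_comp_finite (hZ.measurableSet_pair n) (Pr := Pr)
    fun a => ENNReal.ofReal (f a.1 a.2)
  have h2 := lintegral_comp_finite (hZ.measurableSet_pair n) (Pr := Pr)
    fun a => ENNReal.ofReal (avg (f a.1))
  simp only at h1 h2
  rw [h1, h2]
  simp only [hZ.prob_pair, ← Finset.sum_mul]
  congr 1
  rw [Fintype.sum_prod_type, Fintype.sum_prod_type]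
  refine Finset.sum_congr rfl fun a _ => ?_
  have hc : (0 : ℝ) < Fintype.card Y := by exact_mod_cast Fintype.card_pos
  simp only [Finset.sum_const, Finset.card_univ, nsmul_eq_mul, avg]
  rw [← ENNReal.ofReal_sum_of_nonneg fun y _ => hf a y, ← ENNReal.ofReal_natCast,
    ← ENNReal.ofReal_mul hc.le]
  congr 1
  field_simp

theorem lintegral_orbit [Nonempty Y] (hZ : IsUniformSequence Pr Z) (F : σ → Y → σ) (s : σ)
    (n : ℕ) (f : σ → Y → ℝ) (hf : ∀ a y, 0 ≤ f a y) :
    ∫⁻ ω, ENNReal.ofReal (f (orbit F s (fun i => Z i ω) n) (Z n ω)) ∂Pr =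
      ∫⁻ ω, ENNReal.ofReal (avg (f (orbit F s (fun i => Z i ω) n))) ∂Pr := by
  have e := fun ω => orbit_eq_prefix F s (fun i => Z i ω) n
  simp only [e]
  exact hZ.lintegral_draw n (fun a y => f (orbit F s (fun i => if h : i < n then a ⟨i, h⟩ else
      Classical.arbitrary Y) n) y) fun a y => hf _ _

theorem measurable_orbit [Nonempty Y] (hZ : IsUniformSequence Pr Z) (F : σ → Y → σ) (s : σ)
    (n : ℕ) (f : σ → Y → ℝ≥0∞) :
    Measurable fun ω => f (orbit F s (fun i => Z i ω) n) (Z n ω) := by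
  have e := fun ω => orbit_eq_prefix F s (fun i => Z i ω) n
  simp only [e]
  exact measurable_comp_finite (hZ.measurableSet_pair n)
    fun a => f (orbit F s (fun i => if h : i < n then a.1 ⟨i, h⟩ else
      Classical.arbitrary Y) n) a.2

variable {F : σ → Y → σ} {s : σ} {I : σ → Prop}

/-- A nonnegative function that contracts in the mean decays geometrically. -/
theorem lintegral_le_pow [Nonempty Y] (hZ : IsUniformSequence Pr Z)
    [IsProbabilityMeasure Pr] (h0 : I s) (hF : ∀ s y, I s → I (F s y))
    {Φ : σ → ℝ} (hΦ : ∀ s, 0 ≤ Φ s) {ρ : ℝ} (hρ : 0 ≤ ρ)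
    (h : ∀ s, I s → avg (fun y => Φ (F s y)) ≤ ρ * Φ s) (n : ℕ) :
    ∫⁻ ω, ENNReal.ofReal (Φ (orbit F s (fun i => Z i ω) n)) ∂Pr ≤
      ENNReal.ofReal (ρ ^ n * Φ s) := by
  induction n with
  | zero => simp [orbit]
  | succ n ih =>
    simp only [orbit]
    rw [hZ.lintegral_orbit F s n (fun a y => Φ (F a y)) fun _ _ => hΦ _]
    calc _ ≤ ∫⁻ ω, ENNReal.ofReal ρ * ENNReal.ofReal (Φ (orbit F s (fun i => Z i ω) n)) ∂Pr := by
          refine lintegral_mono fun ω => ?_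
          simp only
          rw [← ENNReal.ofReal_mul hρ]
          exact ENNReal.ofReal_le_ofReal (h _ (orbit_invariant h0 hF _ n))
      _ = ENNReal.ofReal ρ * ∫⁻ ω, ENNReal.ofReal (Φ (orbit F s (fun i => Z i ω) n)) ∂Pr :=
          lintegral_const_mul _ (hZ.measurable_orbit F s n fun a _ => ENNReal.ofReal (Φ a))
      _ ≤ _ := by
          rw [pow_succ', mul_assoc, ENNReal.ofReal_mul hρ]
          gcongr

/-- If every step costs in the mean at most the decrease of a nonnegative function, then the total
expected cost is at most the initial value of that function. -/
theorem tsum_lintegral_cost_le [Nonempty Y] (hZ : IsUniformSequence Pr Z)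
    [IsProbabilityMeasure Pr] (h0 : I s)
    (hF : ∀ s y, I s → I (F s y))
    {Ψ : σ → ℝ} (hΨ : ∀ s, 0 ≤ Ψ s) {κ : σ → Y → ℝ} (hκ : ∀ s y, 0 ≤ κ s y)
    (h : ∀ s, I s → avg (κ s) + avg (fun y => Ψ (F s y)) ≤ Ψ s) :
    ∑' n, ∫⁻ ω, ENNReal.ofReal (κ (orbit F s (fun i => Z i ω) n) (Z n ω)) ∂Pr ≤
      ENNReal.ofReal (Ψ s) := by
  refine ENNReal.tsum_le_of_sum_range_le fun n => ?_
  -- The induction needs the stronger claim that the cost paid so far plus the expected remaining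
  -- potential never exceeds the initial potential.
  suffices ∑ n ∈ Finset.range n,
      ∫⁻ ω, ENNReal.ofReal (κ (orbit F s (fun i => Z i ω) n) (Z n ω)) ∂Pr +
      ∫⁻ ω, ENNReal.ofReal (Ψ (orbit F s (fun i => Z i ω) n)) ∂Pr ≤ ENNReal.ofReal (Ψ s) from
    le_trans le_self_add this
  induction n with
  | zero => simp [orbit]
  | succ n ih =>
    refine le_trans ?_ ih
    rw [Finset.sum_range_succ, add_assoc]
    gcongr
    simp only [orbit]
    rw [hZ.lintegral_orbit F s n (fun a y => Ψ (F a y)) fun _ _ => hΨ _,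
      hZ.lintegral_orbit F s n κ hκ, ← lintegral_add_left
        (hZ.measurable_orbit F s n fun a _ => ENNReal.ofReal (avg (κ a)))]
    refine lintegral_mono fun ω => ?_
    simp only
    rw [← ENNReal.ofReal_add (avg_nonneg (hκ _)) (avg_nonneg fun _ => hΨ _)]
    exact ENNReal.ofReal_le_ofReal (h _ (orbit_invariant h0 hF _ n))

end IsUniformSequence

/-- Blocks of eight frames of uniform draws form a uniform sequence. -/
theorem IsUniformDraw.blocks {V : Type} [Fintype V] [DecidableEq V] {m : ℕ} {Pr : Measure Ω}
    [IsProbabilityMeasure Pr] {X : ℕ → V → Ω → Fin m} (hX : IsUniformDraw Pr X) :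
    IsUniformSequence Pr (fun n ω (i : Fin 8) v => X (8 * n + i) v ω) := by
  constructor
  · intro n y
    have : {ω | (fun (i : Fin 8) v => X (8 * n + i) v ω) = y} =
        ⋂ i : Fin 8, ⋂ v, X (8 * n + i) v ⁻¹' {y i v} := by
      ext ω; simp [funext_iff]
    rw [this]
    exact MeasurableSet.iInter fun i => MeasurableSet.iInter fun v =>
      hX.measurable _ _ (measurableSet_singleton _)
  · intro n a
    -- Frame `t` has place `t % 8` in round `t / 8`. The event fixes each of the `8 n` frames at
    -- each node, and independence makes its probability a product.
    have hset : {ω | ∀ i < n, (fun (j : Fin 8) v => X (8 * i + j) v ω) = a i} =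
        ⋂ q ∈ Finset.range (8 * n) ×ˢ (Finset.univ : Finset V),
          (fun q : ℕ × V => X q.1 q.2) q ⁻¹'
            {a (q.1 / 8) ⟨q.1 % 8, Nat.mod_lt _ (by norm_num)⟩ q.2} := by
      ext ω
      simp only [Set.mem_ofPred_eq, funext_iff, Set.mem_iInter, Finset.mem_product,
        Finset.mem_range, Finset.mem_univ, and_true, Set.mem_preimage, Set.mem_singleton_iff,
        Prod.forall]
      constructor
      · intro h t v ht
        have := h (t / 8) (by omega) ⟨t % 8, Nat.mod_lt _ (by norm_num)⟩ v
        simpa [Nat.div_add_mod] using this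
      · intro h i hi j v
        have := h (8 * i + j) v (by omega)
        rw [this]
        have h1 : (8 * i + (j : ℕ)) / 8 = i := by omega
        have h2 : (8 * i + (j : ℕ)) % 8 = j := by omega
        simp [h1, h2]
    rw [hset, hX.indep.measure_inter_preimage_eq_mul _
      (sets := fun q : ℕ × V => {a (q.1 / 8) ⟨q.1 % 8, Nat.mod_lt _ (by norm_num)⟩ q.2})
      fun q _ => measurableSet_singleton _]
    simp only [hX.uniform, Finset.prod_const, Finset.card_product, Finset.card_range,
      Finset.card_univ, Fintype.card_fun, Fintype.card_fin]
    push_cast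
    rw [← ENNReal.inv_pow, ← ENNReal.inv_pow, ← pow_mul, ← pow_mul]
    congr 2
    ring

end Chain

/-! ### Absence of conflicts among random slots -/

/-- No other neighbour of `w` has drawn the same number as `v`. -/
def NoConflict {V X : Type} (G : SimpleGraph V) (x : V → X) (v w : V) : Prop :=
  ∀ u, G.Adj w u → u ≠ v → x u ≠ x v

/-- At every neighbour of `v`, no other node has drawn the same number as `v`. -/
def AllClear {V X : Type} (G : SimpleGraph V) (x : V → X) (v : V) : Prop :=
  ∀ w, G.Adj v w → NoConflict G x v w

section

variable {V : Type} [Fintype V] [DecidableEq V] {m : ℕ}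

/-- For a fixed value `a` of `x v` the event is a product event of probability (1/m)(1 - 1/m)^|U|;
the sum over the `m` values of `a` cancels the factor 1/m. -/
theorem prob_forall_ne (hm : 1 ≤ m) {v : V} {U : Finset V} (hv : v ∉ U) :
    prob (fun x : V → Fin m => ∀ u ∈ U, x u ≠ x v) = (1 - 1 / m : ℝ) ^ U.card := by
  classical
  have hm' : (m : ℝ) ≠ 0 := by positivity
  have h1 : ∀ a : Fin m, prob (fun x : V → Fin m => x v = a ∧ ∀ u ∈ U, x u ≠ a) =
      1 / m * (1 - 1 / m : ℝ) ^ U.card := by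
    intro a
    have h := prob_forall_mem (fun i : V => if i = v then {a} else
      if i ∈ U then Finset.univ.erase a else (Finset.univ : Finset (Fin m)))
    have h2 : (fun y : V → Fin m => ∀ i, y i ∈ if i = v then {a} else
        if i ∈ U then Finset.univ.erase a else (Finset.univ : Finset (Fin m))) =
        fun x : V → Fin m => x v = a ∧ ∀ u ∈ U, x u ≠ a := by
      ext x
      constructor
      · intro h
        refine ⟨by simpa using h v, fun u hu => ?_⟩
        have := h u
        rw [if_neg (by rintro rfl; exact hv hu), if_pos hu] at this
        simpa using this
      · rintro ⟨h3, h4⟩ i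
        by_cases hi : i = v
        · subst hi; simp [h3]
        · by_cases hu : i ∈ U
          · simp [hi, hu, h4 i hu]
          · simp [hi, hu]
    rw [h2] at h
    rw [h, ← Finset.mul_prod_erase Finset.univ _ (Finset.mem_univ v)]
    congr 1
    · simp
    · rw [← Finset.prod_const, ← Finset.prod_subset (s₁ := U)]
      · refine Finset.prod_congr rfl fun i hi => ?_
        rw [if_neg (by rintro rfl; exact hv hi), if_pos hi, Finset.card_erase_of_mem
          (Finset.mem_univ _)]
        simp only [Finset.card_univ, Fintype.card_fin]
        rw [Nat.cast_sub hm]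
        field_simp
        simp
      · intro i hi
        simp only [Finset.mem_erase, Finset.mem_univ, and_true]
        rintro rfl; exact hv hi
      · intro i hi hU
        simp only [Finset.mem_erase, Finset.mem_univ, and_true] at hi
        simp [hi, hU, hm']
  have h2 : prob (fun x : V → Fin m => ∀ u ∈ U, x u ≠ x v) =
      ∑ a : Fin m, prob (fun x : V → Fin m => x v = a ∧ ∀ u ∈ U, x u ≠ a) := by
    unfold prob
    rw [← avg_sum]
    congr 1
    ext x
    rw [Finset.sum_eq_single (x v)]
    · simp
    · intro b _ hb
      simp [Ne.symm hb]
    · simp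
  rw [h2]
  simp only [h1, Finset.sum_const, Finset.card_univ, Fintype.card_fin, nsmul_eq_mul]
  field_simp

theorem one_sub_inv_nonneg (hm : 1 ≤ m) : (0 : ℝ) ≤ 1 - 1 / m := by
  have : (1 : ℝ) ≤ m := by exact_mod_cast hm
  rw [sub_nonneg, div_le_one (by linarith)]
  exact this

theorem pow_le_prob_forall_ne (hm : 1 ≤ m) {v : V} {U : Finset V} (hv : v ∉ U) {n : ℕ}
    (hn : U.card ≤ n) :
    (1 - 1 / m : ℝ) ^ n ≤ prob (fun x : V → Fin m => ∀ u ∈ U, x u ≠ x v) := by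
  rw [prob_forall_ne hm hv]
  refine pow_le_pow_of_le_one (one_sub_inv_nonneg hm) ?_ hn
  have : (0 : ℝ) ≤ 1 / m := by positivity
  linarith

variable (G : SimpleGraph V) [DecidableRel G.Adj]

theorem card_other_neighbors {v w : V} (h : G.Adj w v) :
    (Finset.univ.filter fun u => G.Adj w u ∧ u ≠ v).card = G.degree w - 1 := by
  have : (Finset.univ.filter fun u => G.Adj w u ∧ u ≠ v) = (G.neighborFinset w).erase v := by
    ext u; simp [and_comm]
  rw [this, Finset.card_erase_of_mem (by simpa using h), G.card_neighborFinset_eq_degree]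

theorem pow_le_prob_noConflict (hm : 1 ≤ m) {Δ : ℕ} (hΔ : ∀ w, G.degree w ≤ Δ) {v w : V}
    (h : G.Adj w v) :
    (1 - 1 / m : ℝ) ^ (Δ - 1) ≤ prob (fun x : V → Fin m => NoConflict G x v w) := by
  refine (pow_le_prob_forall_ne hm (v := v)
    (U := Finset.univ.filter fun u => G.Adj w u ∧ u ≠ v) (by simp) (n := Δ - 1) ?_).trans
    (prob_mono ?_)
  · rw [card_other_neighbors G h]
    exact Nat.sub_le_sub_right (hΔ w) 1
  · intro x hx u hu huv
    exact hx u (by simp [hu, huv])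

/-- Only the other neighbours of the neighbours of `v` can do harm, and there are at most `δ * (Δ -
1)` of them, however their neighbourhoods overlap. -/
theorem pow_le_prob_allClear (hm : 1 ≤ m) {Δ δ : ℕ} (hΔ : ∀ w, G.degree w ≤ Δ) {v : V}
    (h : G.degree v ≤ δ) :
    (1 - 1 / m : ℝ) ^ (δ * (Δ - 1)) ≤ prob (fun x : V → Fin m => AllClear G x v) := by
  refine (pow_le_prob_forall_ne hm (v := v) (U := (G.neighborFinset v).biUnion fun w =>
    Finset.univ.filter fun u => G.Adj w u ∧ u ≠ v) (by simp) ?_).trans (prob_mono ?_)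
  · refine (Finset.card_biUnion_le_card_mul _ _ (Δ - 1) fun w hw => ?_).trans ?_
    · rw [card_other_neighbors G (by simpa [G.adj_comm] using hw)]
      exact Nat.sub_le_sub_right (hΔ w) 1
    · rw [G.card_neighborFinset_eq_degree]
      gcongr
  · intro x hx w hw u hu huv
    exact hx u (by simp only [Finset.mem_biUnion, Finset.mem_filter]; exact ⟨w, by simpa using hw, by simp [hu, huv]⟩)

end

/-! ### The radio channel -/

section Channel

variable {V β : Type} {G : SimpleGraph V} {tx : V → Option β} {v : V}

theorem heard_eq_message_iff {a : β} : heard G tx v = Heard.message a ↔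
    ∃ u, G.Adj v u ∧ tx u = some a ∧ ∀ w, G.Adj v w → (tx w).isSome → w = u := by
  unfold heard
  split_ifs with h1 h2
  · have h := h1.choose_spec
    simp only [Heard.message.injEq]
    constructor
    · rintro rfl; exact h
    · rintro ⟨u, hu, hua, huw⟩
      obtain ⟨u', hu', hua', -⟩ := h
      obtain rfl := huw u' hu' (by simp [hua'])
      simpa [hua'] using hua
  · simp only [false_iff]
    exact fun h => h1 ⟨a, h⟩
  · simp only [false_iff]
    exact fun h => h1 ⟨a, h⟩

theorem heard_eq_silence_iff : heard G tx v = Heard.silence ↔ ∀ u, G.Adj v u → tx u = none := by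
  unfold heard
  split_ifs with h1 h2
  · simp only [false_iff]
    obtain ⟨a, u, hu, hua, -⟩ := h1
    intro h
    simp [h u hu] at hua
  · simp only [false_iff]
    obtain ⟨u, hu, hs⟩ := h2
    intro h
    simp [h u hu] at hs
  · simp only [true_iff]
    intro u hu
    by_contra hne
    exact h2 ⟨u, hu, Option.isSome_iff_ne_none.2 hne⟩

theorem heard_eq_collision {u : V} (hu : G.Adj v u) (hs : (tx u).isSome)
    (h : ∀ a, heard G tx v ≠ Heard.message a) : heard G tx v = Heard.collision := by
  cases hh : heard G tx v with
  | silence => rw [heard_eq_silence_iff.1 hh u hu] at hs; simp at hs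
  | message a => exact absurd hh (h a)
  | collision => rfl

theorem exists_of_heard_eq_collision (h : heard G tx v = Heard.collision) :
    ∃ u w, u ≠ w ∧ G.Adj v u ∧ G.Adj v w ∧ (tx u).isSome ∧ (tx w).isSome := by
  have h1 : ¬ ∀ u, G.Adj v u → tx u = none := fun h' => by
    rw [heard_eq_silence_iff.2 h'] at h; simp at h
  push Not at h1
  obtain ⟨u, hu, hne⟩ := h1
  obtain ⟨a, ha⟩ := Option.ne_none_iff_exists'.1 hne
  have h2 : ¬ ∃ u, G.Adj v u ∧ tx u = some a ∧ ∀ w, G.Adj v w → (tx w).isSome → w = u := fun h' => by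
    rw [heard_eq_message_iff.2 h'] at h; simp at h
  push Not at h2
  obtain ⟨w, hw, hws, hne'⟩ := h2 u hu ha
  exact ⟨u, w, hne'.symm, hu, hw, by simp [ha], hws⟩

end Channel

/-! ### The protocol

Eight consecutive frames form a round, and what a node sends during a round depends only on its
memory at the beginning of the round. The first frame serves to gather the rumors: full batches of
rumors from the own subtree, and finally the rest of them, are sent to the parent, who acknowledges
every packet received. In the next six frames a backbone node that has not got the confirmation that
its children hold all that it holds sends the item at its pointer; a child that is behind replies,
and then the pointer is moved back, and otherwise forth. In the last frame the backbone
node sends the first item not yet confirmed; collisions are reported, and silence confirms it. -/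

/-- The part of a set of numbers whose ranks in the set lie in the `j`-th interval of length `c`. -/
def chunk (c : ℕ) (s : Finset ℕ) (j : ℕ) : Finset ℕ :=
  s.filter fun a => (s.filter (· < a)).card / c = j

/-- The memory of a node at the beginning of a round. -/
structure Memory where
  view : LocalView
  /-- the rumors known to originate in the own subtree -/
  pool : Finset ℕ
  /-- the rumors that the parent has acknowledged -/
  sentUp : Finset ℕ
  /-- the number of batches that the parent has acknowledged -/
  count : ℕ
  /-- whether the parent has acknowledged the last batch -/
  done : Bool
  /-- the children that have sent their last batch -/
  finished : Finset ℕ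
  /-- the batches received from the parent -/
  recv : List (Finset ℕ)
  /-- the number of batches that are confirmed to be held by all children -/
  certified : ℕ
  pointer : ℕ

/-- What is remembered of a frame: the packets received, and whether there was silence in the slot
for replies to the own packet. -/
structure Record where
  packets : Finset Packet
  quiet : Prop

open Classical in
/-- The packets received in a frame. -/
noncomputable def packetsOf {m : ℕ} (h : Fin m → Heard Packet) : Finset Packet :=
  Finset.univ.biUnion fun s => match h s with
    | Heard.message p => {p}
    | _ => ∅

theorem mem_packetsOf {m : ℕ} {h : Fin m → Heard Packet} {p : Packet} :
    p ∈ packetsOf h ↔ ∃ s, h s = Heard.message p := by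
  simp only [packetsOf, Finset.mem_biUnion, Finset.mem_univ, true_and]
  refine exists_congr fun s => ?_
  cases hs : h s with
  | silence => simp
  | message a => simp [eq_comm]
  | collision => simp

namespace Memory

/-- The rumors that wait to be sent to the parent. -/
def pending (b : Memory) : Finset ℕ := b.pool \ b.sentUp

/-- The children that take part in the gathering of rumors. -/
def talkers (b : Memory) : Finset ℕ := b.view.children ∩ (b.view.sourceNbrs ∪ b.view.backboneNbrs)

open Classical in
/-- Header and batch for the parent; the header of the last batch is `1`. -/
noncomputable def upBatch (b : Memory) : Option (ℕ × Finset ℕ) :=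
  if b.view.parent = none ∨ ¬ (b.view.isSource ∨ b.view.inBackbone) ∨ b.done = true then none
  else if h : b.view.compression ≤ b.pending.card then
    some (0, (Finset.exists_subset_card_eq h).choose)
  else if b.talkers ⊆ b.finished then some (1, b.pending)
  else none

/-- The items to be spread that a node holds. -/
def itemsOf (w : LocalView) (pool : Finset ℕ) (recv : List (Finset ℕ)) : List (Finset ℕ) :=
  if w.parent = none then
    if w.numRumors ≤ pool.card then
      (List.range (w.numRumors / w.compression + 1)).map (chunk w.compression pool)
    else []
  else recv

def items (b : Memory) : List (Finset ℕ) := itemsOf b.view b.pool b.recv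

/-- The number of items that a node holds. -/
def avail (b : Memory) : ℕ := b.items.length

/-- Whether there are items for the children that are not yet confirmed. -/
def Active (b : Memory) : Prop := b.view.children.Nonempty ∧ b.certified < b.avail

open Classical in
/-- Header and batch to be sent in the `i`-th frame of a round. -/
noncomputable def sendAt (b : Memory) (i : ℕ) : Option (ℕ × Finset ℕ) :=
  if i = 0 then b.upBatch
  else if b.Active then
    if i = 7 then some (b.certified, b.items.getD b.certified ∅)
    else some (b.pointer, b.items.getD b.pointer ∅)
  else none

/-- Whether to reply, in the `i`-th frame of a round, to what was heard. -/
def ReplyAt (b : Memory) (i : ℕ) : Heard Packet → Prop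
  | Heard.silence => False
  | Heard.message p => (i = 0 ∧ p.sender ∈ b.view.children) ∨
      (i ≠ 0 ∧ i ≠ 7 ∧ b.view.parent = some p.sender ∧ b.avail < p.header)
  | Heard.collision => i = 7

/-- The packets that the children have sent for the parent. -/
def fromChildren (b : Memory) (r : Fin 8 → Record) : Finset Packet :=
  (r 0).packets.filter fun p => p.sender ∈ b.view.children

/-- The packet of the parent with the next item is among those received. -/
def IsNext (b : Memory) (r : Fin 8 → Record) (p : Packet) : Prop :=
  (∃ i, i ≠ 0 ∧ p ∈ (r i).packets) ∧ b.view.parent = some p.sender ∧ p.header = b.recv.length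

def newPool (b : Memory) (r : Fin 8 → Record) : Finset ℕ :=
  b.pool ∪ (b.fromChildren r).biUnion Packet.batch

open Classical in
noncomputable def newRecv (b : Memory) (r : Fin 8 → Record) : List (Finset ℕ) :=
  if h : ∃ p, b.IsNext r p then b.recv ++ [h.choose.batch] else b.recv

/-- A child has replied that it is behind. -/
def Nack (b : Memory) (r : Fin 8 → Record) : Prop :=
  b.Active ∧ ∃ i, i ≠ 0 ∧ i ≠ 7 ∧ ¬ (r i).quiet

/-- The batch for the parent, if the parent has acknowledged it. -/
noncomputable def acked (b : Memory) (r : Fin 8 → Record) : Option (ℕ × Finset ℕ) :=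
  open Classical in if (r 0).quiet then none else b.upBatch

open Classical in
/-- The memory after a round. -/
noncomputable def commit (b : Memory) (r : Fin 8 → Record) : Memory where
  view := b.view
  pool := b.newPool r
  sentUp := match b.acked r with
    | none => b.sentUp
    | some hb => b.sentUp ∪ hb.2
  count := match b.acked r with
    | none => b.count
    | some _ => b.count + 1
  done := match b.acked r with
    | none => b.done
    | some hb => decide (hb.1 = 1)
  finished := b.finished ∪ ((b.fromChildren r).filter fun p => p.header = 1).image Packet.sender
  recv := b.newRecv r
  certified := if b.Active ∧ (r 7).quiet then b.certified + 1 else b.certified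
  pointer := if b.Nack r then b.pointer - 1
    else if b.Active then
      -- The cap refers to the items held after the round, so the pointer never passes the last item
      -- then at hand.
      min (b.pointer + 1) ((itemsOf b.view (b.newPool r) (b.newRecv r)).length - 1)
    else b.pointer

end Memory

open Classical in
/-- The memory at the beginning. -/
noncomputable def LocalView.initialMemory (w : LocalView) : Memory :=
  ⟨w, if w.isSource then {w.id} else ∅, ∅, 0, false, ∅, [], 0, 0⟩

open Classical in
/-- Gathering of the rumors at the root of the arborescence, followed by their pipelined spreading
along the backbone. -/
noncomputable def gossip : Protocol where
  State := Memory × List Record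
  start w := (w.initialMemory, [])
  send s := s.1.sendAt s.2.length
  reply s _ _ h t := decide (s.1.ReplyAt s.2.length (h t))
  update s _ x h h' :=
    -- At this moment the extended list has exactly eight records, and the default value of `getD`
    -- is not used.
    if s.2.length = 7 then
      (s.1.commit fun i =>
        (s.2 ++ [Record.mk (packetsOf h) (h' x = Heard.silence)]).getD i ⟨∅, True⟩, [])
    else (s.1, s.2 ++ [Record.mk (packetsOf h) (h' x = Heard.silence)])

/-! ### One frame and one round -/

namespace Network

variable {V : Type} [Fintype V] [DecidableEq V] (N : Network V)

/-- The packet that `v` sends in the `i`-th frame of a round. -/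
noncomputable def packet (B : V → Memory) (i : ℕ) (v : V) : Option Packet :=
  ((B v).sendAt i).map fun hb => ⟨N.ident v, hb.1, hb.2⟩

noncomputable def hears (B : V → Memory) (i : ℕ) (x : V → Fin N.slots) (v : V) (s : Fin N.slots) :
    Heard Packet :=
  heard N.graph (fun u => if x u = s then N.packet B i u else none) v

open Classical in
noncomputable def frameRecord (B : V → Memory) (i : ℕ) (x : V → Fin N.slots) (v : V) : Record where
  packets := packetsOf (N.hears B i x v)
  quiet := heard N.graph (fun u => if (B u).ReplyAt i (N.hears B i x u (x v)) then some () else none)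
    v = Heard.silence

/-- The effect of a round, if the nodes draw the numbers `y i` in its `i`-th frame. -/
noncomputable def round (B : V → Memory) (y : Fin 8 → V → Fin N.slots) : V → Memory :=
  fun v => (B v).commit fun i => N.frameRecord B i (y i) v

noncomputable def initialMemory (v : V) : Memory := (N.view v).initialMemory

variable {N} {B : V → Memory} {i : ℕ} {x : V → Fin N.slots} {u v w : V} {p : Packet}

theorem sender_of_packet (h : N.packet B i v = some p) : p.sender = N.ident v := by
  simp only [packet, Option.map_eq_some_iff] at h
  obtain ⟨a, -, rfl⟩ := h
  rfl

/-- Exactly the packets sent without conflict are received. -/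
theorem mem_packets_iff : p ∈ (N.frameRecord B i x w).packets ↔
    ∃ v, N.graph.Adj w v ∧ N.packet B i v = some p ∧
      ∀ u, N.graph.Adj w u → (N.packet B i u).isSome → x u = x v → u = v := by
  simp only [frameRecord, mem_packetsOf, hears, heard_eq_message_iff]
  constructor
  · rintro ⟨s, v, hv, hp, hu⟩
    split_ifs at hp with hs
    refine ⟨v, hv, hp, fun u hwu hsome hxu => hu u hwu ?_⟩
    rw [if_pos (hxu.trans hs)]
    exact hsome
  · rintro ⟨v, hv, hp, hu⟩
    refine ⟨x v, v, hv, by simp [hp], fun u hwu hsome => ?_⟩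
    split_ifs at hsome with hs
    · exact hu u hwu hsome hs
    · simp at hsome

theorem mem_packets_of_noConflict (hp : N.packet B i v = some p) (h : N.graph.Adj w v)
    (hc : NoConflict N.graph x v w) : p ∈ (N.frameRecord B i x w).packets := by
  refine mem_packets_iff.2 ⟨v, h, hp, fun u hu _ hx => ?_⟩
  by_contra hne
  exact hc u hu hne hx

theorem exists_of_mem_packets (h : p ∈ (N.frameRecord B i x w).packets) :
    ∃ v, N.graph.Adj w v ∧ N.packet B i v = some p := by
  obtain ⟨v, h1, h2, -⟩ := mem_packets_iff.1 h
  exact ⟨v, h1, h2⟩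

/-- What a neighbour of `v` hears in the slot in which `v` sends `p`. -/
theorem hears_of_packet (hp : N.packet B i v = some p) (h : N.graph.Adj w v) :
    (p ∈ (N.frameRecord B i x w).packets ∧ N.hears B i x w (x v) = Heard.message p) ∨
    (p ∉ (N.frameRecord B i x w).packets ∧ N.hears B i x w (x v) = Heard.collision) := by
  by_cases hm : p ∈ (N.frameRecord B i x w).packets
  · left
    refine ⟨hm, ?_⟩
    obtain ⟨v', hv', hp', hu⟩ := mem_packets_iff.1 hm
    obtain rfl : v' = v := N.ident.injective
      ((sender_of_packet hp').symm.trans (sender_of_packet hp))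
    refine heard_eq_message_iff.2 ⟨v', h, by simp [hp], fun u hwu hs => ?_⟩
    split_ifs at hs with hxu
    · exact hu u hwu hs hxu
    · simp at hs
  · right
    refine ⟨hm, heard_eq_collision h (by simp [hp]) fun a ha => hm ?_⟩
    obtain ⟨u, hu, hua, huw⟩ := heard_eq_message_iff.1 ha
    obtain rfl : v = u := huw v h (by simp [hp])
    simp only [if_true] at hua
    rw [hp] at hua
    simp only [frameRecord, mem_packetsOf]
    rw [← Option.some.inj hua] at ha
    exact ⟨_, ha⟩

theorem quiet_iff : (N.frameRecord B i x v).quiet ↔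
    ∀ w, N.graph.Adj v w → ¬ (B w).ReplyAt i (N.hears B i x w (x v)) := by
  simp only [frameRecord, heard_eq_silence_iff]
  refine forall_congr' fun w => forall_congr' fun _ => ?_
  split_ifs with h <;> simp [h]

end Network

/-! ### Chunks -/

/-- Since ranks separate the elements, a chunk is no larger than the interval of ranks that defines
it. -/
theorem rank_injOn (s : Finset ℕ) :
    Set.InjOn (fun a => (s.filter (· < a)).card) (s : Set ℕ) := by
  have h : ∀ a ∈ s, ∀ b ∈ s, a < b → (s.filter (· < a)).card < (s.filter (· < b)).card := by
    intro a ha b _ hab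
    refine Finset.card_lt_card (Finset.ssubset_iff_of_subset ?_ |>.2 ⟨a, by simp [ha, hab], by simp⟩)
    intro i hi
    simp only [Finset.mem_filter] at hi ⊢
    exact ⟨hi.1, hi.2.trans hab⟩
  intro a ha b hb hab
  rcases lt_trichotomy a b with h1 | h1 | h1
  · exact absurd hab (h a ha b hb h1).ne
  · exact h1
  · exact absurd hab (h b hb a ha h1).ne'

theorem card_chunk_le {c : ℕ} (hc : 1 ≤ c) (s : Finset ℕ) (j : ℕ) : (chunk c s j).card ≤ c := by
  have : (chunk c s j).card ≤ (Finset.Ico (c * j) (c * j + c)).card := by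
    refine Finset.card_le_card_of_injOn (fun a => (s.filter (· < a)).card) ?_
      ((rank_injOn s).mono fun a ha => ?_)
    · intro a ha
      simp only [chunk, Finset.coe_filter, Set.mem_ofPred_eq] at ha
      simp only [Finset.coe_Ico, Set.mem_Ico]
      rw [← ha.2]
      exact ⟨Nat.mul_div_le _ _, by
        have := Nat.lt_mul_div_succ (s.filter (· < a)).card hc
        rw [mul_add, mul_one] at this
        exact this⟩
    · simp only [chunk, Finset.coe_filter, Set.mem_ofPred_eq] at ha
      exact ha.1
  simpa using this

theorem chunk_subset (c : ℕ) (s : Finset ℕ) (j : ℕ) : chunk c s j ⊆ s := Finset.filter_subset _ _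

theorem exists_mem_chunk {c : ℕ} {s : Finset ℕ} {a : ℕ} (ha : a ∈ s) :
    ∃ j < s.card / c + 1, a ∈ chunk c s j := by
  refine ⟨(s.filter (· < a)).card / c, ?_, by simp [chunk, ha]⟩
  exact Nat.lt_succ_of_le (Nat.div_le_div_right (Finset.card_le_card (Finset.filter_subset _ _)))

/-! ### The arborescence in local terms, and the invariant that holds between rounds -/

namespace Network

variable {V : Type} [Fintype V] [DecidableEq V] (N : Network V)

/-- `w` is a child of `v` in the arborescence. -/
def IsChild (w v : V) : Prop := w ≠ N.tree.root ∧ N.tree.parent w = v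

/-- The `j`-th batch that is spread from the root. -/
def item (j : ℕ) : Finset ℕ := chunk N.compression N.rumors j

/-- The additional item is the incomplete last chunk; it is empty if the compression divides the
number of rumors. -/
def numItems : ℕ := N.sources.card / N.compression + 1

theorem card_rumors : N.rumors.card = N.sources.card := Finset.card_map _

variable {N} {v w : V}

theorem IsChild.adj (h : N.IsChild w v) : N.graph.Adj v w := by
  rw [N.graph.adj_comm, ← h.2]
  exact N.tree.parent_adj w h.1

theorem IsChild.mem (h : N.IsChild w v) : v ∈ N.backbone := h.2 ▸ N.tree.parent_mem w h.1

theorem isChild_parent (h : w ≠ N.tree.root) : N.IsChild w (N.tree.parent w) := ⟨h, rfl⟩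

theorem view_parent_eq_none : (N.view v).parent = none ↔ v = N.tree.root := by
  simp [view]

theorem view_parent_eq_some : (N.view w).parent = some (N.ident v) ↔ N.IsChild w v := by
  simp [view, IsChild, N.ident.injective.eq_iff]

theorem mem_view_children : N.ident w ∈ (N.view v).children ↔ N.IsChild w v := by
  simp [view, IsChild]

theorem view_children_nonempty : (N.view v).children.Nonempty ↔ ∃ w, N.IsChild w v := by
  constructor
  · rintro ⟨i, hi⟩
    have hi' := hi
    simp only [view, Finset.mem_map] at hi'
    obtain ⟨w, -, rfl⟩ := hi'
    exact ⟨w, mem_view_children.1 hi⟩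
  · rintro ⟨w, hw⟩
    exact ⟨_, mem_view_children.2 hw⟩

/-- What holds of the memories of the nodes between rounds. -/
structure Invariant (N : Network V) (B : V → Memory) : Prop where
  view : ∀ v, (B v).view = N.view v
  pool_subtree : ∀ v, ∀ i ∈ (B v).pool, ∃ u ∈ N.sources, N.ident u = i ∧
    ∃ j : ℕ, N.tree.parent^[j] u = v
  own : ∀ v ∈ N.sources, N.ident v ∈ (B v).pool
  sentUp_subset : ∀ v, (B v).sentUp ⊆ (B v).pool
  -- Before the last batch only full batches are sent up.
  card_sentUp : ∀ v, (B v).done = false → (B v).sentUp.card = N.compression * (B v).count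
  of_done : ∀ v, (B v).done = true → (B v).pool ⊆ (B v).sentUp ∧ (B v).talkers ⊆ (B v).finished
  sentUp_subset_parent : ∀ w v, N.IsChild w v → (B w).sentUp ⊆ (B v).pool
  mem_finished : ∀ w v, N.IsChild w v → (N.ident w ∈ (B v).finished ↔ (B w).done = true)
  recv : ∀ v, v ≠ N.tree.root → (B v).recv = (List.range (B v).recv.length).map N.item
  avail_le_parent : ∀ w v, N.IsChild w v → (B w).avail ≤ (B v).avail
  certified_le : ∀ w v, N.IsChild w v → (B v).certified ≤ (B w).avail
  -- The pointer is at most one item short of the slowest child; it can be far from it only by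
  -- running ahead.
  exists_avail_le : ∀ v, (∃ w, N.IsChild w v) →
    ∃ w, N.IsChild w v ∧ (B w).avail ≤ (B v).pointer + 1
  pointer_le : ∀ v, (B v).pointer ≤ (B v).avail - 1

namespace Invariant

variable {B : V → Memory} (I : Invariant N B)

theorem isSource (I : Invariant N B) : (B v).view.isSource = (v ∈ N.sources) := by
  rw [I.view]; rfl

theorem inBackbone (I : Invariant N B) : (B v).view.inBackbone = (v ∈ N.backbone) := by
  rw [I.view]; rfl

theorem compression (I : Invariant N B) : (B v).view.compression = N.compression := by
  rw [I.view]; rfl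

theorem numRumors (I : Invariant N B) : (B v).view.numRumors = N.sources.card := by
  rw [I.view]; rfl

theorem parent_eq_none (I : Invariant N B) : (B v).view.parent = none ↔ v = N.tree.root := by
  rw [I.view, view_parent_eq_none]

theorem parent_eq_some (I : Invariant N B) :
    (B w).view.parent = some (N.ident v) ↔ N.IsChild w v := by
  rw [I.view, view_parent_eq_some]

theorem mem_children (I : Invariant N B) : N.ident w ∈ (B v).view.children ↔ N.IsChild w v := by
  rw [I.view, mem_view_children]

theorem children_nonempty (I : Invariant N B) :
    (B v).view.children.Nonempty ↔ ∃ w, N.IsChild w v := by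
  rw [I.view, view_children_nonempty]

theorem mem_talkers (I : Invariant N B) : N.ident w ∈ (B v).talkers ↔
    N.IsChild w v ∧ w ∈ N.backbone ∪ N.sources := by
  simp only [Memory.talkers, Finset.mem_inter, I.mem_children, Finset.mem_union]
  refine and_congr_right fun h => ?_
  rw [I.view]
  have := h.adj
  simp [Network.view, this, or_comm]

theorem exists_of_mem_talkers (I : Invariant N B) {i : ℕ} (h : i ∈ (B v).talkers) :
    ∃ w, N.ident w = i := by
  have h1 := (Finset.mem_inter.1 h).1
  rw [I.view] at h1
  simp only [Network.view, Finset.mem_map] at h1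
  obtain ⟨w, -, h⟩ := h1
  exact ⟨w, h⟩

theorem pool_subset (I : Invariant N B) : (B v).pool ⊆ N.rumors := by
  intro i hi
  obtain ⟨u, hu, rfl, -⟩ := I.pool_subtree v i hi
  simp [rumors, hu]

theorem pool_eq (I : Invariant N B) (h : N.sources.card ≤ (B v).pool.card) :
    (B v).pool = N.rumors :=
  Finset.eq_of_subset_of_card_le I.pool_subset (by rwa [N.card_rumors])

theorem items_root (I : Invariant N B) : (B N.tree.root).items =
    if N.sources.card ≤ (B N.tree.root).pool.card then (List.range N.numItems).map N.item
    else [] := by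
  unfold Memory.items Memory.itemsOf
  rw [if_pos (I.parent_eq_none.2 rfl), I.numRumors, I.compression]
  split_ifs with h
  · rw [I.pool_eq h]; rfl
  · rfl

theorem items_of_ne (I : Invariant N B) (h : v ≠ N.tree.root) : (B v).items = (B v).recv := by
  unfold Memory.items Memory.itemsOf
  rw [if_neg (by rwa [I.parent_eq_none])]

theorem avail_of_ne (I : Invariant N B) (h : v ≠ N.tree.root) :
    (B v).avail = (B v).recv.length := by
  rw [Memory.avail, I.items_of_ne h]

theorem items_eq (I : Invariant N B) : (B v).items = (List.range (B v).avail).map N.item := by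
  by_cases h : v = N.tree.root
  · subst h
    unfold Memory.avail
    rw [I.items_root]
    split_ifs <;> simp
  · rw [I.avail_of_ne h, I.items_of_ne h]
    exact I.recv v h

theorem items_getD (I : Invariant N B) {j : ℕ} (h : j < (B v).avail) :
    (B v).items.getD j ∅ = N.item j := by
  rw [I.items_eq]
  simp [List.getD, h]

theorem avail_root (I : Invariant N B) : (B N.tree.root).avail =
    if N.sources.card ≤ (B N.tree.root).pool.card then N.numItems else 0 := by
  unfold Memory.avail
  rw [I.items_root]
  split_ifs <;> simp

theorem active_iff (I : Invariant N B) :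
    (B v).Active ↔ (∃ w, N.IsChild w v) ∧ (B v).certified < (B v).avail := by
  rw [Memory.Active, I.children_nonempty]

theorem pointer_lt (I : Invariant N B) (h : (B v).Active) : (B v).pointer < (B v).avail := by
  have := I.pointer_le v
  have := h.2
  omega

/-- The packets of the last seven frames of a round. -/
theorem packet_spread (I : Invariant N B) {i : ℕ} (hi : i ≠ 0) {p : Packet}
    (h : N.packet B i v = some p) :
    (B v).Active ∧ p.header = (if i = 7 then (B v).certified else (B v).pointer) ∧
      p.header < (B v).avail ∧ p.batch = N.item p.header := by
  simp only [packet, Memory.sendAt, if_neg hi, Option.map_eq_some_iff] at h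
  obtain ⟨hb, hhb, rfl⟩ := h
  split_ifs at hhb with h1 h2
  · obtain rfl := Option.some.inj hhb
    exact ⟨h1, by simp [h2], h1.2, I.items_getD h1.2⟩
  · obtain rfl := Option.some.inj hhb
    exact ⟨h1, by simp [h2], I.pointer_lt h1, I.items_getD (I.pointer_lt h1)⟩

theorem packet_of_active (I : Invariant N B) {i : ℕ} (hi : i ≠ 0) (h : (B v).Active) :
    N.packet B i v = some ⟨N.ident v, if i = 7 then (B v).certified else (B v).pointer,
      N.item (if i = 7 then (B v).certified else (B v).pointer)⟩ := by
  simp only [packet, Memory.sendAt, if_neg hi, if_pos h]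
  split_ifs with h2
  · rw [I.items_getD h.2]; rfl
  · rw [I.items_getD (I.pointer_lt h)]; rfl

theorem upBatch_ne_none (I : Invariant N B) {hb : ℕ × Finset ℕ} (h : (B v).upBatch = some hb) :
    v ≠ N.tree.root ∧ v ∈ N.backbone ∪ N.sources ∧ (B v).done = false ∧
      hb.2 ⊆ (B v).pending ∧
      ((hb.1 = 0 ∧ hb.2.card = N.compression) ∨
        (hb.1 = 1 ∧ hb.2 = (B v).pending ∧ (B v).pending.card < N.compression ∧
          (B v).talkers ⊆ (B v).finished)) := by
  unfold Memory.upBatch at h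
  split_ifs at h with h1 h2 h3
  · obtain rfl := Option.some.inj h
    push Not at h1
    rw [I.isSource, I.inBackbone, ne_eq, I.parent_eq_none] at h1
    have h4 := (Finset.exists_subset_card_eq h2).choose_spec
    refine ⟨h1.1, by simpa [or_comm] using h1.2.1, by simpa using h1.2.2, h4.1,
      Or.inl ⟨rfl, h4.2.trans I.compression⟩⟩
  · obtain rfl := Option.some.inj h
    push Not at h1
    rw [I.isSource, I.inBackbone, ne_eq, I.parent_eq_none] at h1
    rw [I.compression] at h2
    exact ⟨h1.1, by simpa [or_comm] using h1.2.1, by simpa using h1.2.2, subset_rfl,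
      Or.inr ⟨rfl, rfl, not_le.1 h2, h3⟩⟩

theorem packet_zero : N.packet B 0 v = (B v).upBatch.map fun hb => ⟨N.ident v, hb.1, hb.2⟩ := by
  simp [packet, Memory.sendAt]

variable {x : V → Fin N.slots}

/-- The parent acknowledges exactly the packets that it receives. -/
theorem acked_eq_some (I : Invariant N B) {hb : ℕ × Finset ℕ} {r : Fin 8 → Record}
    (hr : r 0 = N.frameRecord B 0 x w) :
    (B w).acked r = some hb ↔ (B w).upBatch = some hb ∧
      Packet.mk (N.ident w) hb.1 hb.2 ∈ (N.frameRecord B 0 x (N.tree.parent w)).packets := by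
  unfold Memory.acked
  rw [hr]
  by_cases hu : (B w).upBatch = some hb
  · have hroot := (I.upBatch_ne_none hu).1
    have hp : N.packet B 0 w = some ⟨N.ident w, hb.1, hb.2⟩ := by rw [packet_zero, hu]; rfl
    -- A neighbour hears the packet of `w` or a collision in this slot. Collisions get no reply in
    -- frame 0, and a received packet gets one from the parent only.
    have hq : (N.frameRecord B 0 x w).quiet ↔
        Packet.mk (N.ident w) hb.1 hb.2 ∉ (N.frameRecord B 0 x (N.tree.parent w)).packets := by
      rw [quiet_iff]
      constructor
      · intro h hm
        have hadj := (isChild_parent hroot).adj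
        rcases hears_of_packet hp hadj (x := x) with h1 | h1
        · refine h _ hadj.symm ?_
          rw [h1.2]
          exact Or.inl ⟨rfl, I.mem_children.2 (isChild_parent hroot)⟩
        · exact h1.1 hm
      · intro h u hu hrep
        rcases hears_of_packet hp hu.symm (x := x) with h1 | h1
        · rw [h1.2] at hrep
          rcases hrep with h2 | h2
          · have := (I.mem_children.1 h2.2).2
            subst this
            exact h h1.1
          · exact h2.1 rfl
        · rw [h1.2] at hrep
          exact absurd hrep (by simp [Memory.ReplyAt])
    rw [hq]
    split_ifs with h <;> simp [h, hu]
  · split_ifs <;> simp [hu]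

theorem mem_fromChildren (I : Invariant N B) {r : Fin 8 → Record}
    (hr : r 0 = N.frameRecord B 0 x v) {p : Packet} :
    p ∈ (B v).fromChildren r ↔ ∃ w hb, N.IsChild w v ∧ (B w).upBatch = some hb ∧
      p = ⟨N.ident w, hb.1, hb.2⟩ ∧ p ∈ (N.frameRecord B 0 x v).packets := by
  simp only [Memory.fromChildren, hr, Finset.mem_filter]
  constructor
  · rintro ⟨h1, h2⟩
    obtain ⟨w, hw, hp⟩ := exists_of_mem_packets h1
    rw [sender_of_packet hp, I.mem_children] at h2
    rw [packet_zero, Option.map_eq_some_iff] at hp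
    obtain ⟨hb, hhb, rfl⟩ := hp
    exact ⟨w, hb, h2, hhb, rfl, h1⟩
  · rintro ⟨w, hb, hw, -, rfl, hm⟩
    exact ⟨hm, I.mem_children.2 hw⟩

variable {y : Fin 8 → V → Fin N.slots}

/-- A child that sends is a talker and not yet done, whereas a finished child is done. This is why
the pool is final once the last batch is sent. -/
theorem fromChildren_eq_empty (I : Invariant N B) (h : (B v).talkers ⊆ (B v).finished) :
    (B v).fromChildren (fun i => N.frameRecord B i (y i) v) = ∅ := by
  refine Finset.eq_empty_of_forall_notMem fun p hp => ?_
  obtain ⟨w, hb, hw, hu, -, -⟩ := (I.mem_fromChildren rfl).1 hp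
  obtain ⟨-, hD, hdone, -⟩ := I.upBatch_ne_none hu
  have := (I.mem_finished w v hw).1 (h (I.mem_talkers.2 ⟨hw, hD⟩))
  simp [hdone] at this

/-- The batch is determined by the number of items already held, so it does not matter which packet
`choose` picks in `newRecv`. -/
theorem isNext_iff (I : Invariant N B) {p : Packet} :
    (B w).IsNext (fun i => N.frameRecord B i (y i) w) p → ∃ v, N.IsChild w v ∧
      p.header = (B w).avail ∧ p.header < (B v).avail ∧ p.batch = N.item p.header ∧
      ∃ i : Fin 8, i ≠ 0 ∧ N.packet B i v = some p := by
  rintro ⟨⟨i, hi, hp⟩, hpar, hh⟩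
  obtain ⟨v, hv, hpv⟩ := exists_of_mem_packets hp
  have hi' : (i : ℕ) ≠ 0 := fun h => hi (Fin.ext h)
  rw [sender_of_packet hpv, I.parent_eq_some] at hpar
  obtain ⟨-, -, h1, h2⟩ := I.packet_spread hi' hpv
  exact ⟨v, hpar, by rw [hh, I.avail_of_ne hpar.1], h1, h2, i, hi, hpv⟩

theorem view_round (I : Invariant N B) : (N.round B y v).view = N.view v := I.view v

theorem pool_subset_round : (B v).pool ⊆ (N.round B y v).pool := Finset.subset_union_left

theorem recv_round (I : Invariant N B) :
    ((N.round B y w).recv = (B w).recv ∧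
      ¬ ∃ p, (B w).IsNext (fun i => N.frameRecord B i (y i) w) p) ∨
    ((N.round B y w).recv = (B w).recv ++ [N.item (B w).avail] ∧
      (B w).avail < (B (N.tree.parent w)).avail ∧
      ∃ p, (B w).IsNext (fun i => N.frameRecord B i (y i) w) p) := by
  simp only [Network.round, Memory.commit, Memory.newRecv]
  split_ifs with hn
  · right
    obtain ⟨v, hv, h1, h2, h3, -⟩ := I.isNext_iff hn.choose_spec
    obtain rfl := hv.2
    rw [h1] at h2 h3
    exact ⟨by rw [h3], h2, hn⟩
  · exact Or.inl ⟨rfl, hn⟩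

theorem avail_round_of_ne (I : Invariant N B) (h : w ≠ N.tree.root) :
    (N.round B y w).avail = (N.round B y w).recv.length := by
  unfold Memory.avail Memory.items Memory.itemsOf
  rw [if_neg]
  rw [I.view_round, view_parent_eq_none]
  exact h

theorem avail_round (I : Invariant N B) (h : N.IsChild w v) :
    ((N.round B y w).avail = (B w).avail ∧
      ¬ ∃ p, (B w).IsNext (fun i => N.frameRecord B i (y i) w) p) ∨
    ((N.round B y w).avail = (B w).avail + 1 ∧ (B w).avail < (B v).avail ∧
      ∃ p, (B w).IsNext (fun i => N.frameRecord B i (y i) w) p) := by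
  rw [I.avail_round_of_ne h.1]
  rw [I.avail_of_ne h.1]
  rcases I.recv_round (y := y) (w := w) with h1 | h1
  · left; rw [h1.1]; exact ⟨rfl, h1.2⟩
  · right; rw [h1.1, ← h.2, ← I.avail_of_ne h.1]
    refine ⟨?_, h1.2⟩
    rw [List.length_append, ← I.avail_of_ne h.1]; rfl

/-- Pools only grow, so the root never loses its items once it has all rumors; elsewhere the
received list is only extended. -/
theorem avail_le_round (I : Invariant N B) : (B v).avail ≤ (N.round B y v).avail := by
  by_cases h : v = N.tree.root
  · unfold Memory.avail Memory.items Memory.itemsOf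
    have h1 := I.parent_eq_none.2 h
    have h2 : (N.round B y v).view.parent = none := h1
    rw [if_pos h1, if_pos h2]
    have h3 : (N.round B y v).view = (B v).view := rfl
    rw [h3]
    have h4 := Finset.card_le_card (pool_subset_round (B := B) (y := y) (v := v))
    split_ifs with h5 h6
    · simp
    · omega
    · simp
    · simp
  · rcases I.avail_round (isChild_parent h) (y := y) with h1 | h1 <;> omega

/-- A child that receives the packet with its next item, holds it after the round. -/
theorem avail_lt_round (I : Invariant N B) (h : N.IsChild w v) {i : Fin 8} (hi : i ≠ 0)
    {p : Packet} (hp : N.packet B i v = some p)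
    (hm : p ∈ (N.frameRecord B i (y i) w).packets) (hh : p.header ≤ (B w).avail) :
    p.header < (N.round B y w).avail := by
  rcases I.avail_round h (y := y) with h1 | h1
  · rcases hh.lt_or_eq with h2 | h2
    · omega
    · refine absurd ⟨p, ⟨⟨i, hi, hm⟩, ?_, ?_⟩⟩ h1.2
      · rw [sender_of_packet hp, I.parent_eq_some]; exact h
      · rw [h2, I.avail_of_ne h.1]
  · omega

/-- Only children that are behind make a node move back its pointer. -/
theorem nack_iff (I : Invariant N B) :
    (B v).Nack (fun i => N.frameRecord B i (y i) v) ↔ (B v).Active ∧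
      ∃ i : Fin 8, i ≠ 0 ∧ i ≠ 7 ∧ ∃ w, N.IsChild w v ∧ (B w).avail < (B v).pointer ∧
        ∃ p, N.packet B i v = some p ∧ p ∈ (N.frameRecord B i (y i) w).packets := by
  unfold Memory.Nack
  refine and_congr_right fun ha => exists_congr fun i => and_congr_right fun h0 =>
    and_congr_right fun h7 => ?_
  have h0' : (i : ℕ) ≠ 0 := fun h => h0 (Fin.ext h)
  have h7' : (i : ℕ) ≠ 7 := by
    intro h; exact h7 (Fin.ext h)
  obtain ⟨p, hp⟩ : ∃ p, N.packet B i v = some p := ⟨_, I.packet_of_active h0' ha⟩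
  have hhead := (I.packet_spread h0' hp).2.1
  rw [if_neg h7'] at hhead
  rw [quiet_iff]
  push Not
  constructor
  · rintro ⟨w, hw, hrep⟩
    -- The replying neighbour has heard the packet of `v` or a collision. In a streaming frame the
    -- latter gets no reply, so it is a child of `v` that lacks an earlier item.
    rcases hears_of_packet hp hw.symm (x := y i) with h1 | h1
    · rw [h1.2] at hrep
      rcases hrep with h2 | h2
      · exact absurd h2.1 h0'
      · rw [sender_of_packet hp, I.parent_eq_some] at h2
        exact ⟨w, h2.2.2.1, by rw [← hhead]; exact h2.2.2.2, _, hp, h1.1⟩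
    · rw [h1.2] at hrep
      exact absurd hrep h7'
  · rintro ⟨w, hw, hlt, p', hp', hm⟩
    refine ⟨w, hw.adj, ?_⟩
    rw [hp] at hp'
    obtain rfl := Option.some.inj hp'
    rcases hears_of_packet hp hw.adj.symm (x := y i) with h1 | h1
    · rw [h1.2]
      refine Or.inr ⟨h0', h7', by rw [sender_of_packet hp]; exact I.parent_eq_some.2 hw, ?_⟩
      rw [hhead]; exact hlt
    · exact absurd hm h1.1

/-- Silence in the last frame of a round means that all neighbours have received the packet. -/
theorem quiet_seven_iff {p : Packet} (hp : N.packet B 7 v = some p) :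
    (N.frameRecord B 7 x v).quiet ↔
      ∀ w, N.graph.Adj v w → p ∈ (N.frameRecord B 7 x w).packets := by
  rw [quiet_iff]
  refine forall_congr' fun w => forall_congr' fun hw => ?_
  rcases hears_of_packet hp hw.symm (x := x) with h1 | h1
  · rw [h1.2]
    simp [Memory.ReplyAt, h1.1]
  · rw [h1.2]
    simp [Memory.ReplyAt, h1.1]

theorem certified_round :
    ((N.round B y v).certified = (B v).certified + 1 ∧ (B v).Active ∧
      (N.frameRecord B 7 (y 7) v).quiet) ∨
    ((N.round B y v).certified = (B v).certified ∧
      ¬ ((B v).Active ∧ (N.frameRecord B 7 (y 7) v).quiet)) := by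
  by_cases h : (B v).Active ∧ (N.frameRecord B 7 (y 7) v).quiet
  · exact Or.inl ⟨if_pos h, h⟩
  · exact Or.inr ⟨if_neg h, h⟩

theorem pointer_round :
    ((B v).Nack (fun i => N.frameRecord B i (y i) v) ∧ (B v).Active ∧
      (N.round B y v).pointer = (B v).pointer - 1) ∨
    (¬ (B v).Nack (fun i => N.frameRecord B i (y i) v) ∧ (B v).Active ∧
      (N.round B y v).pointer = min ((B v).pointer + 1) ((N.round B y v).avail - 1)) ∨
    (¬ (B v).Active ∧ (N.round B y v).pointer = (B v).pointer) := by
  by_cases h : (B v).Nack (fun i => N.frameRecord B i (y i) v)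
  · exact Or.inl ⟨h, h.1, if_pos h⟩
  · by_cases ha : (B v).Active
    · exact Or.inr (Or.inl ⟨h, ha, (if_neg h).trans (if_pos ha)⟩)
    · exact Or.inr (Or.inr ⟨ha, (if_neg h).trans (if_neg ha)⟩)

end Invariant

end Network

/-! ### The invariant holds initially and is preserved by every round -/

namespace Network

variable {V : Type} [Fintype V] [DecidableEq V] {N : Network V}

theorem invariant_initial : Invariant N N.initialMemory := by
  have hav : ∀ v, (N.initialMemory v).recv = [] := fun v => rfl
  have hpool : ∀ v, (N.initialMemory v).pool = if v ∈ N.sources then {N.ident v} else ∅ := by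
    intro v
    by_cases h : v ∈ N.sources
    · rw [if_pos h]; exact if_pos h
    · rw [if_neg h]; exact if_neg h
  have havail : ∀ v, v ≠ N.tree.root → (N.initialMemory v).avail = 0 := by
    intro v hv
    unfold Memory.avail Memory.items Memory.itemsOf
    rw [if_neg]
    · rfl
    · exact fun h => hv (view_parent_eq_none.1 h)
  constructor
  · exact fun v => rfl
  · intro v i hi
    rw [hpool] at hi
    split_ifs at hi with h
    · exact ⟨v, h, (Finset.mem_singleton.1 hi).symm, 0, rfl⟩
    · simp at hi
  · intro v hv
    rw [hpool, if_pos hv]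
    simp
  · exact fun v => Finset.empty_subset _
  · exact fun v _ => rfl
  · intro v h
    exact absurd h (by simp [initialMemory, LocalView.initialMemory])
  · exact fun w v _ => Finset.empty_subset _
  · intro w v _
    simp [initialMemory, LocalView.initialMemory]
  · exact fun v _ => rfl
  · intro w v h
    rw [havail w h.1]; exact Nat.zero_le _
  · exact fun w v _ => Nat.zero_le _
  · rintro v ⟨w, hw⟩
    exact ⟨w, hw, by rw [havail w hw.1]; exact Nat.zero_le _⟩
  · exact fun v => Nat.zero_le _

namespace Invariant

variable {B : V → Memory} {y : Fin 8 → V → Fin N.slots} {v w : V}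

theorem mem_pool_round (I : Invariant N B) {a : ℕ} : a ∈ (N.round B y v).pool ↔
    a ∈ (B v).pool ∨ ∃ w hb, N.IsChild w v ∧ (B w).upBatch = some hb ∧
      Packet.mk (N.ident w) hb.1 hb.2 ∈ (N.frameRecord B 0 (y 0) v).packets ∧ a ∈ hb.2 := by
  have : (N.round B y v).pool = (B v).newPool fun i => N.frameRecord B i (y i) v := rfl
  rw [this, Memory.newPool, Finset.mem_union, Finset.mem_biUnion]
  refine or_congr_right ?_
  constructor
  · rintro ⟨p, hp, ha⟩
    obtain ⟨w, hb, h1, h2, rfl, h4⟩ := (I.mem_fromChildren rfl).1 hp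
    exact ⟨w, hb, h1, h2, h4, ha⟩
  · rintro ⟨w, hb, h1, h2, h3, h4⟩
    exact ⟨_, (I.mem_fromChildren rfl).2 ⟨w, hb, h1, h2, rfl, h3⟩, h4⟩

/-- The memory of a node after a round in which its parent has received its packet. -/
theorem round_of_acked (I : Invariant N B) {hb : ℕ × Finset ℕ} (hu : (B w).upBatch = some hb)
    (hm : Packet.mk (N.ident w) hb.1 hb.2 ∈
      (N.frameRecord B 0 (y 0) (N.tree.parent w)).packets) :
    (N.round B y w).sentUp = (B w).sentUp ∪ hb.2 ∧ (N.round B y w).count = (B w).count + 1 ∧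
      (N.round B y w).done = decide (hb.1 = 1) := by
  have h : (B w).acked (fun i => N.frameRecord B i (y i) w) = some hb :=
    (I.acked_eq_some rfl).2 ⟨hu, hm⟩
  simp only [Network.round, Memory.commit, h, and_self]

/-- The memory of a node after a round in which its parent has received nothing from it. -/
theorem round_of_not_acked (I : Invariant N B)
    (h : ∀ hb, (B w).upBatch = some hb → Packet.mk (N.ident w) hb.1 hb.2 ∉
      (N.frameRecord B 0 (y 0) (N.tree.parent w)).packets) :
    (N.round B y w).sentUp = (B w).sentUp ∧ (N.round B y w).count = (B w).count ∧
      (N.round B y w).done = (B w).done := by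
  have h : (B w).acked (fun i => N.frameRecord B i (y i) w) = none := by
    rw [Option.eq_none_iff_forall_ne_some]
    intro hb hh
    obtain ⟨h1, h2⟩ := (I.acked_eq_some rfl).1 hh
    exact h hb h1 h2
  simp only [Network.round, Memory.commit, h, and_self]

theorem acked_or_not (B : V → Memory) (y : Fin 8 → V → Fin N.slots) (w : V) :
    (∃ hb, (B w).upBatch = some hb ∧ Packet.mk (N.ident w) hb.1 hb.2 ∈
      (N.frameRecord B 0 (y 0) (N.tree.parent w)).packets) ∨
    (∀ hb, (B w).upBatch = some hb → Packet.mk (N.ident w) hb.1 hb.2 ∉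
      (N.frameRecord B 0 (y 0) (N.tree.parent w)).packets) := by
  by_contra! h
  obtain ⟨h1, hb, h2, h3⟩ := h
  exact h1 hb h2 h3

theorem pool_round_eq (I : Invariant N B) (h : (B v).talkers ⊆ (B v).finished) :
    (N.round B y v).pool = (B v).pool := by
  have : (N.round B y v).pool = (B v).newPool fun i => N.frameRecord B i (y i) v := rfl
  rw [this, Memory.newPool, I.fromChildren_eq_empty h]
  simp

theorem finished_subset_round : (B v).finished ⊆ (N.round B y v).finished :=
  Finset.subset_union_left

theorem mem_finished_round (I : Invariant N B) (hw : N.IsChild w v) :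
    N.ident w ∈ (N.round B y v).finished ↔ N.ident w ∈ (B v).finished ∨
      ∃ hb, (B w).upBatch = some hb ∧ hb.1 = 1 ∧
        Packet.mk (N.ident w) hb.1 hb.2 ∈ (N.frameRecord B 0 (y 0) v).packets := by
  have : (N.round B y v).finished = (B v).finished ∪
    (((B v).fromChildren fun i => N.frameRecord B i (y i) v).filter fun p => p.header = 1).image
      Packet.sender := rfl
  rw [this, Finset.mem_union, Finset.mem_image]
  refine or_congr_right ?_
  constructor
  · rintro ⟨p, hp, hs⟩
    obtain ⟨hp1, hp2⟩ := Finset.mem_filter.1 hp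
    obtain ⟨w', hb, h1, h2, rfl, h4⟩ := (I.mem_fromChildren rfl).1 hp1
    obtain rfl := N.ident.injective hs
    exact ⟨hb, h2, hp2, h4⟩
  · rintro ⟨hb, h1, h2, h3⟩
    exact ⟨_, Finset.mem_filter.2 ⟨(I.mem_fromChildren rfl).2 ⟨w, hb, hw, h1, rfl, h3⟩, h2⟩, rfl⟩

/-- Children gain at most one item in a round. -/
theorem avail_round_le (I : Invariant N B) (hw : w ≠ N.tree.root) :
    (N.round B y w).avail ≤ (B w).avail + 1 := by
  rcases I.avail_round (isChild_parent hw) (y := y) with h | h <;> omega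

/-- Children do not get ahead of what their parent has held at the beginning of the round. -/
theorem avail_round_le_parent (I : Invariant N B) (hw : N.IsChild w v) :
    (N.round B y w).avail ≤ (B v).avail := by
  have := I.avail_le_parent w v hw
  rcases I.avail_round hw (y := y) with h | h <;> omega

/-- Silence says that every child has received the item numbered `certified`. By the invariant a
child holds all earlier items, so it either appends this one or already has it. -/
theorem certified_lt_avail_round (I : Invariant N B) (hw : N.IsChild w v) (ha : (B v).Active)
    (hq : (N.frameRecord B 7 (y 7) v).quiet) :
    (B v).certified < (N.round B y w).avail := by
  obtain ⟨p, hp⟩ : ∃ p, N.packet B 7 v = some p := ⟨_, I.packet_of_active (by norm_num) ha⟩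
  have hh := (I.packet_spread (by norm_num) hp).2.1
  rw [if_pos rfl] at hh
  rw [← hh]
  refine I.avail_lt_round hw (i := 7) (by decide) hp ((quiet_seven_iff hp).1 hq w hw.adj) ?_
  rw [hh]
  exact I.certified_le w v hw

theorem round (I : Invariant N B) : Invariant N (N.round B y) := by
  constructor
  · exact fun v => I.view v
  · intro v a ha
    rcases I.mem_pool_round.1 ha with h | ⟨w, hb, hw, hu, -, hab⟩
    · exact I.pool_subtree v a h
    · have h1 := (I.upBatch_ne_none hu).2.2.2.1 hab
      obtain ⟨u, hu, hua, j, hj⟩ := I.pool_subtree w a (Finset.mem_sdiff.1 h1).1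
      exact ⟨u, hu, hua, j + 1, by rw [Function.iterate_succ_apply', hj, hw.2]⟩
  · exact fun v hv => pool_subset_round (I.own v hv)
  · intro v
    rcases acked_or_not B y v with ⟨hb, hu, hm⟩ | h
    · rw [(I.round_of_acked hu hm).1]
      refine Finset.Subset.trans (Finset.union_subset (I.sentUp_subset v) ?_) pool_subset_round
      exact (I.upBatch_ne_none hu).2.2.2.1.trans Finset.sdiff_subset
    · rw [(I.round_of_not_acked h).1]
      exact (I.sentUp_subset v).trans pool_subset_round
  · intro v hd
    rcases acked_or_not B y v with ⟨hb, hu, hm⟩ | h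
    · obtain ⟨h1, h2, h3⟩ := I.round_of_acked hu hm
      rw [h3] at hd
      obtain ⟨-, -, hd0, hsub, h4 | h4⟩ := I.upBatch_ne_none hu
      -- The new full batch consists of pending rumors, which have not been acknowledged before.
      · rw [h1, h2, Finset.card_union_of_disjoint, I.card_sentUp v hd0, h4.2]
        · ring
        · exact Finset.disjoint_of_subset_right hsub Finset.disjoint_sdiff
      · simp [h4.1] at hd
    · obtain ⟨h1, h2, h3⟩ := I.round_of_not_acked h
      rw [h1, h2]
      exact I.card_sentUp v (h3 ▸ hd)
  · intro v hd
    rcases acked_or_not B y v with ⟨hb, hu, hm⟩ | h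
    · obtain ⟨h1, h2, h3⟩ := I.round_of_acked hu hm
      rw [h3] at hd
      obtain ⟨-, -, hd0, hsub, h4 | h4⟩ := I.upBatch_ne_none hu
      · simp [h4.1] at hd
      -- The last batch contains everything pending, and nothing new arrives during the round
      -- because all talkers have finished.
      · rw [I.pool_round_eq h4.2.2.2, h1, h4.2.1]
        refine ⟨fun a ha => ?_, h4.2.2.2.trans finished_subset_round⟩
        simp only [Memory.pending, Finset.mem_union, Finset.mem_sdiff]
        tauto
    · obtain ⟨h1, h2, h3⟩ := I.round_of_not_acked h
      obtain ⟨h4, h5⟩ := I.of_done v (h3 ▸ hd)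
      rw [I.pool_round_eq h5, h1]
      exact ⟨h4, h5.trans finished_subset_round⟩
  · intro w v hw
    rcases acked_or_not B y w with ⟨hb, hu, hm⟩ | h
    · rw [(I.round_of_acked hu hm).1]
      refine Finset.union_subset ((I.sentUp_subset_parent w v hw).trans pool_subset_round) ?_
      intro a ha
      rw [hw.2] at hm
      exact I.mem_pool_round.2 (Or.inr ⟨w, hb, hw, hu, hm, ha⟩)
    · rw [(I.round_of_not_acked h).1]
      exact (I.sentUp_subset_parent w v hw).trans pool_subset_round
  · intro w v hw
    rw [I.mem_finished_round hw, I.mem_finished w v hw, ← hw.2]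
    rcases acked_or_not B y w with ⟨hb, hu, hm⟩ | h
    · rw [(I.round_of_acked hu hm).2.2]
      have := (I.upBatch_ne_none hu).2.2.1
      simp only [this, Bool.false_eq_true, false_or, decide_eq_true_eq]
      constructor
      · rintro ⟨hb', hu', h1, -⟩
        rw [hu] at hu'
        rw [Option.some.inj hu']; exact h1
      · exact fun h1 => ⟨hb, hu, h1, hm⟩
    · rw [(I.round_of_not_acked h).2.2]
      refine or_iff_left ?_
      rintro ⟨hb, hu, -, hm⟩
      exact h hb hu hm
  · intro v hv
    rcases I.recv_round (y := y) (w := v) with h | h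
    · rw [h.1]; exact I.recv v hv
    · rw [h.1, List.length_append, List.length_singleton, List.range_succ, List.map_append,
        ← I.recv v hv, I.avail_of_ne hv]
      rfl
  · exact fun w v hw => (I.avail_round_le_parent hw).trans I.avail_le_round
  · intro w v hw
    rcases certified_round (B := B) (y := y) (v := v) with ⟨h1, h2, h3⟩ | ⟨h1, -⟩
    · rw [h1]; exact I.certified_lt_avail_round hw h2 h3
    · rw [h1]; exact (I.certified_le w v hw).trans I.avail_le_round
  · intro v hv
    -- If a child has reported a gap, that child stays within one item of the lowered pointer. If
    -- none has, pointer and child advance by at most one, limited by the items at hand. At an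
    -- inactive node the children already hold all that the node holds.
    rcases pointer_round (B := B) (y := y) (v := v) with ⟨h1, -, h2⟩ | ⟨h1, -, h2⟩ | ⟨h1, h2⟩
    · obtain ⟨-, i, -, -, w, hw, hlt, -⟩ := I.nack_iff.1 h1
      refine ⟨w, hw, ?_⟩
      have := I.avail_round_le hw.1 (y := y)
      omega
    · obtain ⟨w, hw, hle⟩ := I.exists_avail_le v hv
      refine ⟨w, hw, ?_⟩
      have h3 := I.avail_round_le hw.1 (y := y)
      have h4 := I.avail_round_le_parent hw (y := y)
      have h5 := I.avail_le_round (y := y) (v := v)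
      omega
    · obtain ⟨w, hw, hle⟩ := I.exists_avail_le v hv
      refine ⟨w, hw, ?_⟩
      have h3 := I.avail_round_le_parent hw (y := y)
      have h4 := I.certified_le w v hw
      have h5 : ¬ (B v).certified < (B v).avail := fun h => h1 (I.active_iff.2 ⟨hv, h⟩)
      omega
  · intro v
    have h5 := I.avail_le_round (y := y) (v := v)
    have := I.pointer_le v
    rcases pointer_round (B := B) (y := y) (v := v) with
      ⟨h1, -, h2⟩ | ⟨h1, -, h2⟩ | ⟨h1, h2⟩ <;> omega

end Invariant

end Network

namespace Network

variable {V : Type} [Fintype V] [DecidableEq V] (N : Network V)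

/-! ### Executions of the protocol -/

/-- The records of the first `i` frames of a round. -/
noncomputable def log (B : V → Memory) (z : ℕ → V → Fin N.slots) (i : ℕ) (v : V) : List Record :=
  (List.range i).map fun j => N.frameRecord B j (z j) v

/-- After `i` frames of a round, in which the numbers `z` have been drawn, the configuration is as
described by the memories `B` at the beginning of the round. -/
structure Tracks (cfg : Config gossip V) (B : V → Memory) (z : ℕ → V → Fin N.slots) (i : ℕ) :
    Prop where
  state : ∀ v, cfg.state v = ((B v, N.log B z i v) : Memory × List Record)
  pool : ∀ v, (B v).pool ⊆ cfg.known v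
  item : ∀ v, ∀ j < (B v).avail, N.item j ⊆ cfg.known v
  packets : ∀ v, ∀ j < i, ∀ p ∈ (N.frameRecord B j (z j) v).packets, p.batch ⊆ cfg.known v

/-- The memories at the beginning of the round `n`. -/
noncomputable def memory (x : ℕ → V → Fin N.slots) (n : ℕ) : V → Memory :=
  orbit N.round N.initialMemory (fun n (i : Fin 8) => x (8 * n + i)) n

variable {N} {cfg : Config gossip V} {B : V → Memory} {z : ℕ → V → Fin N.slots} {i : ℕ}

theorem invariant_memory (x : ℕ → V → Fin N.slots) (n : ℕ) : Invariant N (N.memory x n) :=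
  orbit_invariant invariant_initial (fun _ _ h => h.round) _ n

theorem item_subset (j : ℕ) : N.item j ⊆ N.rumors := chunk_subset _ _ _

namespace Tracks

theorem send_eq (h : Tracks N cfg B z i) (v : V) :
    gossip.send (cfg.state v) = (B v).sendAt i := by
  rw [h.state v]
  change (B v).sendAt (N.log B z i v).length = _
  simp [log]

/-- The admissibility test in `sent` never suppresses a packet: batches consist of rumors held by
the sender and have at most `c` elements. So the model with memories describes the true channel. -/
theorem sent_eq (h : Tracks N cfg B z i) (I : Invariant N B) (hc : 1 ≤ N.compression) :
    N.sent cfg = N.packet B i := by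
  ext1 v
  unfold sent packet
  rw [h.send_eq v]
  cases hs : (B v).sendAt i with
  | none => rfl
  | some hb =>
    simp only [Option.map_some]
    rw [if_pos]
    by_cases hi : i = 0
    · subst hi
      obtain ⟨-, -, -, h1, h2⟩ := I.upBatch_ne_none
        (show (B v).upBatch = some hb by simpa [Memory.sendAt] using hs)
      refine ⟨(h1.trans Finset.sdiff_subset).trans (h.pool v), ?_⟩
      rcases h2 with h2 | h2
      · exact h2.2.le
      · rw [h2.2.1]; exact h2.2.2.1.le
    · have hp : N.packet B i v = some ⟨N.ident v, hb.1, hb.2⟩ := by simp [packet, hs]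
      obtain ⟨-, -, h1, h2⟩ := I.packet_spread hi hp
      simp only at h1 h2
      rw [h2]
      exact ⟨h.item v _ h1, card_chunk_le hc _ _⟩

theorem heardData_eq (h : Tracks N cfg B z i) (I : Invariant N B) (hc : 1 ≤ N.compression)
    (x : V → Fin N.slots) : N.heardData cfg x = N.hears B i x := by
  ext v s
  unfold heardData hears
  rw [h.sent_eq I hc]

theorem replies_iff (h : Tracks N cfg B z i) (I : Invariant N B) (hc : 1 ≤ N.compression)
    (x : V → Fin N.slots) (v : V) (s : Fin N.slots) :
    N.replies cfg x v s = true ↔ (B v).ReplyAt i (N.hears B i x v s) := by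
  unfold replies
  rw [h.heardData_eq I hc, h.state v]
  classical
  have hl : (N.log B z i v).length = i := by simp [log]
  refine (decide_eq_true_iff (p := (B v).ReplyAt (N.log B z i v).length (N.hears B i x v s))).trans ?_
  rw [hl]

open Classical in
theorem heardReply_eq (h : Tracks N cfg B z i) (I : Invariant N B) (hc : 1 ≤ N.compression)
    (x : V → Fin N.slots) (v : V) (s : Fin N.slots) :
    N.heardReply cfg x v s = heard N.graph
      (fun u => if (B u).ReplyAt i (N.hears B i x u s) then some () else none) v := by
  unfold heardReply
  congr 1
  ext1 u
  simp only [h.replies_iff I hc]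

theorem known_subset_step (x : V → Fin N.slots) (v : V) :
    cfg.known v ⊆ (N.step cfg x).known v := Finset.subset_union_left

theorem batch_subset_step (h : Tracks N cfg B z i) (I : Invariant N B) (hc : 1 ≤ N.compression)
    (x : V → Fin N.slots) {v : V} {p : Packet} (hp : p ∈ (N.frameRecord B i x v).packets) :
    p.batch ⊆ (N.step cfg x).known v := by
  simp only [frameRecord, mem_packetsOf] at hp
  obtain ⟨s, hs⟩ := hp
  refine Finset.Subset.trans ?_ Finset.subset_union_right
  intro a ha
  refine Finset.mem_biUnion.2 ⟨s, Finset.mem_univ _, ?_⟩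
  rw [h.heardData_eq I hc, hs]
  exact ha

theorem update_eq (h : Tracks N cfg B z i) (I : Invariant N B) (hc : 1 ≤ N.compression) (v : V) :
    (N.step cfg (z i)).state v =
      ((if i = 7 then ((B v).commit fun j => (N.log B z (i + 1) v).getD j ⟨∅, True⟩, [])
        else (B v, N.log B z (i + 1) v)) : Memory × List Record) := by
  have hl : N.log B z (i + 1) v = N.log B z i v ++ [N.frameRecord B i (z i) v] := by
    simp [log, List.range_succ]
  have hr : N.frameRecord B i (z i) v = Record.mk (packetsOf (N.heardData cfg (z i) v))
      (N.heardReply cfg (z i) v (z i v) = Heard.silence) := by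
    rw [h.heardReply_eq I hc, h.heardData_eq I hc]
    rfl
  unfold step
  simp only
  rw [h.state v, hl, hr]
  change (if (N.log B z i v).length = 7 then _ else _) = _
  have : (N.log B z i v).length = i := by simp [log]
  rw [this]
  rfl

theorem succ (h : Tracks N cfg B z i) (I : Invariant N B) (hc : 1 ≤ N.compression) (hi : i ≠ 7) :
    Tracks N (N.step cfg (z i)) B z (i + 1) := by
  constructor
  · intro v
    rw [h.update_eq I hc v, if_neg hi]
  · exact fun v => (h.pool v).trans (known_subset_step _ _)
  · exact fun v j hj => (h.item v j hj).trans (known_subset_step _ _)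
  · intro v j hj p hp
    rcases Nat.lt_succ_iff_lt_or_eq.1 hj with h1 | rfl
    · exact (h.packets v j h1 p hp).trans (known_subset_step _ _)
    · exact h.batch_subset_step I hc _ hp

/-- Received rumors count as held at once but enter the memory only at the end of the round; the
field `packets` of `Tracks` bridges the gap. -/
theorem next_round (h : Tracks N cfg B z 7) (I : Invariant N B) (hc : 1 ≤ N.compression)
    (z' : ℕ → V → Fin N.slots) :
    Tracks N (N.step cfg (z 7)) (N.round B fun i => z i) z' 0 := by
  have hpk : ∀ v, ∀ j < 8, ∀ p ∈ (N.frameRecord B j (z j) v).packets,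
      p.batch ⊆ (N.step cfg (z 7)).known v := by
    intro v j hj p hp
    rcases Nat.lt_succ_iff_lt_or_eq.1 hj with h1 | rfl
    · exact (h.packets v j h1 p hp).trans (known_subset_step _ _)
    · exact h.batch_subset_step I hc _ hp
  have hpool : ∀ v, (N.round B (fun i => z i) v).pool ⊆ (N.step cfg (z 7)).known v := by
    intro v a ha
    rcases I.mem_pool_round.1 ha with h1 | ⟨w, hb, -, -, hm, hab⟩
    · exact known_subset_step _ _ (h.pool v h1)
    · exact hpk v 0 (by norm_num) _ hm hab
  constructor
  · intro v
    rw [h.update_eq I hc v, if_pos rfl]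
    have h1 : (fun j : Fin 8 => (N.log B z (7 + 1) v).getD j ⟨∅, True⟩) =
        fun j : Fin 8 => N.frameRecord B j (z j) v := by
      ext1 j
      simp [log, List.getD]
    rw [h1]
    simp only [log, List.range_zero, List.map_nil]
    rfl
  · exact hpool
  · intro v j hj
    by_cases hv : v = N.tree.root
    · subst hv
      have I' := I.round (y := fun i => z i)
      rw [I'.avail_root] at hj
      split_ifs at hj with hk
      · refine Finset.Subset.trans ?_ (hpool _)
        rw [I'.pool_eq hk]
        exact item_subset j
      · omega
    · rcases I.avail_round (isChild_parent hv) (y := fun i => z i) with h1 | ⟨h1, -, p, hp⟩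
      · rw [h1.1] at hj
        exact (h.item v j hj).trans (known_subset_step _ _)
      · rw [h1] at hj
        rcases Nat.lt_succ_iff_lt_or_eq.1 hj with h2 | rfl
        · exact (h.item v j h2).trans (known_subset_step _ _)
        · obtain ⟨⟨k, hk, hm⟩, -⟩ := id hp
          obtain ⟨u, -, h3, -, h4, -⟩ := I.isNext_iff hp
          rw [← h3, ← h4]
          exact hpk v k k.2 p hm
  · intro v j hj
    omega

end Tracks

theorem tracks_run (hc : 1 ≤ N.compression) (x : ℕ → V → Fin N.slots) (n : ℕ) :
    ∀ i < 8, Tracks N (N.run gossip x (8 * n + i)) (N.memory x n) (fun j => x (8 * n + j)) i := by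
  have hstep : ∀ n, Tracks N (N.run gossip x (8 * n)) (N.memory x n) (fun j => x (8 * n + j)) 0 →
      ∀ i < 8, Tracks N (N.run gossip x (8 * n + i)) (N.memory x n) (fun j => x (8 * n + j)) i := by
    intro n h i hi
    induction i with
    | zero => exact h
    | succ i ih => exact (ih (by omega)).succ (invariant_memory x n) hc (by omega)
  refine hstep n ?_
  induction n with
  | zero =>
    constructor
    · exact fun v => rfl
    · intro v
      by_cases h : v ∈ N.sources
      · exact (show (N.initialMemory v).pool = {N.ident v} from if_pos h) ▸
          (show (N.run gossip x 0).known v = {N.ident v} from if_pos h) ▸ subset_rfl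
      · exact (show (N.initialMemory v).pool = ∅ from if_neg h) ▸ Finset.empty_subset _
    · intro v j hj
      have I := invariant_initial (N := N)
      have hj : j < (N.initialMemory v).avail := hj
      by_cases hv : v = N.tree.root
      · subst hv
        rw [I.avail_root] at hj
        split_ifs at hj with hk
        · refine (item_subset j).trans ?_
          rw [← I.pool_eq hk]
          by_cases h : N.tree.root ∈ N.sources
          · exact (show (N.initialMemory N.tree.root).pool = {N.ident N.tree.root} from if_pos h) ▸
              (show (N.run gossip x 0).known N.tree.root = {N.ident N.tree.root} from if_pos h) ▸
                subset_rfl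
          · exact (show (N.initialMemory N.tree.root).pool = ∅ from if_neg h) ▸
              Finset.empty_subset _
        · omega
      · rw [I.avail_of_ne hv] at hj
        exact absurd hj (Nat.not_lt_zero _)
    · intro v j hj
      omega
  | succ n ih => exact (hstep n ih 7 (by norm_num)).next_round (invariant_memory x n) hc _

theorem sent_run (hc : 1 ≤ N.compression) (x : ℕ → V → Fin N.slots) (n : ℕ) {i : ℕ} (hi : i < 8) :
    N.sent (N.run gossip x (8 * n + i)) = N.packet (N.memory x n) i :=
  (tracks_run hc x n i hi).sent_eq (invariant_memory x n) hc

/-- Items have been sent by the parent. -/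
theorem exists_sent_item (hc : 1 ≤ N.compression) (x : ℕ → V → Fin N.slots) (n : ℕ) (v : V)
    (hv : v ≠ N.tree.root) (j : ℕ) (hj : j < (N.memory x n v).avail) :
    ∃ t < 8 * n, ∃ q, N.sent (N.run gossip x t) (N.tree.parent v) = some q ∧
      q.batch = N.item j := by
  induction n with
  | zero =>
    have hj : j < (N.initialMemory v).avail := hj
    rw [invariant_initial.avail_of_ne hv] at hj
    exact absurd hj (Nat.not_lt_zero _)
  | succ n ih =>
    have I := invariant_memory x n
    have hj : j < (N.round (N.memory x n) (fun i => x (8 * n + i)) v).avail := hj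
    have hold : j < (N.memory x n v).avail → ∃ t < 8 * (n + 1), ∃ q,
        N.sent (N.run gossip x t) (N.tree.parent v) = some q ∧ q.batch = N.item j := by
      intro h
      obtain ⟨t, ht, h⟩ := ih h
      exact ⟨t, by omega, h⟩
    rcases I.avail_round (isChild_parent hv) (y := fun i => x (8 * n + i)) with h | ⟨h, -, p, hp⟩
    · exact hold (h.1 ▸ hj)
    · rw [h] at hj
      rcases Nat.lt_succ_iff_lt_or_eq.1 hj with h2 | rfl
      · exact hold h2
      · obtain ⟨u, hu, h3, -, h4, i, -, h5⟩ := I.isNext_iff hp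
        obtain rfl := hu.2
        refine ⟨8 * n + i, by omega, p, ?_, by rw [h4, h3]⟩
        rw [sent_run hc x n i.2, h5]

/-- The first frame of a round yields the upward alternative by `pool_subtree`. In the other frames
the batch is an item; away from the root it was received from the parent, and the root has items
only when its pool is complete. -/
theorem gathersThenSpreads_gossip (hc : 1 ≤ N.compression) : N.GathersThenSpreads gossip := by
  intro x t v p hp
  obtain ⟨n, i, hi, rfl⟩ : ∃ n i, i < 8 ∧ t = 8 * n + i :=
    ⟨t / 8, t % 8, Nat.mod_lt _ (by norm_num), (Nat.div_add_mod t 8).symm⟩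
  rw [sent_run hc x n hi] at hp
  have I := invariant_memory x n
  by_cases h0 : i = 0
  · subst h0
    rw [Invariant.packet_zero, Option.map_eq_some_iff] at hp
    obtain ⟨hb, hu, rfl⟩ := hp
    obtain ⟨h1, h2, -, h3, -⟩ := I.upBatch_ne_none hu
    exact ⟨h2, fun h => absurd h h1, fun _ => Or.inl fun a ha =>
      I.pool_subtree v a (Finset.sdiff_subset (h3 ha))⟩
  · obtain ⟨h1, -, h3, h4⟩ := I.packet_spread h0 hp
    obtain ⟨⟨w, hw⟩, -⟩ := I.active_iff.1 h1
    refine ⟨Finset.mem_union_left _ hw.mem, ?_, fun hv => Or.inr ?_⟩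
    · rintro rfl
      rw [I.avail_root] at h3
      split_ifs at h3 with hk
      · rw [← I.pool_eq hk]
        exact (tracks_run hc x n i hi).pool _
      · omega
    · obtain ⟨t, ht, q, hq, hqb⟩ := exists_sent_item hc x n v hv _ h3
      exact ⟨t, by omega, q, hq, by rw [hqb, h4]⟩

/-- The number of transmissions in the `i`-th frame of a round. -/
noncomputable def frameCost (N : Network V) (B : V → Memory) (i : ℕ) (x : V → Fin N.slots) : ℕ :=
  open Classical in
  (Finset.univ.filter fun v => (N.packet B i v).isSome).card +
    (Finset.univ.filter fun q : V × Fin N.slots =>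
      (B q.1).ReplyAt i (N.hears B i x q.1 q.2)).card

theorem frameMessages_run (hc : 1 ≤ N.compression) (x : ℕ → V → Fin N.slots) (n : ℕ) {i : ℕ}
    (hi : i < 8) :
    N.frameMessages gossip x (8 * n + i) = N.frameCost (N.memory x n) i (x (8 * n + i)) := by
  classical
  unfold frameMessages frameCost
  rw [sent_run hc x n hi]
  congr 2
  · ext q
    simp only [Finset.mem_filter, Finset.mem_univ, true_and]
    exact (tracks_run hc x n i hi).replies_iff (invariant_memory x n) hc _ _ _

theorem totalMessages_gossip (hc : 1 ≤ N.compression) (x : ℕ → V → Fin N.slots) :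
    N.totalMessages gossip x =
      ∑' n, ∑ i : Fin 8, (N.frameCost (N.memory x n) i (x (8 * n + i)) : ℝ≥0∞) := by
  unfold totalMessages
  rw [← (Nat.divModEquiv 8).symm.tsum_eq, ENNReal.tsum_prod
    (f := fun n i => (N.frameMessages gossip x ((Nat.divModEquiv 8).symm (n, i)) : ℝ≥0∞))]
  refine tsum_congr fun n => ?_
  rw [tsum_fintype]
  refine Finset.sum_congr rfl fun i _ => ?_
  rw [← frameMessages_run hc x n i.2]
  simp [Nat.divModEquiv, mul_comm, add_comm]

/-- Every node holds all items. -/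
def Complete (N : Network V) (B : V → Memory) : Prop := ∀ v, N.numItems ≤ (B v).avail

theorem rumors_subset_of_complete (hc : 1 ≤ N.compression) (x : ℕ → V → Fin N.slots) {n : ℕ}
    (h : N.Complete (N.memory x n)) (v : V) : N.rumors ⊆ (N.run gossip x (8 * n)).known v := by
  intro a ha
  obtain ⟨j, hj, haj⟩ := exists_mem_chunk (c := N.compression) ha
  rw [N.card_rumors] at hj
  exact (tracks_run hc x n 0 (by norm_num)).item v j (hj.trans_le (h v)) haj

-- A round takes `16 * N.slots` slots, and all rounds before the first complete one are incomplete.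
-- Bounding the time by a sum of indicators leaves only the probability of incompleteness after `n`
-- rounds to be estimated.
open Classical in
theorem completionTime_gossip_le (hc : 1 ≤ N.compression) (x : ℕ → V → Fin N.slots) :
    N.completionTime gossip x ≤
      ∑' n, if N.Complete (N.memory x n) then 0 else ((16 * N.slots : ℕ) : ℝ≥0∞) := by
  by_cases hex : ∃ n, N.Complete (N.memory x n)
  · have hn := Nat.find_spec hex
    have hmin : ∀ n < Nat.find hex, ¬ N.Complete (N.memory x n) := fun n h => Nat.find_min hex h
    set n := Nat.find hex
    calc N.completionTime gossip x ≤ ((2 * N.slots * (8 * n) : ℕ) : ℝ≥0∞) :=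
          iInf₂_le (8 * n) fun v => rumors_subset_of_complete hc x hn v
      _ = ∑ k ∈ Finset.range n, ((16 * N.slots : ℕ) : ℝ≥0∞) := by
          rw [Finset.sum_const, Finset.card_range, nsmul_eq_mul]
          push_cast; ring
      _ = ∑ k ∈ Finset.range n,
            if N.Complete (N.memory x k) then 0 else ((16 * N.slots : ℕ) : ℝ≥0∞) :=
          Finset.sum_congr rfl fun k hk => by rw [if_neg (hmin k (Finset.mem_range.1 hk))]
      _ ≤ _ := ENNReal.sum_le_tsum _
  · push Not at hex
    -- Without slots the draws `x 0 v` could not exist, so `V` would be empty and completeness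
    -- vacuous.
    by_cases hs : N.slots = 0
    · have : IsEmpty V := ⟨fun v => by
        have := (x 0 v).2
        omega⟩
      exact absurd (fun v => isEmptyElim v) (hex 0)
    · simp only [hex, if_false]
      rw [ENNReal.tsum_const_eq_top_of_ne_zero]
      · exact le_top
      · exact_mod_cast (by omega : 16 * N.slots ≠ 0)

end Network

namespace Network

variable {V : Type} [Fintype V] [DecidableEq V] {N : Network V}

/-! ### Sums over the arborescence -/

/-- If every node of `A` is dominated by one of its children, then the sum over `A` is at most the
sum over all nodes. -/
theorem sum_le_sum_of_child {A : Finset V} {f g : V → ℝ} (hg : ∀ v, 0 ≤ g v)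
    (h : ∀ v ∈ A, ∃ w, N.IsChild w v ∧ f v ≤ g w) : ∑ v ∈ A, f v ≤ ∑ v, g v := by
  classical
  choose! φ hφ using h
  -- A child determines its parent, so no node is charged twice.
  have hinj : Set.InjOn φ A := fun a ha b hb hab => by
    rw [← (hφ a ha).1.2, ← (hφ b hb).1.2, hab]
  calc ∑ v ∈ A, f v ≤ ∑ v ∈ A, g (φ v) := Finset.sum_le_sum fun v hv => (hφ v hv).2
    _ = ∑ w ∈ A.image φ, g w := (Finset.sum_image hinj).symm
    _ ≤ ∑ v, g v := Finset.sum_le_univ_sum_of_nonneg hg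

open Classical in
theorem card_children_le [DecidableRel N.graph.Adj] {δ : ℕ} (hδ : ∀ v ∈ N.backbone, N.graph.degree v ≤ δ) (v : V) :
    (Finset.univ.filter fun w => N.IsChild w v).card ≤ δ := by
  rcases (Finset.univ.filter fun w => N.IsChild w v).eq_empty_or_nonempty with h | ⟨w, hw⟩
  · simp [h]
  · have hv := (Finset.mem_filter.1 hw).2.mem
    refine le_trans (Finset.card_le_card fun u hu => ?_) (hδ v hv)
    simpa using (Finset.mem_filter.1 hu).2.adj

-- Each node is charged by its children, of which there are at most `δ`.
open Classical in
theorem sum_parent_le [DecidableRel N.graph.Adj] {δ : ℕ} (hδ : ∀ v ∈ N.backbone, N.graph.degree v ≤ δ) {A : Finset V}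
    (hA : ∀ v ∈ A, v ≠ N.tree.root) {f g : V → ℝ} (hg : ∀ v, 0 ≤ g v)
    (h : ∀ v ∈ A, f v ≤ g (N.tree.parent v)) : ∑ v ∈ A, f v ≤ δ * ∑ v, g v := by
  calc ∑ v ∈ A, f v ≤ ∑ v ∈ A, g (N.tree.parent v) := Finset.sum_le_sum h
    _ = ∑ y, ∑ v ∈ A with N.tree.parent v = y, g (N.tree.parent v) :=
        (Finset.sum_fiberwise _ _ _).symm
    _ ≤ ∑ y, δ * g y := by
        refine Finset.sum_le_sum fun y _ => ?_
        rw [Finset.sum_congr rfl fun v hv => by rw [(Finset.mem_filter.1 hv).2],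
          Finset.sum_const, nsmul_eq_mul]
        refine mul_le_mul_of_nonneg_right ?_ (hg y)
        refine le_trans ?_ (Nat.cast_le.2 (card_children_le hδ y))
        refine Nat.cast_le.2 (Finset.card_le_card fun v hv => ?_)
        simp only [Finset.mem_filter, Finset.mem_univ, true_and] at hv ⊢
        exact ⟨hA v hv.1, hv.2⟩
    _ = _ := (Finset.mul_sum _ _ _).symm

/-- Nodes of large depth have little weight in total. -/
theorem sum_inv_pow_depth_le [DecidableRel N.graph.Adj] {δ : ℕ} (hδ : ∀ v ∈ N.backbone, N.graph.degree v ≤ δ) {β : ℝ}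
    (hβ : 2 * δ ≤ β) (hβ0 : 0 < β) : ∑ v, (β⁻¹) ^ N.tree.depth v ≤ 2 := by
  classical
  set s := ∑ v, (β⁻¹) ^ N.tree.depth v with hs
  have h1 : ∑ v ∈ Finset.univ.erase N.tree.root, (β⁻¹) ^ N.tree.depth v ≤
      δ * ∑ v, (β⁻¹ * (β⁻¹) ^ N.tree.depth v) := by
    refine sum_parent_le hδ (fun v hv => Finset.ne_of_mem_erase hv) (fun v => by positivity)
      fun v hv => ?_
    rw [N.tree.depth_parent v (Finset.ne_of_mem_erase hv), pow_succ']
  rw [← Finset.mul_sum, ← hs] at h1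
  have h2 : s = 1 + ∑ v ∈ Finset.univ.erase N.tree.root, (β⁻¹) ^ N.tree.depth v := by
    rw [hs, ← Finset.add_sum_erase _ _ (Finset.mem_univ N.tree.root), N.tree.depth_root, pow_zero]
  -- Beyond the root each level has at most half the weight of the previous one, whence s ≤ 1 + s/2.
  have h3 : δ * (β⁻¹ * s) ≤ s / 2 := by
    have h4 : (δ : ℝ) * β⁻¹ ≤ 1 / 2 := by
      rw [mul_inv_le_iff₀ hβ0]; linarith
    have : 0 ≤ s := Finset.sum_nonneg fun v _ => by positivity
    nlinarith
  linarith

/-! ### Gathering -/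

/-- The parent of `v` is still waiting for packets of `v`. -/
def Awaited (N : Network V) (B : V → Memory) (v : V) : Prop :=
  v ≠ N.tree.root ∧ v ∈ N.backbone ∪ N.sources ∧ (B v).done = false

namespace Invariant

variable {B : V → Memory} {y : Fin 8 → V → Fin N.slots} {v w : V}

theorem compression_mul_count_le (I : Invariant N B) (h : (B v).done = false) :
    N.compression * (B v).count ≤ N.sources.card := by
  rw [← I.card_sentUp v h, ← N.card_rumors]
  exact Finset.card_le_card ((I.sentUp_subset v).trans I.pool_subset)

theorem count_lt (I : Invariant N B) (hc : 1 ≤ N.compression) (h : (B v).done = false) :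
    (B v).count < N.numItems := by
  refine Nat.lt_succ_of_le ((Nat.le_div_iff_mul_le hc).2 ?_)
  rw [mul_comm]
  exact I.compression_mul_count_le h

theorem upBatch_isSome_iff (I : Invariant N B) : (B v).upBatch.isSome ↔
    N.Awaited B v ∧ (N.compression ≤ (B v).pending.card ∨ (B v).talkers ⊆ (B v).finished) := by
  have hsrc : (B v).view.isSource ∨ (B v).view.inBackbone ↔ v ∈ N.backbone ∪ N.sources := by
    rw [I.isSource, I.inBackbone, Finset.mem_union, or_comm]
  unfold Memory.upBatch Awaited
  split_ifs with h1 h2 h3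
  · simp only [Option.isSome_none, Bool.false_eq_true, false_iff]
    rintro ⟨⟨h2, h3, h4⟩, -⟩
    rw [hsrc, I.parent_eq_none] at h1
    simp_all
  all_goals
    rw [hsrc, I.parent_eq_none] at h1
    rw [I.compression] at h2
    push Not at h1
    simp_all

/-- A node that has to wait has a child that has not sent more than itself. -/
theorem exists_child_of_upBatch_eq_none (I : Invariant N B)
    (h : N.Awaited B v) (hu : (B v).upBatch = none) :
    ∃ w, N.IsChild w v ∧ N.Awaited B w ∧ (B w).count ≤ (B v).count := by
  have h1 : ¬ (B v).upBatch.isSome := by simp [hu]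
  rw [I.upBatch_isSome_iff] at h1
  push Not at h1
  obtain ⟨h2, h3⟩ := h1 h
  obtain ⟨i, hi, hif⟩ := Finset.not_subset.1 h3
  obtain ⟨w, rfl⟩ := I.exists_of_mem_talkers hi
  obtain ⟨hw, hwD⟩ := I.mem_talkers.1 hi
  have hd : (B w).done = false := by
    rw [I.mem_finished w v hw] at hif
    simpa using hif
  refine ⟨w, hw, ⟨hw.1, hwD, hd⟩, ?_⟩
  have h4 := Finset.card_le_card (I.sentUp_subset_parent w v hw)
  have h5 : (B v).pending.card = (B v).pool.card - (B v).sentUp.card :=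
    Finset.card_sdiff_of_subset (I.sentUp_subset v)
  have h6 := Finset.card_le_card (I.sentUp_subset v)
  rw [I.card_sentUp w hd] at h4
  rw [I.card_sentUp v h.2.2] at h5 h6
  -- What `w` has sent lies in the pool of `v`, and less than one full batch of that pool is pending
  -- at `v`.
  have h7 : N.compression * (B w).count < N.compression * ((B v).count + 1) := by
    rw [mul_add, mul_one]; omega
  exact Nat.lt_succ_iff.1 (Nat.lt_of_mul_lt_mul_left h7)

theorem awaited_round (I : Invariant N B) (h : N.Awaited (N.round B y) v) : N.Awaited B v := by
  refine ⟨h.1, h.2.1, ?_⟩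
  rcases acked_or_not B y v with ⟨hb, hu, hm⟩ | hn
  · exact (I.upBatch_ne_none hu).2.2.1
  · rw [← (I.round_of_not_acked hn).2.2]; exact h.2.2

/-- Rumors are at the root when no packet is awaited any more. -/
theorem pool_root_of_not_awaited (I : Invariant N B) (h : ∀ v, ¬ N.Awaited B v) :
    N.sources.card ≤ (B N.tree.root).pool.card := by
  have hdone : ∀ v, v ≠ N.tree.root → v ∈ N.backbone ∪ N.sources → (B v).done = true := by
    intro v h1 h2
    by_contra h3
    exact h v ⟨h1, h2, by simpa using h3⟩
  -- A rumor climbs the tree: a node that is done has sent up its whole pool, and what is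
  -- acknowledged lies in the pool of the parent.
  have hup : ∀ j : ℕ, ∀ u ∈ N.sources, N.ident u ∈ (B (N.tree.parent^[j] u)).pool := by
    intro j u hu
    induction j with
    | zero => exact I.own u hu
    | succ j ih =>
      rw [Function.iterate_succ_apply']
      by_cases hr : N.tree.parent^[j] u = N.tree.root
      · rw [hr, N.tree.parent_root, ← hr]; exact ih
      · have hmem : N.tree.parent^[j] u ∈ N.backbone ∪ N.sources := by
          cases j with
          | zero => exact Finset.mem_union_right _ hu
          | succ j =>
            refine Finset.mem_union_left _ ?_
            rw [Function.iterate_succ_apply'] at hr ⊢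
            refine N.tree.parent_mem _ fun h' => hr ?_
            rw [h', N.tree.parent_root]
        exact I.sentUp_subset_parent _ _ (isChild_parent hr)
          ((I.of_done _ (hdone _ hr hmem)).1 ih)
  have hroot : ∀ n v, N.tree.depth v = n → N.tree.parent^[n] v = N.tree.root := by
    intro n
    induction n with
    | zero =>
      intro v hv
      by_contra hr
      have := N.tree.depth_parent v hr
      omega
    | succ n ih =>
      intro v hv
      have hr : v ≠ N.tree.root := by
        rintro rfl
        rw [N.tree.depth_root] at hv
        omega
      rw [Function.iterate_succ_apply]
      refine ih _ ?_
      have := N.tree.depth_parent v hr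
      omega
  rw [← N.card_rumors]
  refine Finset.card_le_card fun a ha => ?_
  simp only [rumors, Finset.mem_map] at ha
  obtain ⟨u, hu, rfl⟩ := ha
  rw [← hroot _ u rfl]
  exact hup _ u hu

end Invariant

open Classical in
/-- The weight of a node in the potential of the gathering. -/
noncomputable def gatherWeight (N : Network V) (β : ℝ) (B : V → Memory) (v : V) : ℝ :=
  if N.Awaited B v then β ^ (N.tree.depth v + (N.numItems - (B v).count)) else 0

/-- The potential of the gathering. -/
noncomputable def gatherPotential (N : Network V) (β : ℝ) (B : V → Memory) : ℝ :=
  ∑ v, N.gatherWeight β B v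

variable {β : ℝ} {B : V → Memory}

theorem gatherWeight_nonneg (hβ : 0 ≤ β) (v : V) : 0 ≤ N.gatherWeight β B v := by
  unfold gatherWeight; split_ifs <;> positivity

theorem gatherPotential_nonneg (hβ : 0 ≤ β) : 0 ≤ N.gatherPotential β B :=
  Finset.sum_nonneg fun v _ => gatherWeight_nonneg hβ v

theorem one_le_gatherPotential (hβ : 1 ≤ β) {v : V} (h : N.Awaited B v) :
    1 ≤ N.gatherPotential β B := by
  refine le_trans ?_ (Finset.single_le_sum (fun v _ => gatherWeight_nonneg (by linarith) v)
    (Finset.mem_univ v))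
  rw [gatherWeight, if_pos h]
  exact one_le_pow₀ hβ

-- An acknowledgement divides the weight by `β`, or removes it if the batch was the last. Without a
-- conflict at the parent there is an acknowledgement, so the full weight survives only in case of a
-- conflict.
open Classical in
theorem gatherWeight_round_le (I : Invariant N B) (hc : 1 ≤ N.compression) (hβ : 1 ≤ β)
    (y : Fin 8 → V → Fin N.slots) {v : V} (h : (B v).upBatch.isSome) :
    N.gatherWeight β (N.round B y) v ≤ N.gatherWeight β B v *
      (1 / β + if NoConflict N.graph (y 0) v (N.tree.parent v) then 0 else 1) := by
  have hβ0 : (0 : ℝ) < β := by linarith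
  have hA := (I.upBatch_isSome_iff.1 h).1
  have hcnt := I.count_lt hc hA.2.2
  have hW : N.gatherWeight β B v = β ^ (N.tree.depth v + (N.numItems - (B v).count)) := if_pos hA
  have hW0 := gatherWeight_nonneg (N := N) (B := B) hβ0.le v
  by_cases hA' : N.Awaited (N.round B y) v
  · have hW' : N.gatherWeight β (N.round B y) v =
      β ^ (N.tree.depth v + (N.numItems - (N.round B y v).count)) := if_pos hA'
    rcases Invariant.acked_or_not B y v with ⟨hb, hu, hm⟩ | hn
    · rw [hW', (I.round_of_acked hu hm).2.1, hW]
      have : N.tree.depth v + (N.numItems - (B v).count) =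
          N.tree.depth v + (N.numItems - ((B v).count + 1)) + 1 := by omega
      rw [this, pow_succ, mul_add, mul_assoc, mul_one_div_cancel hβ0.ne', mul_one]
      refine le_add_of_nonneg_right (mul_nonneg (by positivity) ?_)
      split_ifs <;> norm_num
    · have hconf : ¬ NoConflict N.graph (y 0) v (N.tree.parent v) := by
        intro hnc
        obtain ⟨hb, hu⟩ := Option.isSome_iff_exists.1 h
        refine hn hb hu (mem_packets_of_noConflict ?_ (isChild_parent hA.1).adj hnc)
        rw [Invariant.packet_zero, hu]; rfl
      rw [hW', (I.round_of_not_acked hn).2.1, ← hW, if_neg hconf]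
      have : 0 ≤ 1 / β := by positivity
      nlinarith
  · rw [gatherWeight, if_neg hA']
    refine mul_nonneg hW0 (add_nonneg (by positivity) ?_)
    split_ifs <;> norm_num

theorem gatherWeight_round_eq (I : Invariant N B) (y : Fin 8 → V → Fin N.slots) {v : V}
    (h : (B v).upBatch = none) : N.gatherWeight β (N.round B y) v = N.gatherWeight β B v := by
  obtain ⟨-, h1, h2⟩ := I.round_of_not_acked (w := v) (y := y) (by simp [h])
  unfold gatherWeight Awaited
  rw [h1, h2]

/-- The potential of the gathering decreases in the mean. -/
theorem avg_gatherPotential_le [Nonempty (Fin N.slots)] (I : Invariant N B)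
    (hc : 1 ≤ N.compression) (hβ : 1 ≤ β)
    {ε : ℝ} (hε0 : 0 ≤ ε) (hε : ∀ v w, N.graph.Adj w v →
      prob (fun x : V → Fin N.slots => ¬ NoConflict N.graph x v w) ≤ ε) :
    avg (fun y => N.gatherPotential β (N.round B y)) ≤ (ε + 2 / β) * N.gatherPotential β B := by
  classical
  have hβ0 : (0 : ℝ) < β := by linarith
  set A := Finset.univ.filter fun v => (B v).upBatch.isSome with hA
  set A' := Finset.univ.filter fun v => ¬ (B v).upBatch.isSome with hA'
  have hsplit : ∀ f : V → ℝ, ∑ v, f v = ∑ v ∈ A, f v + ∑ v ∈ A', f v := fun f =>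
    (Finset.sum_filter_add_sum_filter_not _ _ _).symm
  -- A waiting node has an awaited child that is one level deeper and has not sent more, so the
  -- weight of this child is at least `β` times as large.
  have hstuck : ∑ v ∈ A', N.gatherWeight β B v ≤ 1 / β * N.gatherPotential β B := by
    have h0 : ∑ v ∈ A', N.gatherWeight β B v =
        ∑ v ∈ A'.filter fun v => N.Awaited B v, N.gatherWeight β B v := by
      refine (Finset.sum_filter_of_ne fun v _ hne => ?_).symm
      by_contra h
      exact hne (if_neg h)
    rw [h0, gatherPotential, Finset.mul_sum]
    refine sum_le_sum_of_child (N := N) (fun v => mul_nonneg (by positivity)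
      (gatherWeight_nonneg hβ0.le v)) fun v hv => ?_
    simp only [hA', Finset.mem_filter, Finset.mem_univ, true_and] at hv
    obtain ⟨w, hw, hwA, hle⟩ := I.exists_child_of_upBatch_eq_none hv.2 (by simpa using hv.1)
    refine ⟨w, hw, ?_⟩
    rw [gatherWeight, gatherWeight, if_pos hv.2, if_pos hwA, one_div,
      le_inv_mul_iff₀ hβ0, ← pow_succ']
    refine pow_le_pow_right₀ hβ ?_
    have h1 := N.tree.depth_parent w hw.1
    rw [hw.2] at h1
    omega
  have hgo : ∀ v ∈ A, avg (fun y : Fin 8 → V → Fin N.slots =>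
      N.gatherWeight β (N.round B y) v) ≤ (ε + 1 / β) * N.gatherWeight β B v := by
    intro v hv
    have hs : (B v).upBatch.isSome := by simpa [hA] using hv
    refine (avg_mono fun y => gatherWeight_round_le I hc hβ y hs).trans ?_
    rw [avg_mul_left, avg_add, avg_const, mul_comm]
    refine mul_le_mul_of_nonneg_right ?_ (gatherWeight_nonneg hβ0.le v)
    rw [add_comm]
    gcongr
    rw [avg_apply 0 fun x : V → Fin N.slots =>
      if NoConflict N.graph x v (N.tree.parent v) then (0 : ℝ) else 1]
    refine le_trans (le_of_eq ?_) (hε v (N.tree.parent v)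
      (isChild_parent (I.upBatch_isSome_iff.1 hs).1.1).adj)
    unfold prob
    congr 1
    ext x
    split_ifs <;> simp_all
  have e1 : avg (fun y => N.gatherPotential β (N.round B y)) =
      ∑ v, avg (fun y : Fin 8 → V → Fin N.slots => N.gatherWeight β (N.round B y) v) := by
    unfold gatherPotential
    rw [avg_sum]
  rw [e1, hsplit]
  have h2 : ∑ v ∈ A', avg (fun y : Fin 8 → V → Fin N.slots => N.gatherWeight β (N.round B y) v) =
      ∑ v ∈ A', N.gatherWeight β B v := by
    refine Finset.sum_congr rfl fun v hv => ?_
    have hs : (B v).upBatch = none := by simpa [hA'] using hv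
    simp only [gatherWeight_round_eq I _ hs]
    exact avg_const _
  have h1 : ∑ v ∈ A, avg (fun y : Fin 8 → V → Fin N.slots => N.gatherWeight β (N.round B y) v) ≤
      (ε + 1 / β) * ∑ v ∈ A, N.gatherWeight β B v := by
    rw [Finset.mul_sum]
    exact Finset.sum_le_sum hgo
  have h3 : ∑ v ∈ A, N.gatherWeight β B v ≤ N.gatherPotential β B :=
    Finset.sum_le_univ_sum_of_nonneg fun v => gatherWeight_nonneg hβ0.le v
  have h4 : (ε + 1 / β) * ∑ v ∈ A, N.gatherWeight β B v ≤
      (ε + 1 / β) * N.gatherPotential β B :=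
    mul_le_mul_of_nonneg_left h3 (by positivity)
  have h5 : (ε + 2 / β) * N.gatherPotential β B = (ε + 1 / β) * N.gatherPotential β B +
      1 / β * N.gatherPotential β B := by ring
  linarith

end Network

theorem prob_apply {ι X : Type} [Fintype ι] [DecidableEq ι] [Fintype X] [Nonempty X]
    (i : ι) (E : X → Prop) : prob (fun y : ι → X => E (y i)) = prob E := by
  classical
  unfold prob
  exact avg_apply i fun x : X => if E x then (1 : ℝ) else 0

namespace Network

variable {V : Type} [Fintype V] [DecidableEq V] {N : Network V}

/-! ### Spreading: the confirmed items -/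

namespace Invariant

variable {B : V → Memory} {y : Fin 8 → V → Fin N.slots} {v w : V}

theorem avail_le_numItems (I : Invariant N B) (v : V) : (B v).avail ≤ N.numItems := by
  have h : ∀ n v, N.tree.depth v = n → (B v).avail ≤ N.numItems := by
    intro n
    induction n with
    | zero =>
      intro v hv
      have hr : v = N.tree.root := by
        by_contra hr
        have := N.tree.depth_parent v hr
        omega
      subst hr
      rw [I.avail_root]
      split_ifs <;> simp
    | succ n ih =>
      intro v hv
      have hr : v ≠ N.tree.root := by
        rintro rfl
        rw [N.tree.depth_root] at hv
        omega
      refine (I.avail_le_parent v _ (isChild_parent hr)).trans (ih _ ?_)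
      have := N.tree.depth_parent v hr
      omega
  exact h _ v rfl

theorem exists_awaited (I : Invariant N B) (h : (B N.tree.root).avail < N.numItems) :
    ∃ v, N.Awaited B v := by
  by_contra! hn
  rw [I.avail_root, if_pos (I.pool_root_of_not_awaited hn)] at h
  exact lt_irrefl _ h

end Invariant

/-- Inner nodes of the arborescence. -/
def IsInner (N : Network V) (v : V) : Prop := ∃ w, N.IsChild w v

theorem IsInner.mem {v : V} (h : N.IsInner v) : v ∈ N.backbone := h.choose_spec.mem

theorem inner_parent {v : V} (h : v ≠ N.tree.root) : N.IsInner (N.tree.parent v) :=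
  ⟨v, isChild_parent h⟩

open Classical in
/-- The weight of a node with unconfirmed items. -/
noncomputable def certWeight (N : Network V) (β : ℝ) (H : ℕ) (B : V → Memory) (v : V) : ℝ :=
  if N.IsInner v ∧ (B v).certified < N.numItems then
    β ^ ((H - N.tree.depth v) + (N.numItems - (B v).certified)) else 0

variable {β : ℝ} {B : V → Memory} {H : ℕ}

theorem certWeight_nonneg (hβ : 0 ≤ β) (v : V) : 0 ≤ N.certWeight β H B v := by
  unfold certWeight; split_ifs <;> positivity

-- A confirmation lowers the exponent by one, or removes the weight if it was the last; it is missed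
-- only if some neighbour suffers a conflict in the last frame.
open Classical in
theorem certWeight_round_le (I : Invariant N B) (hβ : 1 ≤ β)
    (y : Fin 8 → V → Fin N.slots) {v : V} (h : (B v).certified < (B v).avail) :
    N.certWeight β H (N.round B y) v ≤ N.certWeight β H B v *
      (1 / β + if AllClear N.graph (y 7) v then 0 else 1) := by
  have hβ0 : (0 : ℝ) < β := by linarith
  have hW0 := certWeight_nonneg (N := N) (B := B) (H := H) hβ0.le v
  have hpos : 0 ≤ (1 / β + if AllClear N.graph (y 7) v then 0 else (1 : ℝ)) := by
    split_ifs <;> positivity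
  by_cases hin : N.IsInner v
  swap
  · have : ∀ B, N.certWeight β H B v = 0 := fun B => if_neg fun h => hin h.1
    simp [this]
  have ha : (B v).Active := I.active_iff.2 ⟨hin, h⟩
  have hL := I.avail_le_numItems v
  have hW : N.certWeight β H B v =
      β ^ ((H - N.tree.depth v) + (N.numItems - (B v).certified)) := if_pos ⟨hin, by omega⟩
  by_cases hlt : (N.round B y v).certified < N.numItems
  swap
  · have : N.certWeight β H (N.round B y) v = 0 := if_neg fun h => hlt h.2
    rw [this]
    exact mul_nonneg hW0 hpos
  have hW' : N.certWeight β H (N.round B y) v =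
      β ^ ((H - N.tree.depth v) + (N.numItems - (N.round B y v).certified)) := if_pos ⟨hin, hlt⟩
  rcases Invariant.certified_round (B := B) (y := y) (v := v) with ⟨h1, -⟩ | ⟨h1, h2⟩
  · rw [hW', h1, hW]
    rw [h1] at hlt
    have : (H - N.tree.depth v) + (N.numItems - (B v).certified) =
        (H - N.tree.depth v) + (N.numItems - ((B v).certified + 1)) + 1 := by omega
    rw [this, pow_succ, mul_add, mul_assoc, mul_one_div_cancel hβ0.ne', mul_one]
    refine le_add_of_nonneg_right (mul_nonneg (by positivity) ?_)
    split_ifs <;> norm_num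
  · have hconf : ¬ AllClear N.graph (y 7) v := by
      intro hac
      obtain ⟨p, hp⟩ : ∃ p, N.packet B 7 v = some p := ⟨_, I.packet_of_active (by norm_num) ha⟩
      exact h2 ⟨ha, (Invariant.quiet_seven_iff hp).2 fun w hw =>
        mem_packets_of_noConflict hp hw.symm (hac w hw)⟩
    rw [hW', h1, ← hW, if_neg hconf]
    have : 0 ≤ 1 / β := by positivity
    nlinarith

/-- Mean decrease of a sum of weights, when the nodes in `A` make progress and the others wait for
their parents. -/
theorem avg_sum_weight_le [DecidableRel N.graph.Adj] [Nonempty (Fin N.slots)] {δ : ℕ}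
    (hδ : ∀ v ∈ N.backbone, N.graph.degree v ≤ δ)
    {W : V → ℝ} {W' : V → (Fin 8 → V → Fin N.slots) → ℝ} (hW : ∀ v, 0 ≤ W v)
    (A : V → Prop) {a b c : ℝ} (ha : 0 ≤ a) (hb : 0 ≤ b) (hc : 0 ≤ c)
    (hA : ∀ v, A v → avg (W' v) ≤ a * W v)
    (hne : ∀ v, ¬ A v → v ≠ N.tree.root → ∀ y, W' v y ≤ b * W (N.tree.parent v))
    (hroot : ¬ A N.tree.root → ∀ y, W' N.tree.root y ≤ c) :
    avg (fun y => ∑ v, W' v y) ≤ (a + δ * b) * ∑ v, W v + c := by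
  classical
  rw [avg_sum]
  have hstep : ∀ v, avg (W' v) ≤ a * W v +
      ((if v ∈ Finset.univ.filter (fun v => ¬ A v ∧ v ≠ N.tree.root) then
        b * W (N.tree.parent v) else 0) + if v = N.tree.root then c else 0) := by
    intro v
    have h0 := mul_nonneg ha (hW v)
    have h1 : 0 ≤ b * W (N.tree.parent v) := mul_nonneg hb (hW _)
    by_cases hv : A v
    · have h2 : (0 : ℝ) ≤ if v = N.tree.root then c else 0 := by split_ifs <;> simp [hc]
      simp only [Finset.mem_filter, Finset.mem_univ, hv, not_true, false_and, and_false, if_false]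
      linarith [hA v hv]
    · by_cases hr : v = N.tree.root
      · subst hr
        have := avg_mono (hroot hv)
        rw [avg_const] at this
        simp only [Finset.mem_filter, ne_eq, not_true, and_false, if_false, if_true]
        linarith
      · have := avg_mono (hne v hv hr)
        rw [avg_const] at this
        simp only [Finset.mem_filter, Finset.mem_univ, ne_eq, hv, hr, not_false_eq_true,
          and_self, if_true, if_false]
        linarith
  refine (Finset.sum_le_sum fun v _ => hstep v).trans ?_
  rw [Finset.sum_add_distrib, Finset.sum_add_distrib, ← Finset.mul_sum, ← Finset.sum_filter,
    Finset.sum_ite_eq' Finset.univ N.tree.root, if_pos (Finset.mem_univ _)]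
  have h3 := sum_parent_le hδ (A := Finset.univ.filter (fun v => ¬ A v ∧ v ≠ N.tree.root))
    (f := fun v => b * W (N.tree.parent v)) (g := fun v => b * W v)
    (fun v hv => (Finset.mem_filter.1 hv).2.2) (fun v => mul_nonneg hb (hW v)) fun v _ => le_rfl
  rw [← Finset.mul_sum Finset.univ, ← mul_assoc] at h3
  have h4 : ∑ v ∈ Finset.univ.filter (fun v => v ∈ Finset.univ.filter
      (fun v => ¬ A v ∧ v ≠ N.tree.root)), b * W (N.tree.parent v) =
      ∑ v ∈ Finset.univ.filter (fun v => ¬ A v ∧ v ≠ N.tree.root), b * W (N.tree.parent v) := by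
    congr 1
    ext v; simp
  rw [h4, add_mul]
  linarith

/-- Mean decrease of the weight of the unconfirmed items. -/
theorem avg_certWeight_le [DecidableRel N.graph.Adj] [Nonempty (Fin N.slots)] {δ : ℕ}
    (hδ : ∀ v ∈ N.backbone, N.graph.degree v ≤ δ) (I : Invariant N B) (hβ : 1 ≤ β)
    (hH : ∀ v, N.tree.depth v ≤ H) {p : ℝ} (hp1 : p ≤ 1)
    (hp : ∀ v ∈ N.backbone, p ≤ prob (fun x : V → Fin N.slots => AllClear N.graph x v)) :
    avg (fun y => ∑ v, N.certWeight β H (N.round B y) v) ≤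
      (1 - p + 1 / β + δ * (1 / β)) * ∑ v, N.certWeight β H B v +
        β ^ (H + N.numItems) * N.gatherPotential β B := by
  classical
  have hβ0 : (0 : ℝ) < β := by linarith
  have hstuck : ∀ v, ¬ (B v).certified < (B v).avail → ∀ y,
      N.certWeight β H (N.round B y) v = N.certWeight β H B v := by
    intro v hv y
    have h1 : (N.round B y v).certified = (B v).certified := by
      rcases Invariant.certified_round (B := B) (y := y) (v := v) with ⟨-, h1, -⟩ | ⟨h1, -⟩
      · exact absurd h1.2 hv
      · exact h1
    unfold certWeight
    rw [h1]
  refine avg_sum_weight_le hδ (fun v => certWeight_nonneg hβ0.le v)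
    (fun v => (B v).certified < (B v).avail) (by
      have : 0 ≤ 1 / β := by positivity
      linarith) (by positivity)
    (mul_nonneg (by positivity) (gatherPotential_nonneg hβ0.le)) ?_ ?_ ?_
  · intro v hv
    refine (avg_mono fun y => certWeight_round_le I hβ y hv).trans ?_
    rw [avg_mul_left, avg_add, avg_const, mul_comm]
    by_cases hin : N.IsInner v
    · refine mul_le_mul_of_nonneg_right ?_ (certWeight_nonneg hβ0.le v)
      have h1 : avg (fun y : Fin 8 → V → Fin N.slots =>
          if AllClear N.graph (y 7) v then (0 : ℝ) else 1) =
          prob (fun x : V → Fin N.slots => ¬ AllClear N.graph x v) := by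
        rw [← prob_apply (7 : Fin 8) fun x : V → Fin N.slots => ¬ AllClear N.graph x v]
        unfold prob
        congr 1; ext y
        split_ifs <;> simp_all
      rw [h1, prob_not]
      linarith [hp v hin.mem]
    · have : N.certWeight β H B v = 0 := if_neg fun h => hin h.1
      simp [this]
  · intro v hv hr y
    rw [hstuck v hv y]
    by_cases h : N.IsInner v ∧ (B v).certified < N.numItems
    swap
    · have : N.certWeight β H B v = 0 := if_neg h
      rw [this]
      exact mul_nonneg (by positivity) (certWeight_nonneg hβ0.le _)
    -- A stuck node has all its items confirmed, and its parent has confirmed no more than these.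
    -- The parent is one level higher, so its weight is at least `β` times as large.
    have h1 := I.certified_le v _ (isChild_parent hr)
    rw [certWeight, certWeight, if_pos h, if_pos ⟨inner_parent hr, by omega⟩, one_div,
      le_inv_mul_iff₀ hβ0, ← pow_succ']
    refine pow_le_pow_right₀ hβ ?_
    have h2 := N.tree.depth_parent v hr
    have h3 := hH v
    omega
  · intro hv y
    rw [hstuck _ hv y]
    by_cases h : N.IsInner N.tree.root ∧ (B N.tree.root).certified < N.numItems
    swap
    · have : N.certWeight β H B N.tree.root = 0 := if_neg h
      rw [this]
      exact mul_nonneg (by positivity) (gatherPotential_nonneg hβ0.le)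
    -- The root can be stuck only while the gathering is unfinished; then the potential of the
    -- gathering is at least one and pays for it.
    obtain ⟨u, hu⟩ := I.exists_awaited (by omega)
    rw [certWeight, if_pos h]
    have h1 := one_le_gatherPotential hβ hu
    calc β ^ ((H - N.tree.depth N.tree.root) + (N.numItems - (B N.tree.root).certified)) ≤
        β ^ (H + N.numItems) := pow_le_pow_right₀ hβ (by omega)
      _ ≤ _ := le_mul_of_one_le_right (by positivity) h1

/-! ### Spreading: the items held by the children -/

open Classical in
/-- The number of items that some child of `v` does not hold. -/
noncomputable def missing (N : Network V) (B : V → Memory) (v : V) : ℕ :=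
  (Finset.univ.filter fun w => N.IsChild w v).sup fun w => N.numItems - (B w).avail

theorem le_missing {v w : V} (h : N.IsChild w v) :
    N.numItems - (B w).avail ≤ N.missing B v := by
  classical
  exact Finset.le_sup (f := fun w => N.numItems - (B w).avail) (by simpa using h)

theorem exists_missing {v : V} (h : 0 < N.missing B v) :
    ∃ w, N.IsChild w v ∧ N.numItems - (B w).avail = N.missing B v := by
  classical
  unfold missing at h ⊢
  have hne : (Finset.univ.filter fun w => N.IsChild w v).Nonempty := by
    by_contra hne
    rw [Finset.not_nonempty_iff_eq_empty] at hne
    rw [hne] at h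
    simp at h
  obtain ⟨w, hw, he⟩ := Finset.exists_mem_eq_sup _ hne fun w => N.numItems - (B w).avail
  exact ⟨w, by simpa using hw, he.symm⟩

theorem missing_le {v : V} {n : ℕ} (h : ∀ w, N.IsChild w v → N.numItems - (B w).avail ≤ n) :
    N.missing B v ≤ n := by
  classical
  exact Finset.sup_le fun w hw => h w (by simpa using hw)

/-- The distance of the pointer of `v` from the first item that some child does not hold. -/
noncomputable def offset (N : Network V) (B : V → Memory) (v : V) : ℕ :=
  -- One of the two truncated differences vanishes, so the sum is the absolute difference.
  ((B v).pointer - (N.numItems - N.missing B v)) + ((N.numItems - N.missing B v) - (B v).pointer)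

/-- The child `w` of `v` can get none of the packets for streaming. -/
def Unlucky (N : Network V) (y : Fin 8 → V → Fin N.slots) (v w : V) : Prop :=
  ∀ i ∈ ({1, 2, 3, 4, 5, 6} : Finset (Fin 8)), ¬ NoConflict N.graph (y i) v w

/-- The draws of the six streaming frames are independent. -/
theorem prob_unlucky_le [Nonempty (Fin N.slots)] {v w : V} {ε : ℝ}
    (h : prob (fun x : V → Fin N.slots => ¬ NoConflict N.graph x v w) ≤ ε) :
    prob (fun y => N.Unlucky y v w) ≤ ε ^ 6 := by
  unfold Unlucky
  rw [prob_forall_in _ fun x : V → Fin N.slots => ¬ NoConflict N.graph x v w]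
  exact pow_le_pow_left₀ (prob_nonneg _) h 6

namespace Invariant

variable {y : Fin 8 → V → Fin N.slots}

/-- A lucky child that lacks the streamed item gets it or makes the parent move back. -/
theorem of_not_unlucky {v w : V} (I : Invariant N B) (hw : N.IsChild w v) (ha : (B v).Active)
    (h : ¬ N.Unlucky y v w) :
    ((B v).pointer = (B w).avail → (B v).pointer < (N.round B y w).avail) ∧
      ((B w).avail < (B v).pointer → (B v).Nack fun i => N.frameRecord B i (y i) v) := by
  unfold Unlucky at h
  push Not at h
  obtain ⟨i, hi, hc⟩ := h
  have h0 : i ≠ 0 := by rintro rfl; simp at hi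
  have h7 : i ≠ 7 := by rintro rfl; simp at hi
  have h0' : (i : ℕ) ≠ 0 := fun h => h0 (Fin.ext h)
  have h7' : (i : ℕ) ≠ 7 := fun h => h7 (Fin.ext h)
  obtain ⟨p, hp⟩ : ∃ p, N.packet B i v = some p := ⟨_, I.packet_of_active h0' ha⟩
  have hh := (I.packet_spread h0' hp).2.1
  rw [if_neg h7'] at hh
  have hm := mem_packets_of_noConflict hp hw.adj.symm hc
  constructor
  · intro he
    rw [← hh]
    exact I.avail_lt_round hw h0 hp hm (by rw [hh, he])
  · intro hlt
    exact I.nack_iff.2 ⟨ha, i, h0, h7, w, hw, hlt, p, hp, hm⟩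

theorem missing_round_le {v : V} (I : Invariant N B) :
    N.missing (N.round B y) v ≤ N.missing B v :=
  missing_le fun _ hw => (Nat.sub_le_sub_left I.avail_le_round _).trans (le_missing hw)

end Invariant

open Classical in
/-- The weight of a node with items that some child does not hold. -/
noncomputable def streamWeight (N : Network V) (β κ : ℝ) (H : ℕ) (B : V → Memory) (v : V) : ℝ :=
  if N.missing B v = 0 then 0 else
    β ^ ((H - N.tree.depth v) + N.missing B v) * κ ^ N.offset B v

variable {κ : ℝ}

theorem streamWeight_nonneg (hβ : 0 ≤ β) (hκ : 0 ≤ κ) (v : V) :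
    0 ≤ N.streamWeight β κ H B v := by
  unfold streamWeight; split_ifs <;> positivity

end Network

namespace Network

variable {V : Type} [Fintype V] [DecidableEq V] {N : Network V}

variable {β κ : ℝ} {B : V → Memory} {H : ℕ}

theorem missing_le_numItems (v : V) : N.missing B v ≤ N.numItems :=
  missing_le fun _ _ => Nat.sub_le _ _

/-- The effect of a change of the numbers of missing items and of the offset on the weight. -/
theorem streamWeight_le {B' : V → Memory} (hβ : 1 ≤ β) (hκ : 1 ≤ κ) {v : V} {i j : ℕ}
    (h0 : N.missing B v ≠ 0)
    (he : N.missing B' v + i ≤ N.missing B v) (ho : N.offset B' v ≤ N.offset B v + j) :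
    N.streamWeight β κ H B' v ≤ N.streamWeight β κ H B v * (κ ^ j / β ^ i) := by
  have hβ0 : (0 : ℝ) < β := by linarith
  have hκ0 : (0 : ℝ) < κ := by linarith
  have hW0 := streamWeight_nonneg (N := N) (B := B) (H := H) hβ0.le hκ0.le v
  by_cases h1 : N.missing B' v = 0
  · rw [streamWeight, if_pos h1]
    exact mul_nonneg hW0 (by positivity)
  rw [streamWeight, streamWeight, if_neg h1, if_neg h0, ← mul_div_assoc, le_div_iff₀ (by positivity)]
  calc β ^ (H - N.tree.depth v + N.missing B' v) * κ ^ N.offset B' v * β ^ i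
      = β ^ (H - N.tree.depth v + N.missing B' v + i) * κ ^ N.offset B' v := by
        rw [pow_add _ _ i]; ring
    _ ≤ β ^ (H - N.tree.depth v + N.missing B v) * κ ^ (N.offset B v + j) := by
        refine mul_le_mul (pow_le_pow_right₀ hβ (by omega)) (pow_le_pow_right₀ hκ ho)
          (by positivity) (by positivity)
    _ = _ := by rw [pow_add κ]; ring

theorem streamWeight_le_of_succ {B' : V → Memory} (hβ : 1 ≤ β) (hκ : 1 ≤ κ) {v : V}
    (h0 : N.missing B v ≠ 0)
    (he : N.missing B' v ≤ N.missing B v) (ho : N.offset B' v + 1 ≤ N.offset B v) :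
    N.streamWeight β κ H B' v ≤ N.streamWeight β κ H B v * (1 / κ) := by
  have hβ0 : (0 : ℝ) < β := by linarith
  have hκ0 : (0 : ℝ) < κ := by linarith
  have hW0 := streamWeight_nonneg (N := N) (B := B) (H := H) hβ0.le hκ0.le v
  by_cases h1 : N.missing B' v = 0
  · rw [streamWeight, if_pos h1]
    exact mul_nonneg hW0 (by positivity)
  rw [streamWeight, streamWeight, if_neg h1, if_neg h0, ← mul_div_assoc, mul_one,
    le_div_iff₀ hκ0]
  calc β ^ (H - N.tree.depth v + N.missing B' v) * κ ^ N.offset B' v * κ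
      = β ^ (H - N.tree.depth v + N.missing B' v) * κ ^ (N.offset B' v + 1) := by
        rw [pow_succ]; ring
    _ ≤ _ := mul_le_mul (pow_le_pow_right₀ hβ (by omega)) (pow_le_pow_right₀ hκ ho)
          (by positivity) (by positivity)

namespace Invariant

variable {y : Fin 8 → V → Fin N.slots} {v : V}

theorem missing_le_round (I : Invariant N B) : N.missing B v ≤ N.missing (N.round B y) v + 1 := by
  by_cases h : N.missing B v = 0
  · omega
  obtain ⟨w, hw, he⟩ := exists_missing (Nat.pos_of_ne_zero h)
  have h1 := le_missing (B := N.round B y) hw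
  have h2 := I.avail_round_le hw.1 (y := y)
  omega

theorem first_missing_le_avail (I : Invariant N B) {w : V} (hw : N.IsChild w v) :
    N.numItems - N.missing B v ≤ (B w).avail := by
  have := le_missing (B := B) hw
  have := I.avail_le_numItems w
  omega

theorem exists_avail_eq (I : Invariant N B) (h : N.missing B v ≠ 0) :
    ∃ w, N.IsChild w v ∧ (B w).avail = N.numItems - N.missing B v := by
  obtain ⟨w, hw, he⟩ := exists_missing (Nat.pos_of_ne_zero h)
  have := I.avail_le_numItems w
  exact ⟨w, hw, by omega⟩

theorem first_missing_le_pointer (I : Invariant N B) (h : N.missing B v ≠ 0) :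
    N.numItems - N.missing B v ≤ (B v).pointer + 1 := by
  obtain ⟨w, hw, -⟩ := I.exists_avail_eq h
  obtain ⟨u, hu, he⟩ := I.exists_avail_le v ⟨w, hw⟩
  exact (I.first_missing_le_avail hu).trans he

theorem pointer_round_bounds (I : Invariant N B) :
    (N.round B y v).pointer ≤ (B v).pointer + 1 ∧ (B v).pointer ≤ (N.round B y v).pointer + 1 := by
  have h1 := I.pointer_le v
  have h2 := I.avail_le_round (v := v) (y := y)
  rcases Invariant.pointer_round (B := B) (y := y) (v := v) with ⟨-, -, h⟩ | ⟨-, -, h⟩ | ⟨-, h⟩ <;>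
    omega

open Classical in
/-- The weight of a node whose next missing item is at hand. -/
theorem streamWeight_round_le (I : Invariant N B) (hκ : 1 ≤ κ) (hκβ : κ ≤ β)
    (y : Fin 8 → V → Fin N.slots) (h0 : N.missing B v ≠ 0)
    (h : N.numItems - N.missing B v < (B v).avail) :
    N.streamWeight β κ H (N.round B y) v ≤ N.streamWeight β κ H B v *
      (1 / κ + κ / β + κ * ∑ w ∈ Finset.univ.filter (fun w => N.IsChild w v),
        if N.Unlucky y v w then (1 : ℝ) else 0) := by
  have hβ : 1 ≤ β := hκ.trans hκβ
  have hβ0 : (0 : ℝ) < β := by linarith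
  have hκ0 : (0 : ℝ) < κ := by linarith
  have hW0 := streamWeight_nonneg (N := N) (B := B) (H := H) hβ0.le hκ0.le v
  set s := ∑ w ∈ Finset.univ.filter (fun w => N.IsChild w v),
    if N.Unlucky y v w then (1 : ℝ) else 0 with hs
  have hs0 : 0 ≤ s := Finset.sum_nonneg fun w _ => by split_ifs <;> norm_num
  have hκs : 0 ≤ κ * s := mul_nonneg hκ0.le hs0
  have hκβ0 : 0 ≤ κ / β := by positivity
  have hκ1 : 0 ≤ 1 / κ := by positivity
  obtain ⟨w, hw, hwe⟩ := I.exists_avail_eq h0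
  have hact : (B v).Active := I.active_iff.2
    ⟨⟨w, hw⟩, ((I.certified_le w v hw).trans_eq hwe).trans_lt h⟩
  have hm1 := I.missing_le_round (v := v) (y := y)
  have hm2 := I.missing_round_le (v := v) (y := y)
  have hg1 := I.first_missing_le_pointer h0
  have hP := I.pointer_le v
  have hav := I.avail_le_round (v := v) (y := y)
  have hmL := missing_le_numItems (N := N) (B := B) v
  obtain ⟨hp1, hp2⟩ := I.pointer_round_bounds (v := v) (y := y)
  -- With an unlucky child the weight grows at most by the factor `κ`, which is paid by the sum of
  -- indicators since this sum is at least one.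
  by_cases hun : ∃ w, N.IsChild w v ∧ N.Unlucky y v w
  · obtain ⟨u, hu, hun⟩ := hun
    have hs1 : 1 ≤ s := by
      rw [hs]
      refine le_trans ?_ (Finset.single_le_sum
        (f := fun w => if N.Unlucky y v w then (1 : ℝ) else 0)
        (fun w _ => by split_ifs <;> norm_num) (Finset.mem_filter.2 ⟨Finset.mem_univ u, hu⟩))
      simp [hun]
    have hk : N.streamWeight β κ H (N.round B y) v ≤ N.streamWeight β κ H B v * κ := by
      rcases hm2.eq_or_lt with he | he
      · refine (streamWeight_le (i := 0) (j := 1) hβ hκ h0 (by omega) ?_).trans_eq (by simp)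
        unfold offset
        rw [he]
        omega
      -- The first missing item and the pointer may move apart, which costs κ²/β, and this is at
      -- most `κ`.
      · refine (streamWeight_le (i := 1) (j := 2) hβ hκ h0 (by omega) ?_).trans ?_
        · unfold offset
          omega
        · refine mul_le_mul_of_nonneg_left ?_ hW0
          rw [pow_one, div_le_iff₀ hβ0, sq]
          exact mul_le_mul_of_nonneg_left hκβ hκ0.le
    refine hk.trans (mul_le_mul_of_nonneg_left ?_ hW0)
    nlinarith
  push Not at hun
  have lucky := fun u hu => I.of_not_unlucky hu hact (hun u hu)
  have key : N.streamWeight β κ H (N.round B y) v ≤ N.streamWeight β κ H B v * (1 / κ) ∨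
      N.streamWeight β κ H (N.round B y) v ≤ N.streamWeight β κ H B v * (κ / β) := by
    -- All children are lucky. If the pointer is too far ahead, the slowest child makes it move
    -- back. If it is right, all children that lack the item get it. If it is behind, nobody
    -- complains and it moves forward. So the offset shrinks by one, or fewer items are missing.
    rcases lt_trichotomy (N.numItems - N.missing B v) (B v).pointer with hlt | heq | hgt
    · have hn := (lucky w hw).2 (by omega)
      have hp : (N.round B y v).pointer = (B v).pointer - 1 := by
        rcases Invariant.pointer_round (B := B) (y := y) (v := v) with
          ⟨-, -, h⟩ | ⟨h, -⟩ | ⟨h, -⟩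
        · exact h
        · exact absurd hn h
        · exact absurd hact h
      rcases hm2.eq_or_lt with he | he
      · refine Or.inl (streamWeight_le_of_succ hβ hκ h0 hm2 ?_)
        unfold offset
        rw [he]
        omega
      · refine Or.inr ((streamWeight_le (i := 1) (j := 1) hβ hκ h0 (by omega) ?_).trans_eq
          (by simp))
        unfold offset
        omega
    · have hp : (N.round B y v).pointer = min ((B v).pointer + 1) ((N.round B y v).avail - 1) := by
        rcases Invariant.pointer_round (B := B) (y := y) (v := v) with
          ⟨h, -⟩ | ⟨-, -, h⟩ | ⟨h, -⟩
        · obtain ⟨-, i, -, -, u, hu, hlt, -⟩ := I.nack_iff.1 h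
          have := I.first_missing_le_avail hu
          omega
        · exact h
        · exact absurd hact h
      have he : N.missing (N.round B y) v ≤ N.missing B v - 1 := by
        refine missing_le fun u hu => ?_
        have h1 := I.first_missing_le_avail hu
        have h2 := I.avail_le_round (v := u) (y := y)
        rcases h1.eq_or_lt with h3 | h3
        · have := (lucky u hu).1 (by omega)
          omega
        · omega
      refine Or.inr ((streamWeight_le (i := 1) (j := 1) hβ hκ h0 (by omega) ?_).trans_eq
        (by simp))
      unfold offset
      omega
    · have hp : (N.round B y v).pointer = min ((B v).pointer + 1) ((N.round B y v).avail - 1) := by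
        rcases Invariant.pointer_round (B := B) (y := y) (v := v) with
          ⟨h, -⟩ | ⟨-, -, h⟩ | ⟨h, -⟩
        · obtain ⟨-, i, -, -, u, hu, hlt, -⟩ := I.nack_iff.1 h
          have := I.first_missing_le_avail hu
          omega
        · exact h
        · exact absurd hact h
      rcases hm2.eq_or_lt with he | he
      · refine Or.inl (streamWeight_le_of_succ hβ hκ h0 hm2 ?_)
        unfold offset
        rw [he]
        omega
      · refine Or.inr ((streamWeight_le (i := 1) (j := 1) hβ hκ h0 (by omega) ?_).trans_eq
          (by simp))
        unfold offset
        omega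
  rcases key with h | h <;> refine h.trans (mul_le_mul_of_nonneg_left ?_ hW0) <;> linarith

/-- The weight of a node that has to wait for its parent. -/
theorem streamWeight_round_le_of_stuck (I : Invariant N B) (hκ : 1 ≤ κ) (hβ : 1 ≤ β)
    (y : Fin 8 → V → Fin N.slots) (h0 : N.missing B v ≠ 0)
    (h : (B v).avail ≤ N.numItems - N.missing B v) :
    N.streamWeight β κ H (N.round B y) v ≤
      β ^ ((H - N.tree.depth v) + N.missing B v) * κ := by
  have hκ0 : (0 : ℝ) < κ := by linarith
  have hP := I.pointer_le v
  have hm2 := I.missing_round_le (v := v) (y := y)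
  have hmL := missing_le_numItems (N := N) (B := B) v
  obtain ⟨hp1, hp2⟩ := I.pointer_round_bounds (v := v) (y := y)
  obtain ⟨w, hw, hwe⟩ := I.exists_avail_eq h0
  have hm : N.missing (N.round B y) v = N.missing B v := by
    have h1 := I.avail_round_le_parent hw (y := y)
    have h2 := le_missing (B := N.round B y) hw
    omega
  have hg := (I.round (y := y)).first_missing_le_pointer (v := v) (by rwa [hm])
  rw [streamWeight, if_neg (by omega), hm]
  -- The items of `v` end before the first missing one, so the pointer cannot have run ahead by more
  -- than one; the invariant bounds how far it is behind. Hence the offset is at most one.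
  refine mul_le_mul_of_nonneg_left ?_ (by positivity)
  refine (pow_le_pow_right₀ hκ (?_ : _ ≤ 1)).trans_eq (pow_one κ)
  unfold offset
  rw [hm] at hg ⊢
  omega

end Invariant

/-- Mean decrease of the weight of the items that some children lack. -/
theorem avg_streamWeight_le [DecidableRel N.graph.Adj] [Nonempty (Fin N.slots)] {δ : ℕ}
    (hδ : ∀ v ∈ N.backbone, N.graph.degree v ≤ δ) (I : Invariant N B) (hκ : 1 ≤ κ) (hκβ : κ ≤ β)
    (hH : ∀ v, N.tree.depth v ≤ H) {ε : ℝ} (hε : ∀ v w, N.graph.Adj w v →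
      prob (fun x : V → Fin N.slots => ¬ NoConflict N.graph x v w) ≤ ε) :
    avg (fun y => ∑ v, N.streamWeight β κ H (N.round B y) v) ≤
      (1 / κ + κ / β + κ * (δ * ε ^ 6) + δ * (κ / β)) * ∑ v, N.streamWeight β κ H B v +
        κ * β ^ (H + N.numItems) * N.gatherPotential β B := by
  classical
  have hβ : 1 ≤ β := hκ.trans hκβ
  have hβ0 : (0 : ℝ) < β := by linarith
  have hκ0 : (0 : ℝ) < κ := by linarith
  have hzero : ∀ v, N.missing B v = 0 → ∀ y, N.streamWeight β κ H (N.round B y) v = 0 := by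
    intro v hv y
    have := I.missing_round_le (v := v) (y := y)
    exact if_pos (by omega)
  refine avg_sum_weight_le hδ (fun v => streamWeight_nonneg hβ0.le hκ0.le v)
    (fun v => N.missing B v ≠ 0 ∧ N.numItems - N.missing B v < (B v).avail) (by positivity)
    (by positivity) (mul_nonneg (by positivity) (gatherPotential_nonneg hβ0.le)) ?_ ?_ ?_
  · intro v hv
    refine (avg_mono fun y => I.streamWeight_round_le hκ hκβ y hv.1 hv.2).trans ?_
    rw [avg_mul_left, avg_add, avg_const, avg_mul_left, avg_sum, mul_comm]
    refine mul_le_mul_of_nonneg_right ?_ (streamWeight_nonneg hβ0.le hκ0.le v)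
    refine add_le_add_right (mul_le_mul_of_nonneg_left ?_ hκ0.le) _
    have h1 : ∀ w ∈ Finset.univ.filter (fun w => N.IsChild w v),
        avg (fun y : Fin 8 → V → Fin N.slots => if N.Unlucky y v w then (1 : ℝ) else 0) ≤
          ε ^ 6 := by
      intro w hw
      refine le_trans (le_of_eq ?_) (prob_unlucky_le (hε v w (Finset.mem_filter.1 hw).2.adj.symm))
      unfold prob
      rfl
    refine (Finset.sum_le_card_nsmul _ _ _ h1).trans ?_
    rw [nsmul_eq_mul]
    exact mul_le_mul_of_nonneg_right (by exact_mod_cast card_children_le hδ v) (by positivity)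
  · intro v hv hr y
    have hWp : 0 ≤ N.streamWeight β κ H B (N.tree.parent v) :=
      streamWeight_nonneg hβ0.le hκ0.le _
    by_cases h0 : N.missing B v = 0
    · rw [hzero v h0 y]
      exact mul_nonneg (by positivity) hWp
    have h : (B v).avail ≤ N.numItems - N.missing B v := by
      by_contra h
      exact hv ⟨h0, by omega⟩
    -- The parent of a stuck node sees at least as many items missing and is one level higher, so it
    -- outweighs the node by `β`, up to the factor `κ` for the offset.
    have h1 := le_missing (B := B) (isChild_parent hr)
    have h2 := missing_le_numItems (N := N) (B := B) v
    refine (I.streamWeight_round_le_of_stuck hκ hβ y h0 h).trans ?_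
    have h3 := N.tree.depth_parent v hr
    have h4 := hH v
    rw [streamWeight, if_neg (by omega), div_mul_eq_mul_div, le_div_iff₀ hβ0]
    calc β ^ (H - N.tree.depth v + N.missing B v) * κ * β
        = κ * (β ^ (H - N.tree.depth v + N.missing B v + 1) * 1) := by rw [pow_succ]; ring
      _ ≤ _ := by
        refine mul_le_mul_of_nonneg_left (mul_le_mul (pow_le_pow_right₀ hβ (by omega))
          (one_le_pow₀ hκ) zero_le_one (by positivity)) hκ0.le
  · intro hv y
    by_cases h0 : N.missing B N.tree.root = 0
    · rw [hzero _ h0 y]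
      exact mul_nonneg (by positivity) (gatherPotential_nonneg hβ0.le)
    have h : (B N.tree.root).avail ≤ N.numItems - N.missing B N.tree.root := by
      by_contra h
      exact hv ⟨h0, by omega⟩
    have h2 := missing_le_numItems (N := N) (B := B) N.tree.root
    obtain ⟨u, hu⟩ := I.exists_awaited (by omega)
    refine (I.streamWeight_round_le_of_stuck hκ hβ y h0 h).trans ?_
    calc β ^ (H - N.tree.depth N.tree.root + N.missing B N.tree.root) * κ
        ≤ β ^ (H + N.numItems) * κ :=
          mul_le_mul_of_nonneg_right (pow_le_pow_right₀ hβ (by omega)) hκ0.le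
      _ = κ * β ^ (H + N.numItems) := mul_comm _ _
      _ ≤ _ := le_mul_of_one_le_right (by positivity) (one_le_gatherPotential hβ hu)

end Network

namespace Network

variable {V : Type} [Fintype V] [DecidableEq V] {N : Network V}

/-! ### The number of slots -/

/-- The mean of `Φ` bounds the probability of incompleteness. The first `M` rounds are charged in
full, and from then on the probabilities are dominated by a geometric series. -/
theorem lintegral_completionTime_le_of_potential [Nonempty (Fin N.slots)]
    (hc : 1 ≤ N.compression) {Ω : Type} [MeasurableSpace Ω] {Pr : Measure Ω}
    [IsProbabilityMeasure Pr] {X : ℕ → V → Ω → Fin N.slots} (hX : IsUniformDraw Pr X)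
    {Φ : (V → Memory) → ℝ} (hΦ : ∀ B, 0 ≤ Φ B)
    (h1 : ∀ B, Invariant N B → ¬ N.Complete B → 1 ≤ Φ B) {ρ : ℝ} (hρ0 : 0 ≤ ρ) (hρ1 : ρ < 1)
    (h : ∀ B, Invariant N B → avg (fun y => Φ (N.round B y)) ≤ ρ * Φ B) {M : ℕ}
    (hM : ρ ^ M * Φ N.initialMemory ≤ 1) :
    ∫⁻ ω, N.completionTime gossip (fun t v => X t v ω) ∂Pr ≤
      ENNReal.ofReal (16 * N.slots * (M + 1 / (1 - ρ))) := by
  classical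
  have hZ := hX.blocks
  set g : (V → Memory) → ℝ≥0∞ := fun B => if N.Complete B then 0 else 1 with hg
  set B : Ω → ℕ → V → Memory := fun ω n => N.memory (fun t v => X t v ω) n with hB
  have hmeas : ∀ n, Measurable fun ω => g (B ω n) := fun n =>
    hZ.measurable_orbit N.round N.initialMemory n fun a _ => g a
  have hle1 : ∀ n, ∫⁻ ω, g (B ω n) ∂Pr ≤ 1 := fun n => by
    refine (lintegral_mono (g := fun _ => 1) fun ω => ?_).trans (by simp)
    simp only [hg]
    split_ifs <;> simp
  have hle : ∀ n, ∫⁻ ω, g (B ω n) ∂Pr ≤ ENNReal.ofReal (ρ ^ n * Φ N.initialMemory) := fun n => by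
    refine le_trans (lintegral_mono fun ω => ?_)
      (hZ.lintegral_le_pow (I := Invariant N) invariant_initial (fun _ _ h => h.round) hΦ hρ0 h n)
    simp only [hg]
    split_ifs with hcomp
    · exact zero_le
    · rw [ENNReal.one_le_ofReal]
      exact h1 _ (invariant_memory (fun t v => X t v ω) n) hcomp
  have hsum : ∑' n, ∫⁻ ω, g (B ω n) ∂Pr ≤ ENNReal.ofReal (M + 1 / (1 - ρ)) := by
    set a : ℕ → ℝ≥0∞ := fun n => ∫⁻ ω, g (B ω n) ∂Pr with ha
    rw [← Summable.sum_add_tsum_nat_add' (f := a) (k := M) ENNReal.summable,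
      ENNReal.ofReal_add (by positivity) (by rw [one_div, inv_nonneg]; linarith)]
    refine add_le_add ?_ ?_
    · refine (Finset.sum_le_sum fun n _ => hle1 n).trans ?_
      simp
    · calc ∑' n, a (n + M) ≤ ∑' n : ℕ, ENNReal.ofReal (ρ ^ n) := by
            refine ENNReal.tsum_le_tsum fun n => (hle _).trans (ENNReal.ofReal_le_ofReal ?_)
            rw [pow_add, mul_assoc]
            exact mul_le_of_le_one_right (pow_nonneg hρ0 n) hM
        _ = _ := by
          rw [← ENNReal.ofReal_tsum_of_nonneg (fun n => pow_nonneg hρ0 n)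
            (summable_geometric_of_lt_one hρ0 hρ1), tsum_geometric_of_lt_one hρ0 hρ1, one_div]
  calc ∫⁻ ω, N.completionTime gossip (fun t v => X t v ω) ∂Pr
      ≤ ∫⁻ ω, ∑' n, ((16 * N.slots : ℕ) : ℝ≥0∞) * g (B ω n) ∂Pr := by
        refine lintegral_mono fun ω => (completionTime_gossip_le hc _).trans (le_of_eq ?_)
        refine tsum_congr fun n => ?_
        simp only [hg, hB]
        split_ifs <;> simp
    _ = ((16 * N.slots : ℕ) : ℝ≥0∞) * ∑' n, ∫⁻ ω, g (B ω n) ∂Pr := by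
        rw [lintegral_tsum fun n => ((hmeas n).const_mul _).aemeasurable, ← ENNReal.tsum_mul_left]
        exact tsum_congr fun n => lintegral_const_mul _ (hmeas n)
    _ ≤ ENNReal.ofReal (16 * N.slots) * ENNReal.ofReal (M + 1 / (1 - ρ)) := by
        refine mul_le_mul' (le_of_eq ?_) hsum
        rw [← ENNReal.ofReal_natCast]
        push_cast
        rfl
    _ = _ := (ENNReal.ofReal_mul (by positivity)).symm

/-! ### Lower bounds and initial values of the potentials -/

section Potentials

variable {β κ : ℝ} {B : V → Memory} {H : ℕ}

theorem one_le_of_not_complete (I : Invariant N B) (hβ : 1 ≤ β) (hB : ¬ N.Complete B) {R : ℝ}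
    (hR : 0 ≤ R) (h : ∀ w, w ≠ N.tree.root → (B w).avail < N.numItems → 1 ≤ R) (j : ℕ) :
    1 ≤ β ^ j * N.gatherPotential β B + R := by
  have h0 := gatherPotential_nonneg (N := N) (B := B) (by linarith : 0 ≤ β)
  have h1 : (1 : ℝ) ≤ β ^ j := one_le_pow₀ hβ
  unfold Complete at hB
  push Not at hB
  obtain ⟨w, hw⟩ := hB
  by_cases hr : w = N.tree.root
  · subst hr
    obtain ⟨u, hu⟩ := I.exists_awaited hw
    have := one_le_gatherPotential hβ hu
    nlinarith
  · have := h w hr hw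
    nlinarith

theorem one_le_sum_streamWeight (hβ : 1 ≤ β) (hκ : 1 ≤ κ) {w : V} (hr : w ≠ N.tree.root)
    (hw : (B w).avail < N.numItems) : 1 ≤ ∑ v, N.streamWeight β κ H B v := by
  refine le_trans ?_ (Finset.single_le_sum
    (fun v _ => streamWeight_nonneg (by linarith) (by linarith) v)
    (Finset.mem_univ (N.tree.parent w)))
  have := le_missing (B := B) (isChild_parent hr)
  rw [streamWeight, if_neg (by omega)]
  exact one_le_mul_of_one_le_of_one_le (one_le_pow₀ hβ) (one_le_pow₀ hκ)

theorem one_le_sum_certWeight (I : Invariant N B) (hβ : 1 ≤ β) {w : V} (hr : w ≠ N.tree.root)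
    (hw : (B w).avail < N.numItems) : 1 ≤ ∑ v, N.certWeight β H B v := by
  refine le_trans ?_ (Finset.single_le_sum (fun v _ => certWeight_nonneg (by linarith) v)
    (Finset.mem_univ (N.tree.parent w)))
  have := I.certified_le w _ (isChild_parent hr)
  rw [certWeight, if_pos ⟨inner_parent hr, by omega⟩]
  exact one_le_pow₀ hβ

variable [DecidableRel N.graph.Adj] {δ : ℕ}

/-- Writing β^depth = β^(2 depth) β^(-depth) lets `sum_inv_pow_depth_le` absorb the summation, so
the number of nodes does not enter. -/
theorem gatherPotential_initial_le (hδ : ∀ v ∈ N.backbone, N.graph.degree v ≤ δ)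
    (hH : ∀ v, N.tree.depth v ≤ H) (hβ : 1 ≤ β) (hβδ : 2 * δ ≤ β) :
    N.gatherPotential β N.initialMemory ≤ β ^ (2 * H + N.numItems) * 2 := by
  have hβ0 : (0 : ℝ) < β := by linarith
  refine le_trans ?_ (mul_le_mul_of_nonneg_left (sum_inv_pow_depth_le hδ hβδ hβ0)
    (by positivity))
  rw [Finset.mul_sum]
  refine Finset.sum_le_sum fun v _ => ?_
  have hv := hH v
  unfold gatherWeight
  split_ifs
  · rw [inv_pow, ← div_eq_mul_inv, le_div_iff₀ (by positivity), ← pow_add]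
    exact pow_le_pow_right₀ hβ (by omega)
  · positivity

theorem sum_le_of_le_pow (hδ : ∀ v ∈ N.backbone, N.graph.degree v ≤ δ)
    (hH : ∀ v, N.tree.depth v ≤ H) (hβ : 1 ≤ β) (hβδ : 2 * δ ≤ β) {W : V → ℝ} {j : ℕ}
    (hW : ∀ v, W v ≤ β ^ ((H - N.tree.depth v) + j)) : ∑ v, W v ≤ β ^ (H + j) * 2 := by
  have hβ0 : (0 : ℝ) < β := by linarith
  refine le_trans ?_ (mul_le_mul_of_nonneg_left (sum_inv_pow_depth_le hδ hβδ hβ0)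
    (by positivity))
  rw [Finset.mul_sum]
  refine Finset.sum_le_sum fun v _ => (hW v).trans ?_
  have hv := hH v
  rw [inv_pow, ← div_eq_mul_inv, le_div_iff₀ (by positivity), ← pow_add]
  exact pow_le_pow_right₀ hβ (by omega)

theorem sum_streamWeight_initial_le (hδ : ∀ v ∈ N.backbone, N.graph.degree v ≤ δ)
    (hH : ∀ v, N.tree.depth v ≤ H) (hκ : 1 ≤ κ) (hκβ : κ ≤ β) (hβδ : 2 * δ ≤ β) :
    ∑ v, N.streamWeight β κ H N.initialMemory v ≤ β ^ (H + 2 * N.numItems) * 2 := by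
  have hβ := hκ.trans hκβ
  refine sum_le_of_le_pow hδ hH hβ hβδ fun v => ?_
  have hm := missing_le_numItems (N := N) (B := N.initialMemory) v
  have ho : N.offset N.initialMemory v ≤ N.numItems := by
    have : (N.initialMemory v).pointer = 0 := rfl
    unfold offset
    omega
  unfold streamWeight
  split_ifs
  · positivity
  · calc β ^ (H - N.tree.depth v + N.missing N.initialMemory v) *
          κ ^ N.offset N.initialMemory v
        ≤ β ^ (H - N.tree.depth v + N.numItems) * β ^ N.numItems := by
          refine mul_le_mul (pow_le_pow_right₀ hβ (by omega)) ?_ (by positivity) (by positivity)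
          exact (pow_le_pow_left₀ (by linarith) hκβ _).trans (pow_le_pow_right₀ hβ ho)
      _ = _ := by rw [← pow_add]; congr 1; ring

theorem sum_certWeight_initial_le (hδ : ∀ v ∈ N.backbone, N.graph.degree v ≤ δ)
    (hH : ∀ v, N.tree.depth v ≤ H) (hβ : 1 ≤ β) (hβδ : 2 * δ ≤ β) :
    ∑ v, N.certWeight β H N.initialMemory v ≤ β ^ (H + 2 * N.numItems) * 2 := by
  refine sum_le_of_le_pow hδ hH hβ hβδ fun v => ?_
  unfold certWeight
  split_ifs
  · exact pow_le_pow_right₀ hβ (by omega)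
  · positivity

theorem initial_le_pow (hβ : 4 ≤ β) {L : ℕ} {g s : ℝ} (hg : g ≤ β ^ (2 * H + L) * 2)
    (hs : s ≤ β ^ (H + 2 * L) * 2) :
    β ^ (H + L + 1) * g + s ≤ β ^ (3 * H + 2 * L + 2) := by
  have hβ1 : 1 ≤ β := by linarith
  have h1 : β ^ (H + L + 1) * g ≤ β ^ (3 * H + 2 * L + 1) * 2 := by
    refine (mul_le_mul_of_nonneg_left hg (by positivity)).trans_eq ?_
    rw [← mul_assoc, ← pow_add]
    congr 2; ring
  have h2 : s ≤ β ^ (3 * H + 2 * L + 1) * 2 :=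
    hs.trans (mul_le_mul_of_nonneg_right (pow_le_pow_right₀ hβ1 (by omega)) zero_le_two)
  have h3 : (0 : ℝ) < β ^ (3 * H + 2 * L + 1) := by positivity
  rw [pow_succ _ (3 * H + 2 * L + 1)]
  nlinarith

end Potentials

variable [DecidableRel N.graph.Adj] {δ H : ℕ} {ε p : ℝ}

/-- Few conflicts: streaming takes a constant number of rounds for every item and every level. -/
theorem lintegral_completionTime_le_of_few_conflicts [Nonempty (Fin N.slots)]
    (hc : 1 ≤ N.compression) {Ω : Type} [MeasurableSpace Ω] {Pr : Measure Ω}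
    [IsProbabilityMeasure Pr] {X : ℕ → V → Ω → Fin N.slots} (hX : IsUniformDraw Pr X)
    (hδ : ∀ v ∈ N.backbone, N.graph.degree v ≤ δ) (hH : ∀ v, N.tree.depth v ≤ H)
    (hε0 : 0 ≤ ε) (hε : ∀ v w, N.graph.Adj w v →
      prob (fun x : V → Fin N.slots => ¬ NoConflict N.graph x v w) ≤ ε)
    (h16 : 16 ≤ δ) (hεδ : ε ^ 2 * δ ≤ 1) :
    ∫⁻ ω, N.completionTime gossip (fun t v => X t v ω) ∂Pr ≤
      ENNReal.ofReal (16 * N.slots * (36 * H + 24 * N.numItems + 26)) := by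
  have hd : (16 : ℝ) ≤ δ := by exact_mod_cast h16
  have hd0 : (0 : ℝ) < δ := by linarith
  -- With these powers of δ both log `β` and log(1/`ρ`) have order log δ, so no logarithm is lost.
  set κ : ℝ := (δ : ℝ) with hκ
  set β : ℝ := κ ^ 3 with hβ
  have hβ256 : 256 * κ ≤ β := by
    have : 256 ≤ κ ^ 2 := by nlinarith
    rw [hβ, pow_succ]
    exact mul_le_mul_of_nonneg_right this hd0.le
  have hκ1 : 1 ≤ κ := by linarith
  have hβ1 : 1 ≤ β := by linarith
  have hκβ : κ ≤ β := by linarith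
  have hβ0 : 0 < β := by linarith
  set r := Real.sqrt κ with hr
  have hr2 : r ^ 2 = κ := Real.sq_sqrt hd0.le
  have hr4 : 4 ≤ r := by rw [hr]; exact Real.le_sqrt_of_sq_le (by linarith)
  have hr0 : 0 < r := by linarith
  have hρ1 : 2 / r ≤ 1 / 2 := by rw [div_le_div_iff₀ hr0 two_pos]; linarith
  set L := N.numItems with hL
  have hεr : ε * r ≤ 1 := by
    have : (ε * r) ^ 2 ≤ 1 := by rw [mul_pow, hr2]; exact hεδ
    nlinarith [mul_nonneg hε0 hr0.le]
  have hε1 : ε ≤ 1 / r := by rwa [le_div_iff₀ hr0]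
  have hinvκ : 1 / κ = (1 / r) * (1 / r) := by rw [← hr2]; field_simp
  have hr4' : 1 / r ≤ 1 / 4 := by
    rw [div_le_div_iff₀ hr0 (by norm_num)]; linarith
  have hrinv0 : 0 < 1 / r := by positivity
  have hκβ' : κ / β = (1 / κ) * (1 / κ) := by rw [hβ]; field_simp
  have hκinv0 : 0 < 1 / κ := by positivity
  have hκinv : 1 / κ ≤ (1 / 4) * (1 / r) := by rw [hinvκ]; nlinarith
  have hβinv : 1 / β ≤ 1 / κ := one_div_le_one_div_of_le hd0 hκβ
  -- This is where six streaming frames are needed: ε⁶ ≤ δ⁻³ has to beat the union bound over δ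
  -- children and the growth factor κ = δ, with a factor 1/δ left over.
  have h6 : κ * (κ * ε ^ 6) ≤ 1 / κ := by
    rw [le_div_iff₀ hd0]
    have h0 : 0 ≤ ε ^ 2 * κ := by positivity
    have : κ * (κ * ε ^ 6) * κ = (ε ^ 2 * κ) ^ 3 := by ring
    rw [this]
    exact pow_le_one₀ h0 hεδ
  have hstream : 1 / κ + κ / β + κ * (κ * ε ^ 6) + κ * (κ / β) ≤ 2 / r := by
    have h7 : κ * (κ / β) = 1 / κ := by rw [hβ]; field_simp
    have h8 : κ / β ≤ 1 / κ := by rw [hκβ']; nlinarith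
    rw [h7]
    have : 2 / r = 2 * (1 / r) := by ring
    rw [this]
    linarith
  have hgather : ε + 2 / β + κ / β ≤ 2 / r := by
    have h8 : κ / β ≤ 1 / κ := by rw [hκβ']; nlinarith
    have : 2 / r = 2 * (1 / r) := by ring
    have h9 : 2 / β = 2 * (1 / β) := by ring
    rw [this, h9]
    linarith
  refine (lintegral_completionTime_le_of_potential hc hX (ρ := 2 / r)
    (M := 4 * (9 * H + 6 * L + 6))
    -- The source term that the unfinished gathering feeds into the second sum is κ/β times the
    -- first summand, so it only adds κ/β to the contraction rate of the gathering.
    (Φ := fun B => β ^ (H + L + 1) * N.gatherPotential β B + ∑ v, N.streamWeight β κ H B v)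
    (fun B => add_nonneg (mul_nonneg (by positivity) (gatherPotential_nonneg hβ0.le))
      (Finset.sum_nonneg fun v _ => streamWeight_nonneg hβ0.le hd0.le v)) ?_ (by positivity)
    (by linarith) ?_ ?_).trans ?_
  · intro B I hB
    exact one_le_of_not_complete I hβ1 hB
      (Finset.sum_nonneg fun v _ => streamWeight_nonneg hβ0.le hd0.le v)
      (fun w hr hw => one_le_sum_streamWeight hβ1 hκ1 hr hw) _
  · intro B I
    rw [avg_add, avg_mul_left]
    have h1 := avg_gatherPotential_le I hc hβ1 hε0 hε
    have h2 := avg_streamWeight_le hδ I hκ1 hκβ hH hε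
    have hG := gatherPotential_nonneg (N := N) (B := B) hβ0.le
    have hS : 0 ≤ ∑ v, N.streamWeight β κ H B v :=
      Finset.sum_nonneg fun v _ => streamWeight_nonneg hβ0.le hd0.le v
    have h3 := mul_le_mul_of_nonneg_left h1 (by positivity : 0 ≤ β ^ (H + L + 1))
    have h4 := mul_le_mul_of_nonneg_right hstream hS
    have h5 := mul_le_mul_of_nonneg_right hgather
      (mul_nonneg (by positivity : 0 ≤ β ^ (H + L + 1)) hG)
    have h6 : κ * β ^ (H + L) = κ / β * β ^ (H + L + 1) := by
      rw [pow_succ]; field_simp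
    rw [← hL, h6] at h2
    refine (add_le_add h3 h2).trans ?_
    linarith
  · have h1 := initial_le_pow (by linarith) (gatherPotential_initial_le hδ hH hβ1 (by linarith))
      (sum_streamWeight_initial_le hδ hH hκ1 hκβ (by linarith))
    refine (mul_le_mul_of_nonneg_left h1 (by positivity)).trans ?_
    have h2 : β ^ (3 * H + 2 * L + 2) = κ ^ (9 * H + 6 * L + 6) := by
      rw [hβ, ← pow_mul]; congr 1; ring
    rw [← hL, h2, pow_mul, ← mul_pow]
    refine pow_le_one₀ (by positivity) ?_
    -- Four rounds compensate one factor `κ` of the initial value because δ ≥ 16; the initial value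
    -- has at most 9H + 6L + 6 such factors.
    have h3 : (2 / r) ^ 4 * κ = 16 / κ := by
      rw [← hr2]; field_simp; ring
    rw [h3, div_le_one hd0]
    exact hd
  · refine ENNReal.ofReal_le_ofReal (mul_le_mul_of_nonneg_left ?_ (by positivity))
    have : 1 / (1 - 2 / r) ≤ 2 := by
      rw [div_le_iff₀ (by linarith)]; linarith
    push_cast
    linarith

/-- In general, stop and wait with error messages is fast enough. -/
theorem lintegral_completionTime_le_of_allClear [Nonempty (Fin N.slots)]
    (hc : 1 ≤ N.compression) {Ω : Type} [MeasurableSpace Ω] {Pr : Measure Ω}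
    [IsProbabilityMeasure Pr] {X : ℕ → V → Ω → Fin N.slots} (hX : IsUniformDraw Pr X)
    (hδ : ∀ v ∈ N.backbone, N.graph.degree v ≤ δ) (hH : ∀ v, N.tree.depth v ≤ H)
    (hε0 : 0 ≤ ε) (hε : ∀ v w, N.graph.Adj w v →
      prob (fun x : V → Fin N.slots => ¬ NoConflict N.graph x v w) ≤ ε)
    (hp0 : 0 < p) (hp1 : p ≤ 1) (hεp : ε ≤ 1 - p)
    (hp : ∀ v ∈ N.backbone, p ≤ prob (fun x : V → Fin N.slots => AllClear N.graph x v)) :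
    ∫⁻ ω, N.completionTime gossip (fun t v => X t v ω) ∂Pr ≤
      ENNReal.ofReal (16 * N.slots *
        ((3 * H + 2 * N.numItems + 2) * (2 * Real.log (2 * (δ + 3) / p) / p) + 1 + 2 / p)) := by
  have hd0 : (0 : ℝ) ≤ δ := by positivity
  -- Chosen so that the losses (1 + δ)/β and 3/β from waiting use up at most half of the progress
  -- `p`.
  set β : ℝ := 2 * (δ + 3) / p with hβ
  have hβδ : 2 * ((δ : ℝ) + 3) ≤ β := by
    rw [hβ, le_div_iff₀ hp0]; nlinarith
  have hβ1 : 1 ≤ β := by linarith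
  have hβ0 : 0 < β := by linarith
  have hβp : β * p = 2 * (δ + 3) := by rw [hβ]; field_simp
  set L := N.numItems with hL
  have hcert : 1 - p + 1 / β + δ * (1 / β) ≤ 1 - p / 2 := by
    have : (1 + δ) * (1 / β) ≤ p / 2 := by
      rw [mul_one_div, div_le_iff₀ hβ0]; nlinarith
    linarith
  have hgather : ε + 2 / β + 1 / β ≤ 1 - p / 2 := by
    have : 2 / β + 1 / β ≤ p / 2 := by
      rw [← add_div, div_le_iff₀ hβ0]; nlinarith
    linarith
  set n := 3 * H + 2 * L + 2 with hn
  -- Since 1 - p/2 ≤ exp(-p/2), this many rounds outweigh the initial value β^n.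
  set M := ⌈(n : ℝ) * (2 * Real.log β / p)⌉₊ with hM
  have hlog : 0 ≤ Real.log β := Real.log_nonneg hβ1
  refine (lintegral_completionTime_le_of_potential hc hX (ρ := 1 - p / 2) (M := M)
    (Φ := fun B => β ^ (H + L + 1) * N.gatherPotential β B + ∑ v, N.certWeight β H B v)
    (fun B => add_nonneg (mul_nonneg (by positivity) (gatherPotential_nonneg hβ0.le))
      (Finset.sum_nonneg fun v _ => certWeight_nonneg hβ0.le v)) ?_ (by linarith)
    (by linarith) ?_ ?_).trans ?_
  · intro B I hB
    exact one_le_of_not_complete I hβ1 hB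
      (Finset.sum_nonneg fun v _ => certWeight_nonneg hβ0.le v)
      (fun w hr hw => one_le_sum_certWeight I hβ1 hr hw) _
  · intro B I
    rw [avg_add, avg_mul_left]
    have h1 := avg_gatherPotential_le I hc hβ1 hε0 hε
    have h2 := avg_certWeight_le hδ I hβ1 hH hp1 hp
    have hG := gatherPotential_nonneg (N := N) (B := B) hβ0.le
    have hS : 0 ≤ ∑ v, N.certWeight β H B v :=
      Finset.sum_nonneg fun v _ => certWeight_nonneg hβ0.le v
    have h3 := mul_le_mul_of_nonneg_left h1 (by positivity : 0 ≤ β ^ (H + L + 1))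
    have h4 := mul_le_mul_of_nonneg_right hcert hS
    have h5 := mul_le_mul_of_nonneg_right hgather
      (mul_nonneg (by positivity : 0 ≤ β ^ (H + L + 1)) hG)
    have h6 : β ^ (H + L) = 1 / β * β ^ (H + L + 1) := by
      rw [pow_succ]; field_simp
    rw [← hL, h6] at h2
    refine (add_le_add h3 h2).trans ?_
    linarith
  · have h1 := initial_le_pow (by linarith) (gatherPotential_initial_le hδ hH hβ1 (by linarith))
      (sum_certWeight_initial_le hδ hH hβ1 (by linarith))
    refine (mul_le_mul_of_nonneg_left h1 (pow_nonneg (by linarith) _)).trans ?_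
    rw [← hL, ← hn]
    have h2 : (1 - p / 2) ^ M ≤ Real.exp (-(p / 2) * M) := by
      rw [mul_comm, Real.exp_nat_mul]
      refine pow_le_pow_left₀ (by linarith) ?_ _
      have := Real.add_one_le_exp (-(p / 2))
      linarith
    have h3 : β ^ n = Real.exp (n * Real.log β) := by
      rw [Real.exp_nat_mul, Real.exp_log hβ0]
    rw [h3]
    refine (mul_le_mul_of_nonneg_right h2 (Real.exp_pos _).le).trans ?_
    rw [← Real.exp_add, Real.exp_le_one_iff]
    have h4 := Nat.le_ceil ((n : ℝ) * (2 * Real.log β / p))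
    rw [← hM] at h4
    have h5 := mul_le_mul_of_nonneg_left h4 (by linarith : 0 ≤ p / 2)
    have h6 : p / 2 * (n * (2 * Real.log β / p)) = n * Real.log β := by field_simp
    linarith
  · refine ENNReal.ofReal_le_ofReal (mul_le_mul_of_nonneg_left ?_ (by positivity))
    have h1 := (Nat.ceil_lt_add_one (by positivity : 0 ≤ (n : ℝ) * (2 * Real.log β / p))).le
    have h2 : 1 / (1 - (1 - p / 2)) = 2 / p := by
      rw [sub_sub_cancel]; field_simp
    rw [h2]
    rw [← hM, hn] at h1
    push_cast at h1
    linarith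

end Network

namespace Network

variable {V : Type} [Fintype V] [DecidableEq V] {N : Network V}

/-! ### The number of transmissions -/

variable {B : V → Memory} {y : Fin 8 → V → Fin N.slots}

open Classical in
/-- The nodes that send a batch to their parent. -/
noncomputable def senders (_ : Network V) (B : V → Memory) : Finset V :=
  Finset.univ.filter fun v => (B v).upBatch.isSome

open Classical in
/-- The nodes that send to their children. -/
noncomputable def actives (_ : Network V) (B : V → Memory) : Finset V :=
  Finset.univ.filter fun v => (B v).Active

/-- By how much the pointer of the parent is ahead. -/
noncomputable def lag (N : Network V) (B : V → Memory) (w : V) : ℕ :=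
  if w = N.tree.root then 0 else (B (N.tree.parent w)).pointer - (B w).avail

noncomputable def laggards (N : Network V) (B : V → Memory) : Finset V :=
  Finset.univ.filter fun w => N.lag B w ≠ 0

open Classical in
/-- The packets lost in the neighbourhood of the active nodes. -/
noncomputable def losses (N : Network V) (B : V → Memory) (x : V → Fin N.slots) : Finset (V × V) :=
  Finset.univ.filter fun q => (B q.1).Active ∧ N.graph.Adj q.1 q.2 ∧ ¬ NoConflict N.graph x q.1 q.2

theorem exists_of_hears {i : ℕ} {x : V → Fin N.slots} {v : V} {s : Fin N.slots} {p : Packet}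
    (h : N.hears B i x v s = Heard.message p) :
    ∃ u, N.graph.Adj v u ∧ x u = s ∧ N.packet B i u = some p := by
  obtain ⟨u, hu, hp, -⟩ := heard_eq_message_iff.1 h
  split_ifs at hp with hx
  exact ⟨u, hu, hx, hp⟩

/-- Every reply is the acknowledgement of one sender's packet by its parent, and it is determined by
the sender: the parent in the sender's slot. -/
theorem frameCost_zero_le (I : Invariant N B) (x : V → Fin N.slots) :
    N.frameCost B 0 x ≤ 2 * (N.senders B).card := by
  classical
  unfold frameCost
  rw [two_mul]
  refine add_le_add (Finset.card_le_card fun v hv => ?_) ((Finset.card_le_card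
    (t := (N.senders B).image fun w => (N.tree.parent w, x w)) fun q hq => ?_).trans
      Finset.card_image_le)
  · simpa [Invariant.packet_zero, senders] using hv
  · obtain ⟨v, s⟩ := q
    have hq := (Finset.mem_filter.1 hq).2
    cases hh : N.hears B 0 x v s with
    | silence => simp [hh, Memory.ReplyAt] at hq
    | collision => simp [hh, Memory.ReplyAt] at hq
    | message p =>
      simp only [hh, Memory.ReplyAt, true_and, ne_eq, not_true, false_and, or_false] at hq
      obtain ⟨u, hu, hx, hp⟩ := exists_of_hears hh
      rw [sender_of_packet hp, I.mem_children] at hq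
      rw [Invariant.packet_zero, Option.map_eq_some_iff] at hp
      obtain ⟨hb, hhb, -⟩ := hp
      exact Finset.mem_image.2 ⟨u, by simp [senders, hhb], by rw [hq.2, hx]⟩

theorem card_packet_le (I : Invariant N B) {i : ℕ} (h0 : i ≠ 0) :
    (Finset.univ.filter fun v => (N.packet B i v).isSome).card ≤ (N.actives B).card := by
  classical
  refine Finset.card_le_card fun v hv => ?_
  obtain ⟨p, hp⟩ := Option.isSome_iff_exists.1 (Finset.mem_filter.1 hv).2
  simpa [actives] using (I.packet_spread h0 hp).1

/-- Only a child behind the pointer replies, and only in the slot of its parent; so each laggard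
replies at most once. -/
theorem frameCost_stream_le (I : Invariant N B) (x : V → Fin N.slots) {i : ℕ} (h0 : i ≠ 0)
    (h7 : i ≠ 7) : N.frameCost B i x ≤ (N.actives B).card + (N.laggards B).card := by
  classical
  unfold frameCost
  refine add_le_add ((card_packet_le I h0).trans' (Finset.card_le_card fun v hv => by simpa using hv))
    ((Finset.card_le_card
    (t := (N.laggards B).image fun w => (w, x (N.tree.parent w))) fun q hq => ?_).trans
      Finset.card_image_le)
  obtain ⟨v, s⟩ := q
  have hq := (Finset.mem_filter.1 hq).2
  cases hh : N.hears B i x v s with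
  | silence => simp [hh, Memory.ReplyAt] at hq
  | collision => simp [hh, Memory.ReplyAt, h7] at hq
  | message p =>
    simp only [hh, Memory.ReplyAt, h0, false_and, ne_eq, not_false_eq_true, h7, true_and,
      false_or] at hq
    obtain ⟨u, hu, hx, hp⟩ := exists_of_hears hh
    rw [sender_of_packet hp, I.parent_eq_some] at hq
    have h1 := (I.packet_spread h0 hp).2.1
    rw [if_neg h7] at h1
    refine Finset.mem_image.2 ⟨v, ?_, by rw [hq.1.2, hx]⟩
    have hr : v ≠ N.tree.root := hq.1.1
    have hpar : N.tree.parent v = u := hq.1.2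
    have hlt : (B v).avail < p.header := hq.2
    refine Finset.mem_filter.2 ⟨Finset.mem_univ _, ?_⟩
    unfold lag
    rw [if_neg hr, hpar]
    omega

/-- A reported collision at `w` in slot `s` is charged to one active neighbour that has drawn `s`
and whose packet is thus lost at `w`; this pair and its draw determine the reply. -/
theorem frameCost_seven_le (I : Invariant N B) (x : V → Fin N.slots) :
    N.frameCost B 7 x ≤ (N.actives B).card + (N.losses B x).card := by
  classical
  unfold frameCost
  refine add_le_add ((card_packet_le I (i := 7) (by norm_num)).trans'
    (Finset.card_le_card fun v hv => by simpa using hv)) ((Finset.card_le_card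
    (t := (N.losses B x).image fun q => (q.2, x q.1)) fun q hq => ?_).trans
      Finset.card_image_le)
  obtain ⟨w, s⟩ := q
  have hq := (Finset.mem_filter.1 hq).2
  cases hh : N.hears B 7 x w s with
  | silence => simp [hh, Memory.ReplyAt] at hq
  | message p => simp [hh, Memory.ReplyAt] at hq
  | collision =>
    obtain ⟨v, u, -, hv, -, hs, -⟩ := exists_of_heard_eq_collision hh
    obtain ⟨p, hp⟩ := Option.isSome_iff_exists.1 hs
    split_ifs at hp with hx
    refine Finset.mem_image.2 ⟨(v, w), ?_, by simp [hx]⟩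
    simp only [losses, Finset.mem_filter, Finset.mem_univ, true_and]
    refine ⟨(I.packet_spread (by norm_num) hp).1, hv.symm, fun hc => ?_⟩
    have hm := mem_packets_of_noConflict hp hv hc
    rcases hears_of_packet hp hv (x := x) with h1 | h1
    · rw [hx, hh] at h1
      exact absurd h1.2 (by simp)
    · exact h1.1 hm

/-- The number of transmissions in a round. -/
noncomputable def roundCost (N : Network V) (B : V → Memory) (y : Fin 8 → V → Fin N.slots) : ℝ :=
  ∑ i : Fin 8, (N.frameCost B i (y i) : ℝ)

theorem roundCost_nonneg (y : Fin 8 → V → Fin N.slots) : 0 ≤ N.roundCost B y :=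
  Finset.sum_nonneg fun _ _ => Nat.cast_nonneg _

theorem roundCost_le (I : Invariant N B) (y : Fin 8 → V → Fin N.slots) :
    N.roundCost B y ≤ 2 * (N.senders B).card + 7 * (N.actives B).card +
      6 * (N.laggards B).card + (N.losses B (y 7)).card := by
  unfold roundCost
  have h0 := frameCost_zero_le I (y 0)
  have h7 := frameCost_seven_le I (y 7)
  have hi : ∀ i : Fin 8, (i : ℕ) ≠ 0 → (i : ℕ) ≠ 7 →
      N.frameCost B i (y i) ≤ (N.actives B).card + (N.laggards B).card :=
    fun i h0 h7 => frameCost_stream_le I (y i) h0 h7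
  have h1 := hi 1 (by decide) (by decide)
  have h2 := hi 2 (by decide) (by decide)
  have h3 := hi 3 (by decide) (by decide)
  have h4 := hi 4 (by decide) (by decide)
  have h5 := hi 5 (by decide) (by decide)
  have h6 := hi 6 (by decide) (by decide)
  have : ∑ i : Fin 8, N.frameCost B i (y i) ≤ 2 * (N.senders B).card + 7 * (N.actives B).card +
      6 * (N.laggards B).card + (N.losses B (y 7)).card := by
    rw [Fin.sum_univ_eight]
    have e0 : ((0 : Fin 8) : ℕ) = 0 := rfl
    have e7 : ((7 : Fin 8) : ℕ) = 7 := rfl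
    rw [e0, e7]
    omega
  exact_mod_cast this

/-! ### Expected decrease of the amount of work that is left -/

/-- A bound on the number of batches that a node sends to its parent. -/
noncomputable def maxUp (N : Network V) (v : V) : ℕ := if v ∈ N.backbone then N.numItems else 2

open Classical in
noncomputable def upLeft (N : Network V) (B : V → Memory) (v : V) : ℝ :=
  if N.Awaited B v then ((N.maxUp v - (B v).count : ℕ) : ℝ) else 0

open Classical in
noncomputable def downLeft (N : Network V) (B : V → Memory) (v : V) : ℝ :=
  if N.IsInner v then ((N.numItems - (B v).certified : ℕ) : ℝ) else 0

theorem upLeft_nonneg (v : V) : 0 ≤ N.upLeft B v := by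
  unfold upLeft; split_ifs <;> positivity

theorem downLeft_nonneg (v : V) : 0 ≤ N.downLeft B v := by
  unfold downLeft; split_ifs <;> positivity

namespace Invariant

theorem pool_subset_singleton (I : Invariant N B) {v : V} (hv : v ∉ N.backbone) :
    (B v).pool ⊆ {N.ident v} := by
  intro a ha
  obtain ⟨u, -, rfl, j, hj⟩ := I.pool_subtree v a ha
  cases j with
  | zero => simp [← hj]
  | succ j =>
    rw [Function.iterate_succ_apply'] at hj
    by_cases hr : N.tree.parent^[j] u = N.tree.root
    · rw [hr, N.tree.parent_root] at hj
      exact absurd (hj ▸ N.tree.root_mem) hv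
    · exact absurd (hj ▸ N.tree.parent_mem _ hr) hv

/-- A source outside the backbone is a leaf and has only its own rumor. So it sends at most one full
batch, followed by an empty last one. -/
theorem count_lt_maxUp (I : Invariant N B) (hc : 1 ≤ N.compression) {v : V}
    (h : N.Awaited B v) : (B v).count < N.maxUp v := by
  unfold maxUp
  split_ifs with hv
  · exact I.count_lt hc h.2.2
  · have h1 := Finset.card_le_card ((I.sentUp_subset v).trans (I.pool_subset_singleton hv))
    rw [I.card_sentUp v h.2.2, Finset.card_singleton] at h1
    nlinarith

open Classical in
theorem upLeft_round_le (I : Invariant N B) (hc : 1 ≤ N.compression)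
    (y : Fin 8 → V → Fin N.slots) (v : V) :
    N.upLeft (N.round B y) v ≤ N.upLeft B v -
      if (B v).upBatch.isSome ∧ NoConflict N.graph (y 0) v (N.tree.parent v) then 1 else 0 := by
  have hnat : ∀ (_ : N.Awaited B v), (1 : ℝ) ≤ ((N.maxUp v - (B v).count : ℕ) : ℝ) := fun h => by
    have := I.count_lt_maxUp hc h
    exact_mod_cast (by omega : 1 ≤ N.maxUp v - (B v).count)
  split_ifs with h
  · have hA := (I.upBatch_isSome_iff.1 h.1).1
    obtain ⟨hb, hhb⟩ := Option.isSome_iff_exists.1 h.1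
    have hp : N.packet B 0 v = some ⟨N.ident v, hb.1, hb.2⟩ := by rw [packet_zero, hhb]; rfl
    have hm := mem_packets_of_noConflict hp (isChild_parent hA.1).adj h.2
    have hcount := (I.round_of_acked hhb hm).2.1
    rw [upLeft, upLeft, if_pos hA]
    split_ifs with hA'
    · rw [hcount]
      have := I.count_lt_maxUp hc hA
      rw [← Nat.sub_sub, Nat.cast_sub (by omega)]
      simp
    · linarith [hnat hA]
  · rw [sub_zero]
    by_cases hA' : N.Awaited (N.round B y) v
    · rw [upLeft, upLeft, if_pos hA', if_pos (I.awaited_round hA')]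
      rcases acked_or_not B y v with ⟨hb, hu, hm⟩ | hn
      · have := (I.round_of_acked hu hm).2.1
        exact_mod_cast (by omega : N.maxUp v - (N.round B y v).count ≤ N.maxUp v - (B v).count)
      · rw [(I.round_of_not_acked hn).2.1]
    · rw [upLeft, if_neg hA']
      exact upLeft_nonneg v

open Classical in
theorem downLeft_round_le (I : Invariant N B) (y : Fin 8 → V → Fin N.slots) (v : V) :
    N.downLeft (N.round B y) v ≤ N.downLeft B v -
      if (B v).Active ∧ AllClear N.graph (y 7) v then 1 else 0 := by
  by_cases hin : N.IsInner v
  swap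
  · have h1 : ¬ (B v).Active := fun h => hin (I.active_iff.1 h).1
    rw [downLeft, downLeft, if_neg hin, if_neg hin, if_neg fun h => h1 h.1]
    simp
  rw [downLeft, downLeft, if_pos hin, if_pos hin]
  split_ifs with h
  · have hL := I.avail_le_numItems v
    have hlt := h.1.2
    obtain ⟨p, hp⟩ : ∃ p, N.packet B 7 v = some p := ⟨_, I.packet_of_active (by norm_num) h.1⟩
    rcases Invariant.certified_round (B := B) (y := y) (v := v) with ⟨h1, -⟩ | ⟨h1, h2⟩
    · rw [h1, ← Nat.sub_sub, Nat.cast_sub (by omega)]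
      simp
    · exact absurd ⟨h.1, (Invariant.quiet_seven_iff hp).2 fun w hw =>
        mem_packets_of_noConflict hp hw.symm (h.2 w hw)⟩ h2
  · rw [sub_zero]
    have : (B v).certified ≤ (N.round B y v).certified := by
      rcases Invariant.certified_round (B := B) (y := y) (v := v) with ⟨h1, -⟩ | ⟨h1, -⟩ <;> omega
    exact_mod_cast Nat.sub_le_sub_left this _

/-- Here `certified` is at most the number of items of the child, which is below the pointer, and
the pointer is below the number of items of the parent. -/
theorem active_of_lag (I : Invariant N B) {w : V} (h : N.lag B w ≠ 0) :
    w ≠ N.tree.root ∧ (B (N.tree.parent w)).Active := by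
  unfold lag at h
  split_ifs at h with hr
  · exact absurd rfl h
  · refine ⟨hr, I.active_iff.2 ⟨⟨w, isChild_parent hr⟩, ?_⟩⟩
    have h1 := I.certified_le w _ (isChild_parent hr)
    have h2 := I.pointer_le (N.tree.parent w)
    omega

-- A lucky laggard makes the pointer retreat, and a lucky child without lag keeps up with it. An
-- unlucky laggard may gain one instead of losing one, whence the factor 2.
open Classical in
theorem lag_round_le (I : Invariant N B) (y : Fin 8 → V → Fin N.slots) (w : V) :
    (N.lag (N.round B y) w : ℝ) ≤ N.lag B w - (if N.lag B w ≠ 0 then 1 else 0) +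
      2 * if w ≠ N.tree.root ∧ (B (N.tree.parent w)).Active then
        (if N.Unlucky y (N.tree.parent w) w then 1 else 0) else 0 := by
  by_cases hr : w = N.tree.root
  · simp [lag, hr]
  obtain ⟨hp1, hp2⟩ := I.pointer_round_bounds (v := N.tree.parent w) (y := y)
  have hav := I.avail_le_round (v := w) (y := y)
  have hw := isChild_parent (N := N) hr
  by_cases ha : (B (N.tree.parent w)).Active
  swap
  · have h0 : N.lag B w = 0 := by
      by_contra h
      exact ha (I.active_of_lag h).2
    have h1 : N.lag (N.round B y) w = 0 := by
      unfold lag at h0 ⊢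
      rw [if_neg hr] at h0 ⊢
      rcases Invariant.pointer_round (B := B) (y := y) (v := N.tree.parent w) with
        ⟨-, h, -⟩ | ⟨-, h, -⟩ | ⟨-, h⟩
      · exact absurd h ha
      · exact absurd h ha
      · omega
    rw [h0, h1]
    simp [ha]
  rw [if_pos (⟨hr, ha⟩ : w ≠ N.tree.root ∧ _)]
  by_cases hun : N.Unlucky y (N.tree.parent w) w
  · rw [if_pos hun]
    have h1 : N.lag (N.round B y) w ≤ N.lag B w + 1 := by
      unfold lag
      rw [if_neg hr, if_neg hr]
      omega
    have h2 : (N.lag (N.round B y) w : ℝ) ≤ N.lag B w + 1 := by exact_mod_cast h1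
    split_ifs <;> linarith
  · rw [if_neg hun, mul_zero, add_zero]
    have hl := I.of_not_unlucky hw ha hun
    by_cases h0 : N.lag B w = 0
    · have h1 : N.lag (N.round B y) w = 0 := by
        unfold lag at h0 ⊢
        rw [if_neg hr] at h0 ⊢
        rcases (by omega : (B (N.tree.parent w)).pointer < (B w).avail ∨
          (B (N.tree.parent w)).pointer = (B w).avail) with h | h
        · omega
        · have := hl.1 h
          omega
      rw [h0, h1]
      simp
    · have h1 : N.lag (N.round B y) w + 1 ≤ N.lag B w := by
        unfold lag at h0 ⊢
        rw [if_neg hr] at h0 ⊢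
        rw [if_neg hr]
        have hn := hl.2 (by omega)
        rcases Invariant.pointer_round (B := B) (y := y) (v := N.tree.parent w) with
          ⟨-, -, h⟩ | ⟨h, -⟩ | ⟨h, -⟩
        · omega
        · exact absurd hn h
        · exact absurd ha h
      rw [if_pos h0, le_sub_iff_add_le]
      exact_mod_cast h1

end Invariant

variable {ε p : ℝ} {δ : ℕ}

theorem avg_sum_upLeft_le [Nonempty (Fin N.slots)] (I : Invariant N B) (hc : 1 ≤ N.compression)
    (hε : ∀ v w, N.graph.Adj w v →
      prob (fun x : V → Fin N.slots => ¬ NoConflict N.graph x v w) ≤ ε) (hεp : ε ≤ 1 - p) :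
    avg (fun y => ∑ v, N.upLeft (N.round B y) v) ≤ ∑ v, N.upLeft B v - p * (N.senders B).card := by
  classical
  rw [avg_sum]
  have h : ∀ v, avg (fun y => N.upLeft (N.round B y) v) ≤ N.upLeft B v -
      if (B v).upBatch.isSome then p else 0 := by
    intro v
    refine (avg_mono fun y => I.upLeft_round_le hc y v).trans ?_
    by_cases hv : (B v).upBatch.isSome
    · simp only [hv, true_and, if_true, sub_eq_add_neg]
      rw [avg_add, avg_const]
      have hr := (I.upBatch_isSome_iff.1 hv).1.1
      have h1 := hε v (N.tree.parent v) (isChild_parent hr).adj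
      rw [prob_not, ← prob_apply (0 : Fin 8)
        fun x : V → Fin N.slots => NoConflict N.graph x v (N.tree.parent v)] at h1
      have h2 : avg (fun y : Fin 8 → V → Fin N.slots =>
          -if NoConflict N.graph (y 0) v (N.tree.parent v) then (1 : ℝ) else 0) =
          -prob (fun y : Fin 8 → V → Fin N.slots =>
            NoConflict N.graph (y 0) v (N.tree.parent v)) := by
        unfold prob
        rw [neg_eq_neg_one_mul, ← avg_mul_left]
        congr 1; ext y
        rw [neg_one_mul]
      rw [h2]
      linarith
    · simp only [hv, false_and, if_false, Bool.false_eq_true]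
      rw [avg_const]
  refine (Finset.sum_le_sum fun v _ => h v).trans_eq ?_
  rw [Finset.sum_sub_distrib, ← Finset.sum_filter, Finset.sum_const, nsmul_eq_mul, mul_comm p]
  rfl

theorem avg_sum_downLeft_le [Nonempty (Fin N.slots)] (I : Invariant N B)
    (hp : ∀ v ∈ N.backbone, p ≤ prob (fun x : V → Fin N.slots => AllClear N.graph x v)) :
    avg (fun y => ∑ v, N.downLeft (N.round B y) v) ≤
      ∑ v, N.downLeft B v - p * (N.actives B).card := by
  classical
  rw [avg_sum]
  have h : ∀ v, avg (fun y => N.downLeft (N.round B y) v) ≤ N.downLeft B v -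
      if (B v).Active then p else 0 := by
    intro v
    refine (avg_mono fun y => I.downLeft_round_le y v).trans ?_
    by_cases hv : (B v).Active
    · simp only [hv, true_and, if_true, sub_eq_add_neg]
      rw [avg_add, avg_const]
      have h1 := hp v (I.active_iff.1 hv).1.choose_spec.mem
      rw [← prob_apply (7 : Fin 8)
        fun x : V → Fin N.slots => AllClear N.graph x v] at h1
      have h2 : avg (fun y : Fin 8 → V → Fin N.slots =>
          -if AllClear N.graph (y 7) v then (1 : ℝ) else 0) =
          -prob (fun y : Fin 8 → V → Fin N.slots => AllClear N.graph (y 7) v) := by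
        unfold prob
        rw [neg_eq_neg_one_mul, ← avg_mul_left]
        congr 1; ext y
        rw [neg_one_mul]
      rw [h2]
      linarith
    · simp only [hv, false_and, if_false]
      rw [avg_const]
  refine (Finset.sum_le_sum fun v _ => h v).trans_eq ?_
  rw [Finset.sum_sub_distrib, ← Finset.sum_filter, Finset.sum_const, nsmul_eq_mul, mul_comm p]
  rfl

theorem sum_children_active_le [DecidableRel N.graph.Adj]
    (hδ : ∀ v ∈ N.backbone, N.graph.degree v ≤ δ) (B : V → Memory) {a : ℝ} (ha : 0 ≤ a) :
    (∑ w, open Classical in if w ≠ N.tree.root ∧ (B (N.tree.parent w)).Active then a else 0) ≤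
      δ * ((N.actives B).card * a) := by
  classical
  have h := sum_parent_le hδ (A := Finset.univ.filter (fun w => w ≠ N.tree.root ∧
    (B (N.tree.parent w)).Active)) (f := fun _ => a) (g := fun v => if (B v).Active then a else 0)
    (fun v hv => (Finset.mem_filter.1 hv).2.1) (fun v => by split_ifs <;> simp [ha])
    fun v hv => by simp [(Finset.mem_filter.1 hv).2.2]
  rw [Finset.sum_filter] at h
  refine h.trans_eq ?_
  rw [← Finset.sum_filter, Finset.sum_const, nsmul_eq_mul]
  rfl

theorem avg_sum_lag_le [DecidableRel N.graph.Adj] [Nonempty (Fin N.slots)] (I : Invariant N B)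
    (hδ : ∀ v ∈ N.backbone, N.graph.degree v ≤ δ) (hε0 : 0 ≤ ε) (hε1 : ε ≤ 1)
    (hε : ∀ v w, N.graph.Adj w v →
      prob (fun x : V → Fin N.slots => ¬ NoConflict N.graph x v w) ≤ ε) :
    avg (fun y => ∑ w, (N.lag (N.round B y) w : ℝ)) ≤
      ∑ w, (N.lag B w : ℝ) - (N.laggards B).card + 2 * (δ * ((N.actives B).card * ε)) := by
  classical
  rw [avg_sum]
  have h : ∀ w, avg (fun y => (N.lag (N.round B y) w : ℝ)) ≤
      N.lag B w - (if N.lag B w ≠ 0 then 1 else 0) +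
      2 * if w ≠ N.tree.root ∧ (B (N.tree.parent w)).Active then ε else 0 := by
    intro w
    refine (avg_mono fun y => I.lag_round_le y w).trans ?_
    rw [avg_add, avg_const, avg_mul_left]
    refine add_le_add_right (mul_le_mul_of_nonneg_left ?_ zero_le_two) _
    by_cases hw : w ≠ N.tree.root ∧ (B (N.tree.parent w)).Active
    · simp only [if_pos hw]
      have h1 := prob_unlucky_le (hε (N.tree.parent w) w (isChild_parent hw.1).adj.symm)
      -- For the number of messages the first power of `ε` is enough.
      refine le_trans (le_of_eq ?_) (h1.trans (pow_le_of_le_one hε0 hε1 (by norm_num)))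
      rfl
    · simp only [if_neg hw]
      rw [avg_const]
  refine (Finset.sum_le_sum fun w _ => h w).trans ?_
  rw [Finset.sum_add_distrib, Finset.sum_sub_distrib, ← Finset.mul_sum]
  have h1 : (∑ w, if N.lag B w ≠ 0 then (1 : ℝ) else 0) = (N.laggards B).card := by
    rw [← Finset.sum_filter, Finset.sum_const, nsmul_eq_mul, mul_one]
    rfl
  rw [h1]
  have h2 := sum_children_active_le hδ B hε0
  linarith

theorem avg_card_losses_le [DecidableRel N.graph.Adj] [Nonempty (Fin N.slots)]
    (I : Invariant N B) (hδ : ∀ v ∈ N.backbone, N.graph.degree v ≤ δ)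
    (hε0 : 0 ≤ ε) (hε : ∀ v w, N.graph.Adj w v →
      prob (fun x : V → Fin N.slots => ¬ NoConflict N.graph x v w) ≤ ε) :
    avg (fun y : Fin 8 → V → Fin N.slots => ((N.losses B (y 7)).card : ℝ)) ≤
      δ * ((N.actives B).card * ε) := by
  classical
  have h : ∀ y : Fin 8 → V → Fin N.slots, ((N.losses B (y 7)).card : ℝ) =
      ∑ v ∈ N.actives B, ∑ w ∈ N.graph.neighborFinset v,
        if ¬ NoConflict N.graph (y 7) v w then (1 : ℝ) else 0 := by
    intro y
    have h1 : ((N.losses B (y 7)).card : ℝ) = ∑ q : V × V, if (B q.1).Active ∧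
        N.graph.Adj q.1 q.2 ∧ ¬ NoConflict N.graph (y 7) q.1 q.2 then (1 : ℝ) else 0 := by
      rw [← Finset.sum_filter, Finset.sum_const, nsmul_eq_mul, mul_one, losses]
      congr
    rw [h1, Fintype.sum_prod_type, actives, Finset.sum_filter]
    refine Finset.sum_congr rfl fun v _ => ?_
    by_cases hv : (B v).Active
    · simp only [hv, true_and, if_true]
      rw [SimpleGraph.neighborFinset_eq_filter, Finset.sum_filter]
      refine Finset.sum_congr rfl fun w _ => ?_
      by_cases hw : N.graph.Adj v w <;> simp [hw]
    · simp [hv]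
  simp only [h]
  rw [avg_sum]
  have h2 : ∀ v ∈ N.actives B, avg (fun y : Fin 8 → V → Fin N.slots =>
      ∑ w ∈ N.graph.neighborFinset v,
        if ¬ NoConflict N.graph (y 7) v w then (1 : ℝ) else 0) ≤ δ * ε := by
    intro v hv
    rw [avg_sum]
    have h3 : ∀ w ∈ N.graph.neighborFinset v, avg (fun y : Fin 8 → V → Fin N.slots =>
        if ¬ NoConflict N.graph (y 7) v w then (1 : ℝ) else 0) ≤ ε := by
      intro w hw
      have hadj : N.graph.Adj v w := by simpa using hw
      refine le_trans (le_of_eq ?_) (hε v w hadj.symm)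
      rw [← prob_apply (7 : Fin 8) fun x : V → Fin N.slots => ¬ NoConflict N.graph x v w]
      unfold prob
      congr 1; ext y
      split_ifs <;> simp_all
    refine (Finset.sum_le_card_nsmul _ _ _ h3).trans ?_
    rw [nsmul_eq_mul, SimpleGraph.card_neighborFinset_eq_degree]
    have hD := (I.active_iff.1 (Finset.mem_filter.1 hv).2).1.choose_spec.mem
    exact mul_le_mul_of_nonneg_right (by exact_mod_cast hδ v hD) hε0
  refine (Finset.sum_le_card_nsmul _ _ _ h2).trans_eq ?_
  rw [nsmul_eq_mul]
  ring

/-- The coefficients of Ψ match `roundCost_le`. A sender costs 2 and advances with probability at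
least `p`; a laggard costs 6 and loses one unit of lag. An active node costs 7, expected losses δε
and, through lags, 6 · 2δε, in all 7 + 13δε, against progress of probability at least `p`. -/
theorem lintegral_totalMessages_le [DecidableRel N.graph.Adj] [Nonempty (Fin N.slots)]
    (hc : 1 ≤ N.compression) {Ω : Type} [MeasurableSpace Ω] {Pr : Measure Ω}
    [IsProbabilityMeasure Pr] {X : ℕ → V → Ω → Fin N.slots} (hX : IsUniformDraw Pr X)
    (hδ : ∀ v ∈ N.backbone, N.graph.degree v ≤ δ) (hε0 : 0 ≤ ε)
    (hε : ∀ v w, N.graph.Adj w v →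
      prob (fun x : V → Fin N.slots => ¬ NoConflict N.graph x v w) ≤ ε)
    (hp0 : 0 < p) (hεp : ε ≤ 1 - p)
    (hp : ∀ v ∈ N.backbone, p ≤ prob (fun x : V → Fin N.slots => AllClear N.graph x v)) :
    ∫⁻ ω, N.totalMessages gossip (fun t v => X t v ω) ∂Pr ≤ ENNReal.ofReal
      (2 / p * (N.backbone.card * N.numItems + 2 * N.sources.card) +
        (7 + 13 * (δ * ε)) / p * (N.backbone.card * N.numItems)) := by
  classical
  have hZ := hX.blocks
  have hd0 : (0 : ℝ) ≤ δ * ε := mul_nonneg (Nat.cast_nonneg _) hε0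
  set b := (7 + 13 * (δ * ε)) / p with hb
  have hb0 : 0 ≤ b := by positivity
  set Ψ : (V → Memory) → ℝ := fun B => 2 / p * ∑ v, N.upLeft B v + b * ∑ v, N.downLeft B v +
    6 * ∑ w, (N.lag B w : ℝ) with hΨ
  have hmain := hZ.tsum_lintegral_cost_le (F := N.round) (s := N.initialMemory)
    (I := Invariant N) invariant_initial (fun _ _ h => h.round) (Ψ := Ψ) (κ := N.roundCost)
    (fun B => add_nonneg (add_nonneg
      (mul_nonneg (by positivity) (Finset.sum_nonneg fun v _ => upLeft_nonneg v))
      (mul_nonneg hb0 (Finset.sum_nonneg fun v _ => downLeft_nonneg v))) (by positivity))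
    (fun B y => roundCost_nonneg y) ?_
  · calc ∫⁻ ω, N.totalMessages gossip (fun t v => X t v ω) ∂Pr
        = ∫⁻ ω, ∑' n, ENNReal.ofReal (N.roundCost (N.memory (fun t v => X t v ω) n)
            (fun (i : Fin 8) v => X (8 * n + i) v ω)) ∂Pr := by
          refine lintegral_congr fun ω => ?_
          rw [totalMessages_gossip hc]
          refine tsum_congr fun n => ?_
          unfold roundCost
          rw [ENNReal.ofReal_sum_of_nonneg fun _ _ => Nat.cast_nonneg _]
          exact Finset.sum_congr rfl fun i _ => (ENNReal.ofReal_natCast _).symm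
      _ = ∑' n, ∫⁻ ω, ENNReal.ofReal (N.roundCost (N.memory (fun t v => X t v ω) n)
            (fun (i : Fin 8) v => X (8 * n + i) v ω)) ∂Pr :=
          lintegral_tsum fun n => (hZ.measurable_orbit N.round N.initialMemory n
            fun B y => ENNReal.ofReal (N.roundCost B y)).aemeasurable
      _ ≤ ENNReal.ofReal (Ψ N.initialMemory) := hmain
      _ ≤ _ := ENNReal.ofReal_le_ofReal ?_
    have h1 : ∑ v, N.upLeft N.initialMemory v ≤
        N.backbone.card * N.numItems + 2 * N.sources.card := by
      have : ∀ v, N.upLeft N.initialMemory v ≤ (if v ∈ N.backbone then (N.numItems : ℝ) else 0) +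
          if v ∈ N.sources then 2 else 0 := by
        intro v
        unfold upLeft
        split_ifs with hA h1 h2 h2 <;> try positivity
        · have : N.maxUp v - (N.initialMemory v).count ≤ N.numItems := by
            rw [maxUp, if_pos h1]; exact Nat.sub_le _ _
          have : ((N.maxUp v - (N.initialMemory v).count : ℕ) : ℝ) ≤ N.numItems := by
            exact_mod_cast this
          linarith
        · have : N.maxUp v - (N.initialMemory v).count ≤ N.numItems := by
            rw [maxUp, if_pos h1]; exact Nat.sub_le _ _
          rw [add_zero]
          exact_mod_cast this
        · have : N.maxUp v - (N.initialMemory v).count ≤ 2 := by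
            rw [maxUp, if_neg h1]; exact Nat.sub_le _ _
          rw [zero_add]
          exact_mod_cast this
        · exact absurd hA.2.1 (by simp [h1, h2])
      refine (Finset.sum_le_sum fun v _ => this v).trans_eq ?_
      rw [Finset.sum_add_distrib, Finset.sum_ite_mem, Finset.sum_ite_mem]
      simp [mul_comm]
    have h2 : ∑ v, N.downLeft N.initialMemory v ≤ N.backbone.card * N.numItems := by
      have : ∀ v, N.downLeft N.initialMemory v ≤
          if v ∈ N.backbone then (N.numItems : ℝ) else 0 := by
        intro v
        unfold downLeft
        split_ifs with hA h1
        · exact_mod_cast Nat.sub_le _ _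
        · exact absurd hA.mem h1
        · positivity
        · exact le_rfl
      refine (Finset.sum_le_sum fun v _ => this v).trans_eq ?_
      rw [Finset.sum_ite_mem]
      simp
    have h3 : ∑ w, (N.lag N.initialMemory w : ℝ) = 0 := by
      refine Finset.sum_eq_zero fun w _ => ?_
      have : (N.initialMemory (N.tree.parent w)).pointer = 0 := rfl
      simp [lag, this]
    simp only [hΨ, h3, mul_zero, add_zero]
    exact add_le_add (mul_le_mul_of_nonneg_left h1 (by positivity))
      (mul_le_mul_of_nonneg_left h2 hb0)
  · intro B I
    have h0 : avg (N.roundCost B) ≤ 2 * (N.senders B).card + 7 * (N.actives B).card +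
        6 * (N.laggards B).card + δ * ((N.actives B).card * ε) := by
      refine (avg_mono fun y => roundCost_le I y).trans ?_
      rw [avg_add, avg_const]
      linarith [avg_card_losses_le I hδ hε0 hε]
    have h1 := avg_sum_upLeft_le I hc hε hεp
    have h2 := avg_sum_downLeft_le I hp
    have h3 := avg_sum_lag_le I hδ hε0 (by linarith) hε
    have h4 : avg (fun y => Ψ (N.round B y)) = 2 / p * avg (fun y => ∑ v, N.upLeft (N.round B y) v) +
        b * avg (fun y => ∑ v, N.downLeft (N.round B y) v) +
        6 * avg (fun y => ∑ w, (N.lag (N.round B y) w : ℝ)) := by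
      simp only [hΨ]
      rw [avg_add, avg_add, avg_mul_left, avg_mul_left, avg_mul_left]
    rw [h4]
    have h5 := mul_le_mul_of_nonneg_left h1 (by positivity : 0 ≤ 2 / p)
    have h6 := mul_le_mul_of_nonneg_left h2 hb0
    have h7 : 2 / p * (p * (N.senders B).card) = 2 * (N.senders B).card := by field_simp
    have h8 : b * (p * (N.actives B).card) = (7 + 13 * (δ * ε)) * (N.actives B).card := by
      rw [hb]; field_simp
    rw [mul_sub, h7] at h5
    rw [mul_sub, h8] at h6
    simp only [hΨ]
    linarith

end Network

/-- A set that a connected graph does not leave is left along an edge. -/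
theorem exists_adj_of_mem_of_notMem {V : Type} {G : SimpleGraph V} (hG : G.Connected) {P : V → Prop} {a b : V} (ha : P a)
    (hb : ¬ P b) : ∃ u v, G.Adj u v ∧ P u ∧ ¬ P v := by
  by_contra! h
  obtain ⟨w⟩ := hG a b
  have : ∀ {u v : V}, G.Walk u v → P u → P v := by
    intro u v w
    induction w with
    | nil => exact id
    | cons hadj _ ih => exact fun hu => ih (h _ _ hadj hu)
  exact hb (this w ha)

section Optimum

variable {V : Type} [Fintype V] [DecidableEq V] {G : SimpleGraph V} {S : Finset V} {c : ℕ}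

/-! ### Existence of schedules -/

/-- As long as rumors are missing somewhere, one more transmission is useful. -/
theorem exists_schedule (hG : G.Connected) (hc : 1 ≤ c)
    (K : (ℕ → V → Option (Finset V)) → ℕ → V → Finset V)
    (h0 : ∀ σ v, K σ 0 v = if v ∈ S then {v} else ∅)
    (hmono : ∀ σ t v, K σ t v ⊆ K σ (t + 1) v)
    (hcongr : ∀ σ σ' T, (∀ t < T, σ t = σ' t) → K σ T = K σ' T)
    (hsend : ∀ σ t a b B, G.Adj b a → σ t a = some B → (∀ u, u ≠ a → σ t u = none) →
      B ⊆ K σ (t + 1) b) :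
    ∃ T σ, ValidSchedule c (K σ) σ T ∧ ∀ v, S ⊆ K σ T v := by
  -- The induction is on the number of missing pairs of a node and a rumor. Each new slot has a
  -- single transmitter, so both models of the channel are served at once.
  have key : ∀ n T σ, ValidSchedule c (K σ) σ T → ∑ v, (S \ K σ T v).card ≤ n →
      ∃ T σ, ValidSchedule c (K σ) σ T ∧ ∀ v, S ⊆ K σ T v := by
    intro n
    induction n with
    | zero =>
      intro T σ hσ hn
      refine ⟨T, σ, hσ, fun v => ?_⟩
      rw [Nat.le_zero, Finset.sum_eq_zero_iff] at hn
      exact Finset.sdiff_eq_empty_iff_subset.1 (Finset.card_eq_zero.1 (hn v (Finset.mem_univ v)))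
    | succ n ih =>
      intro T σ hσ hn
      by_cases hall : ∀ v, S ⊆ K σ T v
      · exact ⟨T, σ, hσ, hall⟩
      push Not at hall
      obtain ⟨v, hv⟩ := hall
      obtain ⟨i, hi, hiv⟩ := Finset.not_subset.1 hv
      have hii : ∀ t, i ∈ K σ t i := by
        intro t
        induction t with
        | zero => simp [h0, hi]
        | succ t iht => exact hmono σ t i iht
      obtain ⟨a, b, hab, ha, hb⟩ := exists_adj_of_mem_of_notMem hG (P := fun u => i ∈ K σ T u)
        (hii T) hiv
      set σ' : ℕ → V → Option (Finset V) := fun t =>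
        if t = T then fun u => if u = a then some {i} else none else σ t with hσ'
      have heq : ∀ t ≤ T, K σ' t = K σ t := fun t ht => hcongr _ _ _ fun t' ht' => by
        rw [hσ']
        exact if_neg (by omega)
      have hT : σ' T = fun u => if u = a then some {i} else none := if_pos rfl
      refine ih (T + 1) σ' ?_ ?_
      · intro t ht w B hB
        rcases (Nat.lt_succ_iff_lt_or_eq.1 ht) with h | rfl
        · rw [heq t h.le]
          have : σ' t = σ t := if_neg h.ne
          rw [this] at hB
          exact hσ t h w B hB
        · rw [heq t le_rfl]
          rw [hT] at hB
          simp only at hB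
          split_ifs at hB with hw
          obtain rfl := Option.some.inj hB
          subst hw
          exact ⟨by simpa using ha, by simpa using hc⟩
      · have hsub : ∀ w, K σ T w ⊆ K σ' (T + 1) w := fun w => by
          rw [← heq T le_rfl]
          exact hmono _ _ _
        have hgain : i ∈ K σ' (T + 1) b :=
          hsend σ' T a b {i} hab.symm (by rw [hT]; simp) (fun u hu => by rw [hT]; simp [hu])
            (Finset.mem_singleton_self i)
        have hlt : ∑ w, (S \ K σ' (T + 1) w).card < ∑ w, (S \ K σ T w).card := by
          refine Finset.sum_lt_sum (fun w _ => Finset.card_le_card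
            (Finset.sdiff_subset_sdiff subset_rfl (hsub w))) ⟨b, Finset.mem_univ b, ?_⟩
          refine Finset.card_lt_card ⟨Finset.sdiff_subset_sdiff subset_rfl (hsub b), fun h => ?_⟩
          have := h (Finset.mem_sdiff.2 ⟨hi, hb⟩)
          exact (Finset.mem_sdiff.1 this).2 hgain
        omega
  exact key _ 0 (fun _ _ => none) (fun t ht => absurd ht (by omega)) le_rfl

section Ideal

variable [DecidableRel G.Adj] {σ σ' : ℕ → V → Option (Finset V)}

theorem mem_idealKnown_succ {t : ℕ} {v i : V} : i ∈ idealKnown G S σ (t + 1) v ↔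
    i ∈ idealKnown G S σ t v ∨ ∃ u, G.Adj v u ∧ i ∈ (σ t u).getD ∅ := by
  simp [idealKnown]

theorem idealKnown_congr {T : ℕ} (h : ∀ t < T, σ t = σ' t) :
    idealKnown G S σ T = idealKnown G S σ' T := by
  induction T with
  | zero => rfl
  | succ T ih =>
    ext v i
    rw [mem_idealKnown_succ, mem_idealKnown_succ, ih fun t ht => h t (by omega), h T (by omega)]

theorem exists_idealSchedule (hG : G.Connected) (hc : 1 ≤ c) :
    ∃ T σ, ValidSchedule c (idealKnown G S σ) σ T ∧ ∀ v, S ⊆ idealKnown G S σ T v :=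
  exists_schedule hG hc (fun σ => idealKnown G S σ) (fun _ _ => rfl)
    (fun _ _ _ => Finset.subset_union_left) (fun _ _ _ => idealKnown_congr)
    fun σ t a b B hab ha _ i hi => mem_idealKnown_succ.2 (Or.inr ⟨a, hab, by simpa [ha]⟩)

end Ideal

section Radio

variable {σ σ' : ℕ → V → Option (Finset V)}

theorem mem_radioKnown_succ {t : ℕ} {v i : V} : i ∈ radioKnown G S σ (t + 1) v ↔
    i ∈ radioKnown G S σ t v ∨ ∃ b, heard G (σ t) v = Heard.message b ∧ i ∈ b := by
  simp only [radioKnown, Finset.mem_union]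
  refine or_congr_right ?_
  cases h : heard G (σ t) v <;> simp

theorem radioKnown_congr {T : ℕ} (h : ∀ t < T, σ t = σ' t) :
    radioKnown G S σ T = radioKnown G S σ' T := by
  induction T with
  | zero => rfl
  | succ T ih =>
    ext v i
    rw [mem_radioKnown_succ, mem_radioKnown_succ, ih fun t ht => h t (by omega), h T (by omega)]

theorem exists_radioSchedule (hG : G.Connected) (hc : 1 ≤ c) :
    ∃ T σ, ValidSchedule c (radioKnown G S σ) σ T ∧ ∀ v, S ⊆ radioKnown G S σ T v :=
  exists_schedule hG hc (fun σ => radioKnown G S σ) (fun _ _ => rfl)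
    (fun _ _ _ => Finset.subset_union_left) (fun _ _ _ => radioKnown_congr)
    fun σ t a b B hab ha hn i hi => mem_radioKnown_succ.2 (Or.inr ⟨B,
      heard_eq_message_iff.2 ⟨a, hab, ha, fun w _ hw => by
        by_contra hwa
        simp [hn w hwa] at hw⟩, hi⟩)

end Radio

/-! ### Lower bounds for the number of transmissions -/

theorem minCDS_le {D : Finset V} (h : IsCDS G D) : minCDS G ≤ D.card :=
  Nat.sInf_le ⟨D, h, rfl⟩

theorem one_le_minCDS {D : Finset V} (h : IsCDS G D) : 1 ≤ minCDS G := by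
  obtain ⟨D', hD', hc⟩ := Nat.sInf_mem (s := {N | ∃ D : Finset V, IsCDS G D ∧ D.card = N})
    ⟨_, D, h, rfl⟩
  unfold minCDS
  rw [← hc, Nat.one_le_iff_ne_zero, Finset.card_ne_zero]
  obtain ⟨⟨v, hv⟩⟩ := hD'.1.nonempty
  exact ⟨v, by simpa using hv⟩

section Transmissions

variable [DecidableRel G.Adj] {σ : ℕ → V → Option (Finset V)} {T : ℕ}

/-- The nodes that transmit the rumor `i`. -/
def transmitters (σ : ℕ → V → Option (Finset V)) (T : ℕ) (i : V) : Finset V :=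
  Finset.univ.filter fun u => ∃ t ∈ Finset.range T, i ∈ (σ t u).getD ∅

theorem mem_transmitters {i u : V} :
    u ∈ transmitters σ T i ↔ ∃ t < T, i ∈ (σ t u).getD ∅ := by
  simp [transmitters]

theorem known_of_sent (hσ : ValidSchedule c (idealKnown G S σ) σ T) {t : ℕ} (ht : t < T) {u i : V}
    (hi : i ∈ (σ t u).getD ∅) : i ∈ idealKnown G S σ t u := by
  cases hb : σ t u with
  | none => simp [hb] at hi
  | some b =>
    rw [hb] at hi
    exact (hσ t ht u b hb).1 hi

theorem eq_or_exists_transmitter {t : ℕ} (htT : t ≤ T) {v i : V}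
    (h : i ∈ idealKnown G S σ t v) :
    v = i ∨ ∃ t' < t, ∃ u ∈ transmitters σ T i, G.Adj v u ∧ i ∈ (σ t' u).getD ∅ := by
  induction t with
  | zero =>
    left
    simp only [idealKnown] at h
    split_ifs at h
    · exact (Finset.mem_singleton.1 h).symm
    · simp at h
  | succ t ih =>
    rcases mem_idealKnown_succ.1 h with h | ⟨u, hu, hi⟩
    · rcases ih (by omega) h with h | ⟨t', ht', h⟩
      · exact Or.inl h
      · exact Or.inr ⟨t', by omega, h⟩
    · exact Or.inr ⟨t, by omega, u, mem_transmitters.2 ⟨t, by omega, hi⟩, hu, hi⟩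

/-- A rumor that has reached another node can be traced back in time through its senders, and the
trace can only end at the source. -/
theorem self_mem_transmitters [Nontrivial V] (hσ : ValidSchedule c (idealKnown G S σ) σ T)
    (hfull : ∀ v, S ⊆ idealKnown G S σ T v) {i : V} (hi : i ∈ S) : i ∈ transmitters σ T i := by
  have key : ∀ t ≤ T, ∀ v, v ≠ i → i ∈ idealKnown G S σ t v → i ∈ transmitters σ T i := by
    intro t
    induction t using Nat.strong_induction_on with
    | _ t ih =>
      intro ht v hv h
      rcases eq_or_exists_transmitter ht h with h | ⟨t', ht', u, hu, -, hi'⟩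
      · exact absurd h hv
      · by_cases hui : u = i
        · rwa [hui] at hu
        · exact ih t' ht' (by omega) u hui (known_of_sent hσ (by omega) hi')
  obtain ⟨v, hv⟩ := exists_ne i
  exact key T le_rfl v hv (hfull v hi)

/-- The transmitters of a rumor form a connected dominating set. -/
theorem isCDS_transmitters [Nontrivial V] (hσ : ValidSchedule c (idealKnown G S σ) σ T)
    (hfull : ∀ v, S ⊆ idealKnown G S σ T v) {i : V} (hi : i ∈ S) :
    IsCDS G (transmitters σ T i) := by
  have hself := self_mem_transmitters hσ hfull hi
  constructor
  -- The same backward trace stays inside the set of transmitters and so connects each of them to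
  -- the source.
  · have key : ∀ t ≤ T, ∀ v (hv : v ∈ transmitters σ T i), i ∈ idealKnown G S σ t v →
        (G.induce (transmitters σ T i : Set V)).Reachable ⟨v, by simpa using hv⟩
          ⟨i, by simpa using hself⟩ := by
      intro t
      induction t using Nat.strong_induction_on with
      | _ t ih =>
        intro ht v hv h
        rcases eq_or_exists_transmitter ht h with rfl | ⟨t', ht', u, hu, hvu, hi'⟩
        · exact SimpleGraph.Reachable.refl _
        · refine SimpleGraph.Reachable.trans (SimpleGraph.Adj.reachable ?_)
            (ih t' ht' (by omega) u hu (known_of_sent hσ (by omega) hi'))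
          simpa using hvu
    refine SimpleGraph.connected_iff_exists_forall_reachable _ |>.2
      ⟨⟨i, by simpa using hself⟩, fun ⟨v, hv⟩ => ?_⟩
    have hv' : v ∈ transmitters σ T i := by simpa using hv
    exact (key T le_rfl v hv' (hfull v hi)).symm
  · intro v hv
    rcases eq_or_exists_transmitter le_rfl (hfull v hi) with rfl | ⟨-, -, u, hu, hvu, -⟩
    · exact absurd hself hv
    · exact ⟨u, hu, hvu⟩

theorem card_transmitters_le (i : V) : (transmitters σ T i).card ≤
    ∑ t ∈ Finset.range T, (Finset.univ.filter fun u => i ∈ (σ t u).getD ∅).card := by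
  refine le_trans (Finset.card_le_card fun u hu => ?_) Finset.card_biUnion_le
  obtain ⟨t, ht, hi⟩ := mem_transmitters.1 hu
  exact Finset.mem_biUnion.2 ⟨t, Finset.mem_range.2 ht, by simpa using hi⟩

/-- Double counting of pairs of a transmission and a rumor in its batch. -/
theorem sum_card_transmitters_le (hσ : ValidSchedule c (idealKnown G S σ) σ T) :
    ∑ i ∈ S, (transmitters σ T i).card ≤
      c * ∑ t ∈ Finset.range T, (Finset.univ.filter fun v => (σ t v).isSome).card := by
  calc ∑ i ∈ S, (transmitters σ T i).card
      ≤ ∑ i ∈ S, ∑ t ∈ Finset.range T,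
          (Finset.univ.filter fun u => i ∈ (σ t u).getD ∅).card :=
        Finset.sum_le_sum fun i _ => card_transmitters_le i
    _ = ∑ t ∈ Finset.range T, ∑ u, (S.filter fun i => i ∈ (σ t u).getD ∅).card := by
        rw [Finset.sum_comm]
        refine Finset.sum_congr rfl fun t _ => ?_
        simp only [Finset.card_filter]
        rw [Finset.sum_comm]
    _ ≤ ∑ t ∈ Finset.range T, ∑ u, if (σ t u).isSome then c else 0 := by
        refine Finset.sum_le_sum fun t ht => Finset.sum_le_sum fun u _ => ?_
        cases hb : σ t u with
        | none => simp
        | some b =>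
          simp only [Option.getD_some, Option.isSome_some, if_true]
          exact (Finset.card_le_card fun i hi => (Finset.mem_filter.1 hi).2).trans
            (hσ t (Finset.mem_range.1 ht) u b hb).2
    _ = _ := by
        rw [Finset.mul_sum]
        refine Finset.sum_congr rfl fun t _ => ?_
        rw [← Finset.sum_filter, Finset.sum_const, smul_eq_mul, mul_comm]

theorem card_sources_le_transmissions [Nontrivial V]
    (hσ : ValidSchedule c (idealKnown G S σ) σ T) (hfull : ∀ v, S ⊆ idealKnown G S σ T v) :
    S.card ≤ ∑ t ∈ Finset.range T, (Finset.univ.filter fun v => (σ t v).isSome).card := by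
  refine le_trans (Finset.card_le_card fun i hi => ?_) Finset.card_biUnion_le
  obtain ⟨t, ht, h⟩ := mem_transmitters.1 (self_mem_transmitters hσ hfull hi)
  refine Finset.mem_biUnion.2 ⟨t, Finset.mem_range.2 ht, ?_⟩
  cases hb : σ t i with
  | none => simp [hb] at h
  | some b => simp [hb]

/-- The infimum in `mOpt` is attained because some schedule exists; over an empty set it would be 0
and bound nothing. -/
theorem exists_mOpt_schedule (hG : G.Connected) (hc : 1 ≤ c) :
    ∃ (T : ℕ) (σ : ℕ → V → Option (Finset V)),
    ValidSchedule c (idealKnown G S σ) σ T ∧ (∀ v, S ⊆ idealKnown G S σ T v) ∧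
      mOpt G S c = ∑ t ∈ Finset.range T, (Finset.univ.filter fun v => (σ t v).isSome).card := by
  obtain ⟨T, σ, h1, h2⟩ := exists_idealSchedule (G := G) (S := S) hG hc
  exact Nat.sInf_mem (s := {M | ∃ (T : ℕ) (σ : ℕ → V → Option (Finset V)),
    ValidSchedule c (idealKnown G S σ) σ T ∧ (∀ v, S ⊆ idealKnown G S σ T v) ∧
      M = ∑ t ∈ Finset.range T, (Finset.univ.filter fun v => (σ t v).isSome).card})
    ⟨_, T, σ, h1, h2, rfl⟩

theorem card_le_mOpt [Nontrivial V] (hG : G.Connected) (hc : 1 ≤ c) : S.card ≤ mOpt G S c := by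
  obtain ⟨T, σ, h1, h2, h3⟩ := exists_mOpt_schedule (G := G) (S := S) hG hc
  rw [h3]
  exact card_sources_le_transmissions h1 h2

theorem card_mul_minCDS_le [Nontrivial V] (hG : G.Connected) (hc : 1 ≤ c) :
    S.card * minCDS G ≤ c * mOpt G S c := by
  obtain ⟨T, σ, h1, h2, h3⟩ := exists_mOpt_schedule (G := G) (S := S) hG hc
  rw [h3]
  refine le_trans ?_ (sum_card_transmitters_le h1)
  rw [← smul_eq_mul]
  exact Finset.card_nsmul_le_sum _ _ _ fun i hi => minCDS_le (isCDS_transmitters h1 h2 hi)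

end Transmissions

/-! ### Lower bounds for the number of slots -/

section Slots

variable {σ : ℕ → V → Option (Finset V)} {T : ℕ}

theorem exists_sOpt_schedule (hG : G.Connected) (hc : 1 ≤ c) :
    ∃ σ : ℕ → V → Option (Finset V),
    ValidSchedule c (radioKnown G S σ) σ (sOpt G S c) ∧ ∀ v, S ⊆ radioKnown G S σ (sOpt G S c) v := by
  obtain ⟨T, σ, h1, h2⟩ := exists_radioSchedule (G := G) (S := S) hG hc
  exact Nat.sInf_mem (s := {T | ∃ σ : ℕ → V → Option (Finset V),
    ValidSchedule c (radioKnown G S σ) σ T ∧ ∀ v, S ⊆ radioKnown G S σ T v}) ⟨T, σ, h1, h2⟩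

/-- A rumor crosses at most one edge per slot. -/
theorem dist_le_of_radioKnown (hG : G.Connected) (hσ : ValidSchedule c (radioKnown G S σ) σ T)
    {t : ℕ} (ht : t ≤ T) {v i : V} (h : i ∈ radioKnown G S σ t v) : G.dist v i ≤ t := by
  induction t generalizing v with
  | zero =>
    simp only [radioKnown] at h
    split_ifs at h
    · rw [Finset.mem_singleton.1 h]; simp
    · simp at h
  | succ t ih =>
    rcases mem_radioKnown_succ.1 h with h | ⟨b, hb, hi⟩
    · exact (ih (by omega) h).trans (by omega)
    · obtain ⟨u, hu, hub, -⟩ := heard_eq_message_iff.1 hb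
      have h1 := ih (by omega) ((hσ t (by omega) u b hub).1 hi)
      have h2 := hG.dist_triangle (u := v) (v := u) (w := i)
      have h3 := SimpleGraph.dist_eq_one_iff_adj.2 hu
      omega

/-- A node receives at most one message per slot, with at most `c` rumors. -/
theorem card_radioKnown_le (hσ : ValidSchedule c (radioKnown G S σ) σ T)
    {t : ℕ} (ht : t ≤ T) (v : V) : (radioKnown G S σ t v).card ≤ 1 + c * t := by
  induction t with
  | zero =>
    simp only [radioKnown]
    split_ifs <;> simp
  | succ t ih =>
    simp only [radioKnown]
    refine (Finset.card_union_le _ _).trans ?_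
    refine (add_le_add (ih (by omega)) (?_ : _ ≤ c)).trans_eq (by ring)
    cases hb : heard G (σ t) v with
    | silence => simp
    | collision => simp
    | message b =>
      obtain ⟨u, -, hub, -⟩ := heard_eq_message_iff.1 hb
      exact (hσ t (by omega) u b hub).2

/-- All nodes lie within `sOpt` steps of any one source; the rest is the triangle inequality. -/
theorem diam_le_two_mul_sOpt (hG : G.Connected) (hc : 1 ≤ c) (hS : S.Nonempty) :
    G.diam ≤ 2 * sOpt G S c := by
  obtain ⟨σ, h1, h2⟩ := exists_sOpt_schedule (G := G) (S := S) hG hc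
  obtain ⟨i, hi⟩ := hS
  have : Nonempty V := ⟨i⟩
  obtain ⟨u, v, h⟩ := G.exists_dist_eq_diam
  rw [← h]
  have h3 := dist_le_of_radioKnown hG h1 le_rfl (h2 u hi)
  have h4 := dist_le_of_radioKnown hG h1 le_rfl (h2 v hi)
  have h5 := hG.dist_triangle (u := u) (v := i) (w := v)
  rw [G.dist_comm (u := i)] at h5
  omega

theorem card_le_sOpt (hG : G.Connected) (hc : 1 ≤ c) : S.card ≤ 1 + c * sOpt G S c := by
  obtain ⟨σ, h1, h2⟩ := exists_sOpt_schedule (G := G) (S := S) hG hc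
  obtain ⟨v⟩ := hG.nonempty
  exact (Finset.card_le_card (h2 v)).trans (card_radioKnown_le h1 le_rfl v)

theorem one_le_sOpt [Nontrivial V] (hG : G.Connected) (hc : 1 ≤ c) (hS : S.Nonempty) :
    1 ≤ sOpt G S c := by
  obtain ⟨σ, -, h2⟩ := exists_sOpt_schedule (G := G) (S := S) hG hc
  obtain ⟨i, hi⟩ := hS
  obtain ⟨v, hv⟩ := exists_ne i
  by_contra h0
  have h := h2 v hi
  rw [(by omega : sOpt G S c = 0)] at h
  simp only [radioKnown] at h
  split_ifs at h
  · exact hv (Finset.mem_singleton.1 h).symm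
  · simp at h

end Slots

end Optimum

/-! ### Existence of short backbones and of arborescences -/

section Backbone

variable {V : Type} {G : SimpleGraph V}

theorem exists_dist_eq {W : Type} {K : SimpleGraph W} (hK : K.Connected) {a b : W} {n : ℕ}
    (hn : n ≤ K.dist a b) : ∃ x, K.dist a x = n := by
  induction n with
  | zero => exact ⟨a, by simp⟩
  | succ n ih =>
    obtain ⟨x, hx⟩ := ih (by omega)
    obtain ⟨u, v, huv, hu, hv⟩ := exists_adj_of_mem_of_notMem hK (P := fun u => K.dist a u ≤ n)
      (a := a) (b := b) (by simp) (by omega)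
    refine ⟨v, ?_⟩
    have h1 := hK.dist_triangle (u := a) (v := u) (w := v)
    have h2 := SimpleGraph.dist_eq_one_iff_adj.2 huv
    omega

/-- A connected graph contains few points of large mutual distances. -/
theorem card_mul_le_of_separated {W : Type} [Fintype W] {K : SimpleGraph W}
    (hK : K.Connected) {d : ℕ} {I : Finset W} (hI : ∀ a ∈ I, ∀ b ∈ I, a ≠ b → d < K.dist a b)
    (h2 : 2 ≤ I.card) : I.card * (d / 2 + 1) ≤ Fintype.card W := by
  classical
  set ball : W → Finset W := fun a => Finset.univ.filter fun x => K.dist a x ≤ d / 2 with hball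
  have hdisj : (I : Set W).PairwiseDisjoint ball := by
    intro a ha b hb hab
    rw [Function.onFun, Finset.disjoint_left]
    intro x hxa hxb
    have h1 := (Finset.mem_filter.1 hxa).2
    have h2 := (Finset.mem_filter.1 hxb).2
    have h3 := hI a ha b hb hab
    have h4 := hK.dist_triangle (u := a) (v := x) (w := b)
    rw [K.dist_comm (u := x)] at h4
    omega
  have hcard : ∀ a ∈ I, d / 2 + 1 ≤ (ball a).card := by
    intro a ha
    -- A second point, farther than `d` away, ensures that every distance up to d/2 occurs, so the
    -- ball has at least d/2 + 1 points.
    obtain ⟨b, hb, hba⟩ := Finset.exists_mem_ne (by omega : 1 < I.card) a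
    have h3 := hI a ha b hb hba.symm
    calc d / 2 + 1 = (Finset.range (d / 2 + 1)).card := (Finset.card_range _).symm
      _ ≤ ((ball a).image (K.dist a)).card := by
        refine Finset.card_le_card fun n hn => ?_
        have hn := Finset.mem_range.1 hn
        obtain ⟨x, hx⟩ := exists_dist_eq hK (by omega : n ≤ K.dist a b)
        exact Finset.mem_image.2 ⟨x, Finset.mem_filter.2 ⟨Finset.mem_univ x, by omega⟩, hx⟩
      _ ≤ _ := Finset.card_image_le
  calc I.card * (d / 2 + 1) ≤ ∑ a ∈ I, (ball a).card := by
        rw [← smul_eq_mul]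
        exact Finset.card_nsmul_le_sum _ _ _ hcard
    _ = (I.biUnion ball).card := (Finset.card_biUnion hdisj).symm
    _ ≤ Fintype.card W := Finset.card_le_univ _

/-- A separated set of maximal size covers: an uncovered point could be added to it. -/
theorem exists_landmarks {W : Type} [Fintype W] (K : SimpleGraph W) (d : ℕ) (r : W) :
    ∃ I : Finset W, r ∈ I ∧ (∀ a ∈ I, ∀ b ∈ I, a ≠ b → d < K.dist a b) ∧
      ∀ x, ∃ a ∈ I, K.dist a x ≤ d := by
  classical
  obtain ⟨I, hI, hmax⟩ := Finset.exists_max_image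
    (Finset.univ.filter fun I : Finset W => r ∈ I ∧ ∀ a ∈ I, ∀ b ∈ I, a ≠ b → d < K.dist a b)
    Finset.card ⟨{r}, by simp⟩
  obtain ⟨hr, hsep⟩ := (Finset.mem_filter.1 hI).2
  refine ⟨I, hr, hsep, fun x => ?_⟩
  by_contra! hx
  have hxI : x ∉ I := fun h => by simpa using hx x h
  have := hmax (insert x I) (by
    simp only [Finset.mem_filter, Finset.mem_univ, true_and, Finset.mem_insert]
    refine ⟨Or.inr hr, ?_⟩
    rintro a (rfl | ha) b (rfl | hb) hab
    · exact absurd rfl hab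
    · rw [K.dist_comm]; exact hx b hb
    · exact hx a ha
    · exact hsep a ha b hb hab)
  rw [Finset.card_insert_of_notMem hxI] at this
  omega

/-- Walks of length at most `n` from `r` within `D`. -/
def Within (G : SimpleGraph V) (D : Finset V) (r v : V) (n : ℕ) : Prop :=
  ∃ (hr : r ∈ (D : Set V)) (hv : v ∈ (D : Set V)) (p : (G.induce (D : Set V)).Walk ⟨r, hr⟩ ⟨v, hv⟩),
    p.length ≤ n

theorem Within.trans {D : Finset V} {a b c : V} {n k : ℕ} (h : Within G D a b n)
    (h' : Within G D b c k) : Within G D a c (n + k) := by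
  obtain ⟨ha, hb, p, hp⟩ := h
  obtain ⟨hb', hc, q, hq⟩ := h'
  exact ⟨ha, hc, p.append q, by rw [SimpleGraph.Walk.length_append]; omega⟩

theorem Within.mono {D D' : Finset V} (hD : D ⊆ D') {a b : V} {n k : ℕ} (hn : n ≤ k)
    (h : Within G D a b n) : Within G D' a b k := by
  obtain ⟨ha, hb, p, hp⟩ := h
  have hDD : (D : Set V) ⊆ D' := by exact_mod_cast hD
  exact ⟨hDD ha, hDD hb, p.map (SimpleGraph.induceHomOfLE G hDD).toHom,
    (SimpleGraph.Walk.length_map _ _).trans_le (hp.trans hn)⟩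

theorem within_of_walk {D : Finset V} {a b : V} (p : G.Walk a b) (hp : ∀ x ∈ p.support, x ∈ D) :
    Within G D a b p.length := by
  induction p with
  | nil => exact ⟨by simpa using hp, by simpa using hp, .nil, le_rfl⟩
  | cons h p ih =>
    obtain ⟨hu, hv, q, hq⟩ := ih fun x hx => hp x (by simp [hx])
    refine ⟨by simpa using hp _ (SimpleGraph.Walk.start_mem_support _), hv,
      .cons (v := ⟨_, hu⟩) (by simpa using h) q, ?_⟩
    simpa using hq

theorem connected_of_within {D : Finset V} {r : V} {n : ℕ} (hr : r ∈ D)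
    (h : ∀ v ∈ D, Within G D r v n) : (G.induce (D : Set V)).Connected ∧
      (G.induce (D : Set V)).diam ≤ 2 * n := by
  have hr' : r ∈ (D : Set V) := by simpa using hr
  have hdist : ∀ v : (D : Set V), ∃ p : (G.induce (D : Set V)).Walk ⟨r, hr'⟩ v, p.length ≤ n := by
    rintro ⟨v, hv⟩
    obtain ⟨_, _, p, hp⟩ := h v (by simpa using hv)
    exact ⟨p, hp⟩
  have hconn : (G.induce (D : Set V)).Connected :=
    (SimpleGraph.connected_iff_exists_forall_reachable _).2
      ⟨⟨r, hr'⟩, fun v => ⟨(hdist v).choose⟩⟩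
  refine ⟨hconn, ?_⟩
  have : Nonempty (D : Set V) := ⟨⟨r, hr'⟩⟩
  obtain ⟨u, v, huv⟩ := (G.induce (D : Set V)).exists_dist_eq_diam
  rw [← huv]
  obtain ⟨p, hp⟩ := hdist u
  obtain ⟨q, hq⟩ := hdist v
  refine (SimpleGraph.dist_le (p.reverse.append q)).trans ?_
  rw [SimpleGraph.Walk.length_append, SimpleGraph.Walk.length_reverse]
  omega

theorem dist_le_diam_of_connected {W : Type} [Fintype W] {K : SimpleGraph W} (hK : K.Connected)
    (a b : W) : K.dist a b ≤ K.diam := by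
  have : Nonempty W := ⟨a⟩
  exact SimpleGraph.dist_le_diam (SimpleGraph.connected_iff_ediam_ne_top.1 hK)

variable [Fintype V] [DecidableEq V]

/-- Let d = diam G. Landmarks of mutual distance above d in G[D₀] are joined to one of them, `r`, by
shortest paths of G. Every node is then within 2d of `r`, which gives diameter at most 4d. The balls
of radius d/2 about the landmarks are disjoint, so the paths add at most 2|D₀| nodes, as d + 1 ≤
2(⌊d/2⌋ + 1). -/
theorem exists_isShortBackbone (hG : G.Connected) {D₀ : Finset V} (h₀ : IsCDS G D₀) :
    ∃ D, IsShortBackbone G D₀ D := by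
  classical
  set d := G.diam with hd
  set K := G.induce (D₀ : Set V) with hK
  have hKc : K.Connected := h₀.1
  obtain ⟨r⟩ := hKc.nonempty
  obtain ⟨I, hrI, hsep, hcov⟩ := exists_landmarks K d r
  have hpath : ∀ l : (D₀ : Set V), ∃ p : G.Walk r.1 l.1, p.length ≤ d := by
    intro l
    obtain ⟨p, hp⟩ := hG.exists_walk_length_eq_dist r.1 l.1
    exact ⟨p, hp.trans_le (dist_le_diam_of_connected hG _ _)⟩
  choose p hp using hpath
  set D := D₀ ∪ (I.erase r).biUnion fun l => (p l).support.toFinset with hD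
  have hsub : D₀ ⊆ D := Finset.subset_union_left
  have hr0 : r.1 ∈ D₀ := by simp
  have hland : ∀ l ∈ I, Within G D r.1 l.1 d := by
    intro l hl
    by_cases hlr : l = r
    · rw [hlr]
      exact ⟨by simpa using hsub hr0, by simpa using hsub hr0, .nil, by simp⟩
    · refine (within_of_walk (p l) fun x hx => ?_).mono subset_rfl (hp l)
      exact Finset.mem_union_right _ (Finset.mem_biUnion.2
        ⟨l, Finset.mem_erase.2 ⟨hlr, hl⟩, by simpa using hx⟩)
  have hwithin : ∀ v ∈ D, Within G D r.1 v (2 * d) := by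
    intro v hv
    rcases Finset.mem_union.1 hv with hv | hv
    · obtain ⟨l, hl, hlv⟩ := hcov ⟨v, by simpa using hv⟩
      obtain ⟨q, hq⟩ := hKc.exists_walk_length_eq_dist l ⟨v, by simpa using hv⟩
      have h1 : Within G D₀ l.1 v d := ⟨l.2, by simpa using hv, q, hq.trans_le hlv⟩
      rw [two_mul]
      exact (hland l hl).trans (h1.mono hsub le_rfl)
    · obtain ⟨l, hl, hvl⟩ := Finset.mem_biUnion.1 hv
      have hvl : v ∈ (p l).support := by simpa using hvl
      refine (within_of_walk ((p l).takeUntil v hvl) fun x hx => ?_).mono subset_rfl ?_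
      · exact Finset.mem_union_right _ (Finset.mem_biUnion.2
          ⟨l, hl, by simpa using (p l).support_takeUntil_subset_support hvl hx⟩)
      · have := (p l).length_takeUntil_le_length hvl
        have := hp l
        omega
  obtain ⟨hconn, hdiam⟩ := connected_of_within (hsub hr0) hwithin
  refine ⟨D, ⟨hconn, fun v hv => ?_⟩, hsub, ?_, by omega⟩
  · obtain ⟨u, hu, huv⟩ := h₀.2 v fun h => hv (hsub h)
    exact ⟨u, hsub hu, huv⟩
  · have h1 : D.card ≤ D₀.card + (I.erase r).card * (d + 1) := by
      refine (Finset.card_union_le _ _).trans (Nat.add_le_add_left ?_ _)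
      refine Finset.card_biUnion_le_card_mul _ _ _ fun l _ => ?_
      refine (List.toFinset_card_le _).trans ?_
      rw [SimpleGraph.Walk.length_support]
      exact Nat.succ_le_succ (hp l)
    have h2 : (I.erase r).card = I.card - 1 := Finset.card_erase_of_mem hrI
    by_cases h3 : 2 ≤ I.card
    · have h4 := card_mul_le_of_separated hKc hsep h3
      have h5 : Fintype.card (D₀ : Set V) = D₀.card := by simp
      rw [h5] at h4
      have h6 : (I.erase r).card * (d + 1) ≤ I.card * (2 * (d / 2 + 1)) :=
        Nat.mul_le_mul (by omega) (by omega)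
      have h7 : I.card * (2 * (d / 2 + 1)) = 2 * (I.card * (d / 2 + 1)) := by ring
      omega
    · rw [h2, (by omega : I.card - 1 = 0)] at h1
      omega

/-- A breadth-first tree of G[D], with every other node attached to a node that dominates it. -/
theorem exists_arborescence {D : Finset V} (hD : IsCDS G D) : Nonempty (Arborescence G D) := by
  classical
  set K := G.induce (D : Set V) with hK
  have hKc : K.Connected := hD.1
  obtain ⟨r⟩ := hKc.nonempty
  choose! dom hdom using hD.2
  have hdomD : ∀ v, v ∉ D → dom v ∈ (D : Set V) := fun v hv => by simpa using (hdom v hv).1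
  set dep : V → ℕ := fun v => if h : v ∈ D then K.dist r ⟨v, by simpa using h⟩
    else K.dist r ⟨dom v, hdomD v h⟩ + 1 with hdep
  have hdepD : ∀ v (h : v ∈ (D : Set V)), dep v = K.dist r ⟨v, h⟩ := fun v h =>
    dif_pos (by simpa using h)
  have hpar : ∀ v, v ≠ r.1 → ∃ u ∈ D, G.Adj v u ∧ dep v = dep u + 1 := by
    intro v hv
    by_cases h : v ∈ D
    · have h' : v ∈ (D : Set V) := by simpa using h
      obtain ⟨p, hp⟩ := hKc.exists_walk_length_eq_dist ⟨v, h'⟩ r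
      cases p with
      | nil => exact absurd rfl hv
      | @cons _ u _ hadj q =>
        have hadj' : G.Adj v u.1 := hadj
        refine ⟨u.1, by simp, hadj', ?_⟩
        have hu : dep u.1 = K.dist r u := hdepD u.1 u.2
        rw [hdepD v h', hu, K.dist_comm, ← hp]
        have h1 := SimpleGraph.dist_le q
        have h2 := hKc.dist_triangle (u := ⟨v, h'⟩) (v := u) (w := r)
        rw [← hp, SimpleGraph.dist_eq_one_iff_adj.2 hadj] at h2
        rw [SimpleGraph.Walk.length_cons] at h2 ⊢
        rw [K.dist_comm (u := r)]
        omega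
    · refine ⟨dom v, (hdom v h).1, (hdom v h).2, ?_⟩
      rw [hdepD _ (hdomD v h)]
      exact dif_neg h
  choose! par hpar using hpar
  refine ⟨⟨r.1, fun v => if v = r.1 then r.1 else par v, dep, by simp, if_pos rfl,
    ?_, ?_, ?_, ?_, ?_⟩⟩
  · rw [hdepD r.1 r.2]; simp
  · intro v hv
    rw [if_neg hv]
    exact (hpar v hv).1
  · intro v hv
    rw [if_neg hv]
    exact (hpar v hv).2.1
  · intro v hv
    rw [if_neg hv]
    exact (hpar v hv).2.2
  · intro v
    simp only [hdep]
    split_ifs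
    · exact (dist_le_diam_of_connected hKc _ _).trans (Nat.le_succ _)
    · exact Nat.succ_le_succ (dist_le_diam_of_connected hKc _ _)

end Backbone

/-! ### Numerical estimates -/

/-- A constant below 2 matters: it leaves a factor exp(δ/(2μ)) of the final bound free for the
logarithm in `log_div_le`. -/
theorem exp_neg_le_one_sub {x : ℝ} (h0 : 0 ≤ x) (h1 : x ≤ 1 / 2) :
    Real.exp (-(3 / 2 * x)) ≤ 1 - x := by
  have h2 := Real.quadratic_le_exp_of_nonneg (by positivity : 0 ≤ 3 / 2 * x)
  rw [Real.exp_neg, inv_le_comm₀ (Real.exp_pos _) (by linarith)]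
  refine le_trans ?_ h2
  rw [inv_le_iff_one_le_mul₀ (by linarith)]
  nlinarith [mul_nonneg h0 (by linarith : 0 ≤ 1 / 2 - x), mul_nonneg h0 h0,
    mul_nonneg (mul_nonneg h0 h0) (by linarith : 0 ≤ 1 / 2 - x)]

theorem le_two_mul_one_sub_exp {t ε : ℝ} (ht : 0 ≤ t) (h1 : ε ≤ 1) (h2 : ε ≤ t) :
    ε ≤ 2 * (1 - Real.exp (-t)) := by
  have h3 : Real.exp (-t) ≤ 1 / (1 + t) := by
    rw [Real.exp_neg, one_div]
    exact inv_anti₀ (by linarith) (by linarith [Real.add_one_le_exp t])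
  have h4 : 1 - 1 / (1 + t) = t / (1 + t) := by field_simp; ring
  have h5 : ε / 2 ≤ t / (1 + t) := by
    rw [div_le_div_iff₀ two_pos (by linarith)]
    nlinarith
  linarith

theorem one_le_exp_mul_pow {x f : ℝ} {δ n : ℕ} (h0 : 0 ≤ x) (h1 : x ≤ 1 / 2)
    (h : x * (δ * n) ≤ f) : 1 ≤ Real.exp (3 / 2 * f) * (1 - x) ^ (δ * n) := by
  have h2 := pow_le_pow_left₀ (Real.exp_pos _).le (exp_neg_le_one_sub h0 h1) (δ * n)
  rw [← Real.exp_nat_mul] at h2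
  refine le_trans ?_ (mul_le_mul_of_nonneg_left h2 (Real.exp_pos _).le)
  rw [← Real.exp_add]
  refine Real.one_le_exp ?_
  push_cast
  linarith

/-- The logarithm is at most linear in `f`, since 8δ ≤ exp(5 + 2f) in both cases: 8 · 16 = 128 ≤ e⁵,
or δ ≤ f² ≤ exp(2f). A linear function of `f` is absorbed by exp(f/2), and 1/p takes the remaining
exp(3f/2). -/
theorem log_div_le {δ p f : ℝ} (hδ : 1 ≤ δ) (hp0 : 0 < p) (hf : 0 ≤ f)
    (hp : 1 ≤ Real.exp (3 / 2 * f) * p) (h : δ ≤ 16 ∨ δ ≤ f ^ 2) :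
    Real.log (2 * (δ + 3) / p) / p ≤ 7 * Real.exp (2 * f) := by
  have hp' : 1 / p ≤ Real.exp (3 / 2 * f) := by rwa [div_le_iff₀ hp0]
  have he5 : (128 : ℝ) ≤ Real.exp 5 := by
    have h1 := Real.exp_one_gt_d9
    have h2 : Real.exp 5 = Real.exp 1 ^ 5 := by rw [← Real.exp_nat_mul]; norm_num
    rw [h2]
    calc (128 : ℝ) ≤ 2.7 ^ 5 := by norm_num
      _ ≤ _ := pow_le_pow_left₀ (by norm_num) (by linarith) 5
  have h8 : 8 * δ ≤ Real.exp 5 * Real.exp (2 * f) := by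
    rcases h with h | h
    · have : 1 ≤ Real.exp (2 * f) := Real.one_le_exp (by linarith)
      nlinarith [Real.exp_pos 5]
    · have h1 : f ≤ Real.exp f := by linarith [Real.add_one_le_exp f]
      have h2 : f ^ 2 ≤ Real.exp (2 * f) := by
        have : Real.exp (2 * f) = Real.exp f ^ 2 := by rw [← Real.exp_nat_mul]; norm_num
        rw [this]
        exact pow_le_pow_left₀ hf h1 2
      have h3 := Real.exp_pos (2 * f)
      nlinarith
  have hlog : Real.log (2 * (δ + 3) / p) ≤ 5 + 2 * f + 3 / 2 * f := by
    rw [Real.log_le_iff_le_exp (by positivity), Real.exp_add, Real.exp_add]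
    calc 2 * (δ + 3) / p = 2 * (δ + 3) * (1 / p) := by ring
      _ ≤ 8 * δ * (1 / p) := mul_le_mul_of_nonneg_right (by linarith) (by positivity)
      _ ≤ _ := mul_le_mul h8 hp' (by positivity) (by positivity)
  have h9 : 5 + 2 * f + 3 / 2 * f ≤ 7 * Real.exp (f / 2) := by
    linarith [Real.add_one_le_exp (f / 2)]
  have h10 : Real.exp (2 * f) = Real.exp (f / 2) * Real.exp (3 / 2 * f) := by
    rw [← Real.exp_add]; congr 1; ring
  calc Real.log (2 * (δ + 3) / p) / p = Real.log (2 * (δ + 3) / p) * (1 / p) := by ring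
    _ ≤ 7 * Real.exp (f / 2) * Real.exp (3 / 2 * f) :=
        mul_le_mul (hlog.trans h9) hp' (by positivity) (by positivity)
    _ = _ := by rw [h10]; ring

/-! ### Comparison of the protocol with the optima -/

namespace Network

variable {V : Type} [Fintype V] [DecidableEq V] {N : Network V} [DecidableRel N.graph.Adj]

/-- The probabilities of conflicts in a slot. -/
theorem exists_conflict_bounds {Δ δ : ℕ} {μ : ℝ} (hμ : 0 < μ) (hm : (N.slots : ℝ) = μ * Δ)
    (hm2 : 2 ≤ N.slots) (hΔ : ∀ v, N.graph.degree v ≤ Δ) (hδ1 : 1 ≤ δ)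
    (hδ : ∀ v ∈ N.backbone, N.graph.degree v ≤ δ) :
    ∃ ε p : ℝ, 0 ≤ ε ∧ ε ≤ 1 / μ ∧ 0 < p ∧ ε ≤ 1 - p ∧
      1 ≤ Real.exp (3 / 2 * (δ / μ)) * p ∧
      (∀ v w, N.graph.Adj w v →
        prob (fun x : V → Fin N.slots => ¬ NoConflict N.graph x v w) ≤ ε) ∧
      ∀ v ∈ N.backbone, p ≤ prob (fun x : V → Fin N.slots => AllClear N.graph x v) := by
  have : Nonempty (Fin N.slots) := ⟨⟨0, by omega⟩⟩
  have hmR : (2 : ℝ) ≤ N.slots := by exact_mod_cast hm2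
  have hm0 : (0 : ℝ) < N.slots := by linarith
  set x : ℝ := 1 / N.slots with hx
  have hx0 : 0 ≤ x := by positivity
  have hx1 : x ≤ 1 / 2 := one_div_le_one_div_of_le two_pos hmR
  have hxΔ : x * Δ = 1 / μ := by
    rw [hx, div_mul_eq_mul_div, one_mul, div_eq_div_iff hm0.ne' hμ.ne', hm]; ring
  have hΔ1 : ((Δ - 1 : ℕ) : ℝ) ≤ Δ := by exact_mod_cast Nat.sub_le _ _
  have hq0 : 0 < (1 - x) ^ (Δ - 1) := pow_pos (by linarith) _
  have hq1 : (1 - x) ^ (Δ - 1) ≤ 1 := pow_le_one₀ (by linarith) (by linarith)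
  refine ⟨1 - (1 - x) ^ (Δ - 1), (1 - x) ^ (δ * (Δ - 1)), by linarith, ?_,
    pow_pos (by linarith) _, ?_, ?_, ?_, ?_⟩
  -- By Bernoulli's inequality ε ≤ (Δ - 1)/m, which is at most 1/μ because m = μΔ.
  · have h1 := one_add_mul_le_pow (by linarith : -2 ≤ -x) (Δ - 1)
    have h2 := mul_le_mul_of_nonneg_left hΔ1 hx0
    rw [← sub_eq_add_neg] at h1
    linarith
  · have : (1 - x) ^ (δ * (Δ - 1)) ≤ (1 - x) ^ (Δ - 1) :=
      pow_le_pow_of_le_one (by linarith) (by linarith) (Nat.le_mul_of_pos_left _ hδ1)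
    linarith
  · refine one_le_exp_mul_pow hx0 hx1 ?_
    have h1 : x * ((Δ - 1 : ℕ) : ℝ) ≤ 1 / μ := hxΔ ▸ mul_le_mul_of_nonneg_left hΔ1 hx0
    have h2 := mul_le_mul_of_nonneg_left h1 (Nat.cast_nonneg δ : (0 : ℝ) ≤ δ)
    rw [mul_one_div] at h2
    linarith
  · intro v w h
    rw [prob_not]
    have := pow_le_prob_noConflict N.graph (by omega : 1 ≤ N.slots) hΔ h
    linarith
  · exact fun v hv => pow_le_prob_allClear N.graph (by omega) hΔ (hδ v hv)

theorem two_mul_sources_le (hcS : N.compression ≤ N.sources.card) :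
    N.compression * N.numItems ≤ 2 * N.sources.card := by
  unfold numItems
  have := Nat.mul_div_le N.sources.card N.compression
  rw [mul_add, mul_one]
  omega

variable [Nontrivial V] {Δ δ : ℕ} {μ : ℝ} {D₀ : Finset V}

theorem lintegral_totalMessages_gossip_le (hG : N.graph.Connected) (hc : 1 ≤ N.compression)
    (hcS : N.compression ≤ N.sources.card) (hμ : 0 < μ) (hm : (N.slots : ℝ) = μ * Δ)
    (hm2 : 2 ≤ N.slots) (hΔ : ∀ v, N.graph.degree v ≤ Δ) (hδ1 : 1 ≤ δ)
    (hδ : ∀ v ∈ N.backbone, N.graph.degree v ≤ δ) {α : ℝ} (h₀ : IsCDS N.graph D₀)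
    (hα : (D₀.card : ℝ) ≤ α * minCDS N.graph) (hD : IsShortBackbone N.graph D₀ N.backbone)
    {Ω : Type} [MeasurableSpace Ω] {Pr : Measure Ω} [IsProbabilityMeasure Pr]
    {X : ℕ → V → Ω → Fin N.slots} (hX : IsUniformDraw Pr X) :
    ∫⁻ ω, N.totalMessages gossip (fun t v => X t v ω) ∂Pr ≤ ENNReal.ofReal
      (10000 * (α * mOpt N.graph N.sources N.compression * Real.exp (2 * δ / μ) *
        (1 + δ * (1 - Real.exp (-1 / μ))))) := by
  have : Nonempty (Fin N.slots) := ⟨⟨0, by omega⟩⟩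
  obtain ⟨ε, p, hε0, hεμ, hp0, hεp, hpf, hε, hp⟩ := exists_conflict_bounds hμ hm hm2 hΔ hδ1 hδ
  refine (lintegral_totalMessages_le hc hX hδ hε0 hε hp0 hεp hp).trans
    (ENNReal.ofReal_le_ofReal ?_)
  set M : ℝ := (mOpt N.graph N.sources N.compression : ℝ) with hM
  have hcR : (1 : ℝ) ≤ N.compression := by exact_mod_cast hc
  have hmin : (1 : ℝ) ≤ minCDS N.graph := by exact_mod_cast one_le_minCDS h₀
  have hmin₀ : (minCDS N.graph : ℝ) ≤ D₀.card := by exact_mod_cast minCDS_le h₀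
  -- `D₀` is itself a CDS, so its size is at least the minimum, which is positive.
  have hα1 : 1 ≤ α := by
    by_contra h
    push Not at h
    nlinarith
  have hM0 : 0 ≤ M := Nat.cast_nonneg _
  have hk : (N.sources.card : ℝ) ≤ α * M := by
    have : (N.sources.card : ℝ) ≤ M := by
      rw [hM]
      exact_mod_cast card_le_mOpt hG hc
    nlinarith
  -- The 6 is 3 · 2: the backbone has at most 3α `minCDS` nodes, and rounding up at most doubles the
  -- number of items.
  have hDL : (N.backbone.card * N.numItems : ℝ) ≤ 6 * (α * M) := by
    have h1 : (N.sources.card : ℝ) * minCDS N.graph ≤ N.compression * M := by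
      rw [hM]
      exact_mod_cast card_mul_minCDS_le hG hc
    have h2 : (N.compression : ℝ) * N.numItems ≤ 2 * N.sources.card := by
      exact_mod_cast two_mul_sources_le hcS
    have h3 : (N.backbone.card : ℝ) ≤ 3 * D₀.card := by exact_mod_cast hD.2.2.1
    have h4 : (N.backbone.card : ℝ) ≤ 3 * (α * minCDS N.graph) := by linarith
    refine le_of_mul_le_mul_left ?_ (by linarith : (0 : ℝ) < N.compression)
    calc (N.compression : ℝ) * (N.backbone.card * N.numItems)
        = N.backbone.card * (N.compression * N.numItems) := by ring
      _ ≤ 3 * (α * minCDS N.graph) * (2 * N.sources.card) :=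
          mul_le_mul h4 h2 (by positivity) (by positivity)
      _ = 6 * α * (N.sources.card * minCDS N.graph) := by ring
      _ ≤ 6 * α * (N.compression * M) := mul_le_mul_of_nonneg_left h1 (by linarith)
      _ = _ := by ring
  set W := α * M with hW
  have hW0 : 0 ≤ W := mul_nonneg (by linarith) hM0
  set z := 1 - Real.exp (-1 / μ) with hz
  have hεz : ε ≤ 2 * z := by
    rw [hz, neg_div]
    exact le_two_mul_one_sub_exp (by positivity) (by linarith) hεμ
  have hd0 : (0 : ℝ) ≤ δ := Nat.cast_nonneg _
  have hdε : (δ : ℝ) * ε ≤ 2 * (δ * z) := by nlinarith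
  have hdε0 : (0 : ℝ) ≤ δ * ε := mul_nonneg hd0 hε0
  have hf0 : (0 : ℝ) ≤ δ / μ := by positivity
  have hE : 1 / p ≤ Real.exp (2 * δ / μ) := by
    rw [div_le_iff₀ hp0]
    refine hpf.trans (mul_le_mul_of_nonneg_right (Real.exp_le_exp.2 ?_) hp0.le)
    rw [mul_div_assoc]
    linarith
  have hp1 : (0 : ℝ) < 1 / p := by positivity
  calc 2 / p * (N.backbone.card * N.numItems + 2 * N.sources.card) +
        (7 + 13 * (δ * ε)) / p * (N.backbone.card * N.numItems)
      = 1 / p * (2 * (N.backbone.card * N.numItems + 2 * N.sources.card) +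
        (7 + 13 * (δ * ε)) * (N.backbone.card * N.numItems)) := by ring
    _ ≤ 1 / p * (2 * (6 * W + 2 * W) + (7 + 13 * (2 * (δ * z))) * (6 * W)) := by
        refine mul_le_mul_of_nonneg_left (add_le_add (by linarith) ?_) hp1.le
        exact mul_le_mul (by linarith) hDL (by positivity) (by linarith)
    _ ≤ Real.exp (2 * δ / μ) * (10000 * (W * (1 + δ * z))) := by
        refine mul_le_mul hE ?_ ?_ (Real.exp_pos _).le
        · nlinarith [mul_nonneg hW0 (by linarith : (0 : ℝ) ≤ δ * z)]
        · have : (0 : ℝ) ≤ δ * z := by linarith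
          positivity
    _ = _ := by ring

theorem lintegral_completionTime_gossip_le (hG : N.graph.Connected) (hc : 1 ≤ N.compression)
    (hcS : N.compression ≤ N.sources.card) (hμ : 0 < μ) (hm : (N.slots : ℝ) = μ * Δ)
    (hm2 : 2 ≤ N.slots) (hΔ : ∀ v, N.graph.degree v ≤ Δ) (hδ1 : 1 ≤ δ)
    (hδ : ∀ v ∈ N.backbone, N.graph.degree v ≤ δ)
    (hD : IsShortBackbone N.graph D₀ N.backbone)
    {Ω : Type} [MeasurableSpace Ω] {Pr : Measure Ω} [IsProbabilityMeasure Pr]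
    {X : ℕ → V → Ω → Fin N.slots} (hX : IsUniformDraw Pr X) :
    ∫⁻ ω, N.completionTime gossip (fun t v => X t v ω) ∂Pr ≤ ENNReal.ofReal
      (10000 * (sOpt N.graph N.sources N.compression * (μ * Δ) * Real.exp (2 * δ / μ))) := by
  have : Nonempty (Fin N.slots) := ⟨⟨0, by omega⟩⟩
  obtain ⟨ε, p, hε0, hεμ, hp0, hεp, hpf, hε, hp⟩ := exists_conflict_bounds hμ hm hm2 hΔ hδ1 hδ
  have hS : N.sources.Nonempty := Finset.card_pos.1 (by omega)
  set H := (N.graph.induce (N.backbone : Set V)).diam + 1 with hH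
  have hdepth : ∀ v, N.tree.depth v ≤ H := N.tree.depth_le
  set s := sOpt N.graph N.sources N.compression with hs
  have hs1 : 1 ≤ s := one_le_sOpt hG hc hS
  -- The diameter of the backbone is at most 4 diam G ≤ 8s, and 1 ≤ s covers the extra level.
  have hHs : H ≤ 9 * s := by
    have h1 : N.graph.diam ≤ 2 * s := diam_le_two_mul_sOpt hG hc hS
    have h2 := hD.2.2.2
    omega
  have hLs : N.numItems ≤ 3 * s := by
    have h1 : N.sources.card / N.compression ≤ s + 1 := by
      refine Nat.div_le_of_le_mul ?_
      have : N.sources.card ≤ 1 + N.compression * s := card_le_sOpt hG hc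
      rw [mul_add, mul_one]
      omega
    unfold numItems
    omega
  have hHsR : (H : ℝ) ≤ 9 * s := by exact_mod_cast hHs
  have hLsR : (N.numItems : ℝ) ≤ 3 * s := by exact_mod_cast hLs
  have hs1R : (1 : ℝ) ≤ s := by exact_mod_cast hs1
  have hf0 : (0 : ℝ) ≤ δ / μ := by positivity
  have hd1 : (1 : ℝ) ≤ δ := by exact_mod_cast hδ1
  set E := Real.exp (2 * δ / μ) with hE
  have hE' : E = Real.exp (2 * (δ / μ)) := by rw [hE, mul_div_assoc]
  have hE1 : 1 ≤ E := by rw [hE']; exact Real.one_le_exp (by linarith)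
  have hpE : 1 / p ≤ E := by
    rw [div_le_iff₀ hp0]
    refine hpf.trans (mul_le_mul_of_nonneg_right ?_ hp0.le)
    rw [hE']
    exact Real.exp_le_exp.2 (by linarith)
  have hsE : (s : ℝ) ≤ s * E := le_mul_of_one_le_right (by linarith) hE1
  have hEs : E ≤ s * E := le_mul_of_one_le_left (by linarith) hs1R
  rw [← hm]
  -- The two cases need at most 36·9 + 24·3 + 26 = 422 and 35·14 + 3 = 493 rounds per unit of s E,
  -- both below 625 = 10000/16.
  have hrw : (10000 : ℝ) * (s * N.slots * E) = 16 * N.slots * (625 * (s * E)) := by ring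
  rw [hrw]
  by_cases hfew : 16 ≤ δ ∧ ε ^ 2 * δ ≤ 1
  · refine (lintegral_completionTime_le_of_few_conflicts hc hX hδ hdepth hε0 hε hfew.1
      hfew.2).trans (ENNReal.ofReal_le_ofReal (mul_le_mul_of_nonneg_left ?_ (by positivity)))
    linarith
  · refine (lintegral_completionTime_le_of_allClear hc hX hδ hdepth hε0 hε hp0 (by linarith) hεp
      hp).trans (ENNReal.ofReal_le_ofReal (mul_le_mul_of_nonneg_left ?_ (by positivity)))
    -- If δ ≥ 16 but streaming is not available, then 1 < ε²δ ≤ δ/μ², and multiplication by δ gives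
    -- the second alternative.
    have hcase : (δ : ℝ) ≤ 16 ∨ (δ : ℝ) ≤ (δ / μ) ^ 2 := by
      by_cases h16 : 16 ≤ δ
      · right
        have h1 : ¬ ε ^ 2 * δ ≤ 1 := fun h => hfew ⟨h16, h⟩
        push Not at h1
        have h2 : ε ^ 2 ≤ (1 / μ) ^ 2 := pow_le_pow_left₀ hε0 hεμ 2
        have h3 : 1 ≤ (1 / μ) ^ 2 * δ :=
          h1.le.trans (mul_le_mul_of_nonneg_right h2 (by linarith))
        calc (δ : ℝ) ≤ δ * ((1 / μ) ^ 2 * δ) := le_mul_of_one_le_right (by linarith) h3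
          _ = (δ / μ) ^ 2 := by ring
      · left
        exact_mod_cast (by omega : δ ≤ 16)
    have hlog := log_div_le hd1 hp0 hf0 hpf hcase
    rw [← hE'] at hlog
    have h1 : 2 * Real.log (2 * (δ + 3) / p) / p ≤ 14 * E := by
      rw [mul_div_assoc]; linarith
    have h2 : (3 * H + 2 * N.numItems + 2 : ℝ) ≤ 35 * s := by linarith
    have h3 : (3 * H + 2 * N.numItems + 2 : ℝ) * (2 * Real.log (2 * (δ + 3) / p) / p) ≤
        35 * s * (14 * E) := by
      refine (mul_le_mul_of_nonneg_left h1 (by positivity)).trans ?_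
      exact mul_le_mul_of_nonneg_right h2 (by linarith)
    have h4 : 2 / p = 2 * (1 / p) := by ring
    rw [h4]
    linarith

end Network

end RadioGossip

theorem mainTheorem7 :
    ∃ (P : RadioGossip.Protocol) (C : ℝ), 0 < C ∧
      ∀ (V : Type) [Fintype V] [DecidableEq V] [Nontrivial V]
        (G : SimpleGraph V) [DecidableRel G.Adj] (_ : G.Connected) (ident : V ↪ ℕ)
        (S : Finset V) (c : ℕ) (_ : 1 ≤ c) (_ : c ≤ S.card)
        (μ : ℝ) (m : ℕ) (_ : (m : ℝ) = μ * G.maxDegree) (_ : 2 ≤ m)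
        (α : ℝ) (D₀ : Finset V) (_ : RadioGossip.IsCDS G D₀)
        (_ : (D₀.card : ℝ) ≤ α * RadioGossip.minCDS G),
        (∃ D, RadioGossip.IsShortBackbone G D₀ D ∧ Nonempty (RadioGossip.Arborescence G D)) ∧
        ∀ (D : Finset V) (_ : RadioGossip.IsShortBackbone G D₀ D)
          (T : RadioGossip.Arborescence G D) (N : RadioGossip.Network V)
          (_ : N = ⟨G, ident, S, c, m, D, T⟩) (δ : ℕ) (_ : δ = (D ∪ S).sup fun v => G.degree v),
          N.GathersThenSpreads P ∧
          ∀ (Ω : Type) [MeasurableSpace Ω] (Pr : MeasureTheory.Measure Ω)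
            [MeasureTheory.IsProbabilityMeasure Pr] (X : ℕ → V → Ω → Fin N.slots)
            (_ : RadioGossip.IsUniformDraw Pr X),
            (∫⁻ ω, N.totalMessages P (fun t v => X t v ω) ∂Pr ≤
              ENNReal.ofReal (C * (α * RadioGossip.mOpt G S c * Real.exp (2 * δ / μ) *
                (1 + δ * (1 - Real.exp (-1 / μ)))))) ∧
            (∫⁻ ω, N.completionTime P (fun t v => X t v ω) ∂Pr ≤
              ENNReal.ofReal (C * (RadioGossip.sOpt G S c * (μ * G.maxDegree) *
                Real.exp (2 * δ / μ)))) := by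
  refine ⟨RadioGossip.gossip, 10000, by norm_num, ?_⟩
  intro V _ _ _ G inst hG ident S c hc hcS μ m hm hm2 α D₀ h₀ hα
  obtain ⟨D, hD⟩ := RadioGossip.exists_isShortBackbone hG h₀
  refine ⟨⟨D, hD, RadioGossip.exists_arborescence hD.1⟩, ?_⟩
  intro D hD T N hN δ hδ
  subst hN
  have hmR : (2 : ℝ) ≤ μ * G.maxDegree := by rw [← hm]; exact_mod_cast hm2
  -- Positivity of μ follows from 2 ≤ m = μΔ.
  have hμ : 0 < μ := by
    by_contra h
    push Not at h
    have := mul_nonpos_of_nonpos_of_nonneg h (Nat.cast_nonneg G.maxDegree : (0 : ℝ) ≤ _)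
    linarith
  have hdeg : ∀ v ∈ D, G.degree v ≤ δ := fun v hv => by
    rw [hδ]
    exact Finset.le_sup (f := fun v => G.degree v) (Finset.mem_union_left _ hv)
  have hδ1 : 1 ≤ δ := (hG.preconnected.degree_pos_of_nontrivial T.root).trans_le (hdeg _ T.root_mem)
  refine ⟨RadioGossip.Network.gathersThenSpreads_gossip hc, fun Ω _ Pr _ X hX => ⟨?_, ?_⟩⟩
  · exact @RadioGossip.Network.lintegral_totalMessages_gossip_le V _ _
      ⟨G, ident, S, c, m, D, T⟩ inst _ G.maxDegree δ μ D₀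
      hG hc hcS hμ hm hm2 (fun v => G.degree_le_maxDegree v) hδ1 hdeg α h₀ hα hD Ω _ Pr _ X hX
  · exact @RadioGossip.Network.lintegral_completionTime_gossip_le V _ _
      ⟨G, ident, S, c, m, D, T⟩ inst _ G.maxDegree δ μ D₀
      hG hc hcS hμ hm hm2 (fun v => G.degree_le_maxDegree v) hδ1 hdeg hD Ω _ Pr _ X hX
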